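/- **Model.** A uniform RIV model consists of $\sigma\ge 1$ segments $I_t=[t,t+1]$, $t\in[\sigma]=\{1,\dots,\sigma\}$, and probabilities $p_t\ge 0$ with $\sum_t p_t=1$. Candidates form a finite set $C\subset[1,\sigma+1]$ with $|C|=m$; let $C_t=C\cap I_t$. Each of $n\ge1$ voters $v$ independently picks a segment $I_t$ with probability $p_t$ and two independent uniform points of it; $a_v\le b_v$ are these points in increasing order, $A^*(v)=[a_v,b_v]$ and $A(v)=A^*(v)\cap C$. The target committee size is $k$ with $1\le k\le m$. A committee $W\subseteq C$ satisfies PJR+ if $|W|=k$ and, for every $\ell\in[k]$ and every group $G$ of voters with $|G|\ge n\ell/k$ and $\bigcap_{v\in G}A(v)\not\subseteq W$, we have $|W\cap\bigcup_{v\in G}A(v)|\ge\ell$. The algorithm knows the model and $C$; it learns about voters only through point queries ("is $x\in A(v)$?", $x\in C$) and interval queries ("is $A^*(v)\subseteq[x,y]$?"). Ties are broken arbitrarily by a fixed rule. For $x\in I_t$ and a finite set $T$, let $x^-_T=\max(\{c\in T:c\le x\}\cup\{t\})$ and $x^+_T=\min(\{c\in T:c\ge x\}\cup\{t+1\})$,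 where $t$ is the index of the segment under consideration. **Segment search.** Binary search with interval queries locates the segment of $v$ within a given list of segments, or reports that it is not in the list. **Resolving $v$ for positions $P$.** Locate the segment $I_t$ of $v$ among those that meet $P$ (return $\varnothing$ if there is none). For $i=1,\dots,\lceil\log_2|P|\rceil$ and $j=1,\dots,2^i$, let $x=t+j/2^i$ and make point queries at $x^-_C$ and $x^+_C$ (a segment endpoint that is not a candidate counts as disapproved, without a query). If one of the two is approved, find by binary searches with point queries on $P\cap(t+\frac{j-1}{2^i},x)$ and $P\cap(x,t+\frac{j+1}{2^i})$ the extreme members of $P$ that $v$ approves, and return $P\cap A(v)$; otherwise make an interval query with $x^-_C,x^+_C$, and return $\varnothing$ if it is approved. If nothing has been returned after all rounds, make a point query at every candidate in $P\cap I_t$ and return the approved ones. **Algorithm.** 1. For each $t$ let $k_t=\lfloor p_tk\rfloor$; build $\widehat W_t$ by adding, for $\xi=2,\dots,k_t+1$, the not yet selected candidate of $C_t$ closest to $t+\frac{2\xi-1}{2(k_t+2)}$ (if one is left). Let $\widehat W=\bigcup_t\widehat W_t$, and let $P_t$ consist of $\widehat W_t$ and the $30k$ positions $\big(t+\frac{j}{15k}\big)^{\pm}_{C_t}$,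 $j\in[15k]$. 2. Locate the segment $I_t$ of each voter by segment search over all $\sigma$ segments, and resolve her for $P_t$. Let $u$ be the number of voters who approved no query made in this resolution after its segment search. 3. For $\ell\in[k]$, $c\in C\setminus\widehat W$ and $0\le j<\ell$, let $\rho=|\{w\in\widehat W:w<c\}|$, let $R$ be the set of elements of $\widehat W$ of index $i$ with $\rho-j\le i<\rho+\ell-1-j$ (sorted, indices from $0$), and let $S=\widehat W\setminus R$. Let $s_{\ell,c,j}$ be the number of voters who approved some query made in the resolution after its segment search and for whom approving $c$ and disapproving all of $S$ is possible: if $\varphi_2,\varphi_3$ are the least and the greatest approved point query positions and $D$ is the set of disapproved ones, then $(\varphi_1,\varphi_2]\cap(c^-_S,c]\ne\varnothing$ and $[\varphi_3,\varphi_4)\cap[c,c^+_S)\ne\varnothing$, where $\varphi_1=(\varphi_2)^-_D$ and $\varphi_4=(\varphi_3)^+_D$ (impossible if no point query was approved). 4. If $s_{\ell,c,j}+u<n\ell/k$ for all $\ell,c,j$, output $\widehat W$, completed arbitrarily to $k$ candidates. Otherwise resolve every voter for $C$, and output the committee of the Method of Equal Shares for the ballots $A(v)$ (budgets $k/n$,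 unit prices), completed arbitrarily to $k$ candidates. In the number $\lceil\log_2|P_t|\rceil$ of rounds, $|P_t|$ may be counted with repetitions (so that $|P_t|=|\widehat W_t|+30k$) or as the cardinality of a set. **Theorem.** There are absolute constants $C_0,C_1,c_0>0$ such that the following holds for every uniform RIV model and all $C,n,k$ as above. (a) With probability $1$ the algorithm outputs a committee that satisfies PJR+. (b) If $n\ge C_0k^2\log m$ and, in case $|P_t|$ is counted as the cardinality of a set, $|P_t|\ge15k$ for every $t$ with $p_t>0$, then the expected number of queries put to each voter is at most $C_1(1+\log(\sigma k))$, and with probability at least $1-\exp(-c_0n/k^2)$ the number of queries per voter, i.e. the total number of queries divided by $n$, is at most $C_1(1+\log(\sigma k))$. -/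

import Mathlib

open MeasureTheory

noncomputable section

namespace RIV

/-! ### Approval elections and PJR+

Candidates are (identified with) points of the real line; voters form a finite type. -/

/-- A committee `W` provides PJR+ in the election with candidate set `C`, target committee size `k`
and approval ballots `A`. -/
def PJRPlus {V : Type} [Fintype V] (C : Finset ℝ) (k : ℕ) (A : V → Finset ℝ) (W : Finset ℝ) :
    Prop :=
  W ⊆ C ∧ W.card = k ∧
    ∀ ℓ ∈ Finset.Icc 1 k, ∀ G : Finset V,
      (Fintype.card V : ℝ) * ℓ / k ≤ (G.card : ℝ) →
      (∃ c ∈ C \ W, ∀ v ∈ G, c ∈ A v) →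
      ℓ ≤ (W ∩ G.biUnion A).card

/-! ### The uniform random interval voter model -/

/-- A uniform RIV model: segment `t ∈ {1, …, σ}` is `[t, t + 1]` and is chosen with
probability `p t` (the values of `p` outside `{1, …, σ}` play no role). -/
structure UniformRIV where
  σ : ℕ
  p : ℕ → ℝ
  p_nonneg : ∀ t ∈ Finset.Icc 1 σ, 0 ≤ p t
  sum_p : ∑ t ∈ Finset.Icc 1 σ, p t = 1

/-- The uniform distribution on `[t, t + 1]`. -/
def segmentLaw (t : ℕ) : Measure ℝ := volume.restrict (Set.Icc (t : ℝ) (t + 1))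

/-- The law of the endpoints `(a, b)` of the approval interval of one voter: a segment `t` is chosen
with probability `p t`, two independent uniform points of it are drawn, and `a`, `b` are their
minimum and maximum. -/
def voterLaw (M : UniformRIV) : Measure (ℝ × ℝ) :=
  ∑ t ∈ Finset.Icc 1 M.σ, ENNReal.ofReal (M.p t) •
    ((segmentLaw t).prod (segmentLaw t)).map (fun z => (min z.1 z.2, max z.1 z.2))

/-- The law of the endpoints of `n` independent voters. -/
def profileLaw (M : UniformRIV) (n : ℕ) : Measure (Fin n → ℝ × ℝ) :=
  Measure.pi fun _ => voterLaw M

/-- The approval ballot `[a, b] ∩ C` of a voter with endpoints `(a, b)`. -/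
def ballot (C : Finset ℝ) (v : ℝ × ℝ) : Finset ℝ := C.filter fun c => v.1 ≤ c ∧ c ≤ v.2

/-- `C_t`, the candidates in segment `t`. -/
def candidatesIn (C : Finset ℝ) (t : ℕ) : Finset ℝ :=
  C.filter fun c => (t : ℝ) ≤ c ∧ c ≤ t + 1

/-- For `x` in segment `t`: the element of `T` closest to `x` from the left (`x` included), or the
left endpoint of the segment if there is none in the segment. -/
def leftNbr (t : ℕ) (T : Finset ℝ) (x : ℝ) : ℝ :=
  (insert (t : ℝ) (T.filter fun c => c ≤ x)).max' (Finset.insert_nonempty _ _)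

/-- For `x` in segment `t`: the element of `T` closest to `x` from the right (`x` included), or the
right endpoint of the segment if there is none in the segment. -/
def rightNbr (t : ℕ) (T : Finset ℝ) (x : ℝ) : ℝ :=
  (insert ((t : ℝ) + 1) (T.filter fun c => x ≤ c)).min' (Finset.insert_nonempty _ _)

/-- The index `t(x)` of the segment that contains `x`. -/
def segmentOf (x : ℝ) : ℕ := ⌊x⌋₊

/-! ### Queries and elicitation programs -/

/-- The two types of queries. -/
inductive Query where
  | point (x : ℝ)
  | interval (x y : ℝ)

open scoped Classical in
/-- The truthful answer of a voter with approval interval `[v.1, v.2]`. -/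
def answer (C : Finset ℝ) (v : ℝ × ℝ) : Query → Bool
  | .point x => decide (x ∈ ballot C v)
  | .interval x y => decide (Set.Icc v.1 v.2 ⊆ Set.Icc x y)

/-- An adaptive elicitation program: a decision tree that puts queries to voters, sees nothing of
the voters but the answers, and finally returns a value. -/
inductive Elicit (ι α : Type) : Type where
  | done (a : α) : Elicit ι α
  | ask (v : ι) (q : Query) (next : Bool → Elicit ι α) : Elicit ι α

/-- A dialogue: the queries asked, to whom, and the answers, in order. -/
abbrev Dialogue (ι : Type) := List (ι × Query × Bool)

namespace Elicit

variable {ι α β : Type}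

/-- Sequential composition. -/
def bind : Elicit ι α → (α → Elicit ι β) → Elicit ι β
  | done a, f => f a
  | ask v q next, f => ask v q fun r => bind (next r) f

/-- Return the dialogue of a program together with its result. -/
def listen : Elicit ι α → Elicit ι (α × Dialogue ι)
  | done a => done (a, [])
  | ask v q next => ask v q fun r =>
      bind (listen (next r)) fun z => done (z.1, (v, q, r) :: z.2)

/-- Execute a program on voters that answer according to `ans`: its result and its dialogue. -/
def run (ans : ι → Query → Bool) : Elicit ι α → α × Dialogue ι
  | done a => (a, [])
  | ask v q next =>
      let z := run ans (next (ans v q))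
      (z.1, (v, q, ans v q) :: z.2)

/-- Run `f v` for each voter `v` of a list and collect the results (`d` for absent voters). -/
def forEach [DecidableEq ι] (d : β) (f : ι → Elicit ι β) : List ι → Elicit ι (ι → β)
  | [] => done fun _ => d
  | v :: l => bind (f v) fun b => bind (forEach d f l) fun g => done (Function.update g v b)

end Elicit

/-- The number of queries put to voter `v` in a dialogue. -/
def queryCount {ι : Type} [DecidableEq ι] (I : Dialogue ι) (v : ι) : ℕ :=
  I.countP fun e => decide (e.1 = v)

open Elicit

section Programs

variable {ι : Type}

/-- Ask voter `v` about the position `x`. Point queries are submitted at candidate positions only: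
if `x` is a segment endpoint without a candidate, the answer is negative and no query is made. -/
def askPoint (C : Finset ℝ) (v : ι) (x : ℝ) : Elicit ι Bool :=
  if x ∈ C then ask v (.point x) done else done false

/-- Binary search with interval queries for the segment of voter `v` among those in the sorted
list; `none` if the voter lies in none of them. -/
def segmentSearch (v : ι) : List ℕ → Elicit ι (Option ℕ)
  | [] => done none
  | [t] => ask v (.interval t (t + 1)) fun r => done (if r then some t else none)
  | s :: s' :: T =>
      let mid := (T.length + 1) / 2
      ask v (.interval s ((s :: s' :: T).getD mid 0 + 1)) fun r =>
        if r then segmentSearch v ((s :: s' :: T).take (mid + 1))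
        else segmentSearch v ((s :: s' :: T).drop (mid + 1))
  termination_by T => T.length
  decreasing_by
    · simp only [List.length_take, List.length_cons]; omega
    · simp only [List.length_drop, List.length_cons]; omega

/-- Binary search with point queries for the first approved position of a sorted list whose approved
positions form a final segment. -/
def firstApproved (C : Finset ℝ) (v : ι) : List ℝ → Elicit ι (Option ℝ)
  | [] => done none
  | a :: l =>
      let mid := (a :: l).length / 2
      let x := (a :: l).getD mid 0
      bind (askPoint C v x) fun r =>
        if r then bind (firstApproved C v ((a :: l).take mid)) fun o => done (some (o.getD x))
        else firstApproved C v ((a :: l).drop (mid + 1))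
  termination_by L => L.length
  decreasing_by
    · simp only [List.length_take, List.length_cons]; omega
    · simp only [List.length_drop, List.length_cons]; omega

/-- Binary search with point queries for the last approved position of a sorted list whose approved
positions form an initial segment. -/
def lastApproved (C : Finset ℝ) (v : ι) : List ℝ → Elicit ι (Option ℝ)
  | [] => done none
  | a :: l =>
      let mid := (a :: l).length / 2
      let x := (a :: l).getD mid 0
      bind (askPoint C v x) fun r =>
        if r then
          bind (lastApproved C v ((a :: l).drop (mid + 1))) fun o => done (some (o.getD x))
        else lastApproved C v ((a :: l).take mid)
  termination_by L => L.length
  decreasing_by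
    · simp only [List.length_drop, List.length_cons]; omega
    · simp only [List.length_take, List.length_cons]; omega

/-- Ask about every position of a list; return the approved ones. -/
def askAll (C : Finset ℝ) (v : ι) : List ℝ → Elicit ι (Finset ℝ)
  | [] => done ∅
  | x :: l => bind (askPoint C v x) fun r =>
      bind (askAll C v l) fun s => done (if r then insert x s else s)

/-- The part of `P` in the open interval `(x, y)`, as a sorted list. -/
def between (P : Finset ℝ) (x y : ℝ) : List ℝ :=
  (P.filter fun c => x < c ∧ c < y).sort (· ≤ ·)

/-- The second stage of resolving a voter of segment `t` for `P`, for a list of pairs `(i, j)` that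
are still to be tried: at `x = t + j / 2 ^ i`, query the neighbouring candidates of `x`; if one is
approved, find the ends of the approval set in `P` by two binary searches; otherwise ask whether the
approval interval lies between the two neighbours. If all pairs fail, ask about all of `P`. -/
def resolveIn (C P : Finset ℝ) (v : ι) (t : ℕ) : List (ℕ × ℕ) → Elicit ι (Finset ℝ)
  | [] => askAll C v ((P.filter fun c => (t : ℝ) ≤ c ∧ c ≤ t + 1).sort (· ≤ ·))
  | (i, j) :: rest =>
      let x : ℝ := t + (j : ℝ) / 2 ^ i
      let lo := leftNbr t C x
      let hi := rightNbr t C x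
      bind (askPoint C v lo) fun r₁ => bind (askPoint C v hi) fun r₂ =>
        if r₁ || r₂ then
          bind (firstApproved C v (between P (t + ((j : ℝ) - 1) / 2 ^ i) x)) fun α =>
          bind (lastApproved C v (between P x (t + ((j : ℝ) + 1) / 2 ^ i))) fun β =>
          done (P.filter fun c =>
            α.getD (if r₁ then lo else hi) ≤ c ∧ c ≤ β.getD (if r₂ then hi else lo))
        else ask v (.interval lo hi) fun r =>
          if r then done ∅ else resolveIn C P v t rest

/-- The pairs `(i, j)` with `1 ≤ i ≤ R`, `1 ≤ j ≤ 2 ^ i`, in lexicographic order. -/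
def schedule (R : ℕ) : List (ℕ × ℕ) :=
  (List.range' 1 R).flatMap fun i => (List.range' 1 (2 ^ i)).map fun j => (i, j)

/-- The size `|P|` of a collection of positions, with repetitions counted if `multi` is true, and
as a set otherwise. -/
def size (multi : Bool) (P : Multiset ℝ) : ℕ := if multi then P.card else P.toFinset.card

/-- Resolve voter `v` for the positions `P`: find the voter's segment among those that meet `P`,
and run `⌈log₂ |P|⌉` rounds in it. Returns the approved part of `P` and the dialogue of the second
stage (the one after the segment search); the latter is `none` if the segment is not found. -/
def resolve (σ : ℕ) (C : Finset ℝ) (multi : Bool) (v : ι) (P : Multiset ℝ) :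
    Elicit ι (Finset ℝ × Option (Dialogue ι)) :=
  bind (segmentSearch v
    ((List.range' 1 σ).filter fun t : ℕ => decide (∃ c ∈ P.toFinset, (t : ℝ) ≤ c ∧ c ≤ t + 1)))
  fun o => match o with
    | none => done (∅, none)
    | some t =>
        bind (listen (resolveIn C P.toFinset v t (schedule (Nat.clog 2 (size multi P))))) fun z =>
          done (z.1, some z.2)

end Programs

/-! ### The guessed committee

`tie` is a tie-breaking rule: it selects an element of every nonempty finite set of candidates. -/

/-- The elements of `s` at which `f` is minimal. -/
def argmin (s : Finset ℝ) (f : ℝ → ℝ) : Finset ℝ := s.filter fun c => ∀ c' ∈ s, f c ≤ f c'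

/-- `k_t = ⌊p_t k⌋`. -/
def seats (M : UniformRIV) (k t : ℕ) : ℕ := ⌊M.p t * k⌋₊

/-- The committee `Ŵ_t` guessed in segment `t`: for `ξ = 2, …, k_t + 1` add a not yet selected
candidate of the segment closest to the marked point `t + (2ξ - 1) / (2 (k_t + 2))`, as long as there
is one. -/
def guessIn (M : UniformRIV) (C : Finset ℝ) (k : ℕ) (tie : Finset ℝ → ℝ) (t : ℕ) : Finset ℝ :=
  (List.range' 2 (seats M k t)).foldl
    (fun W ξ =>
      if (candidatesIn C t \ W).Nonempty then
        insert (tie (argmin (candidatesIn C t \ W)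
          fun c => |c - t - (2 * (ξ : ℝ) - 1) / (2 * ((seats M k t : ℝ) + 2))|)) W
      else W) ∅

/-- The guessed committee `Ŵ`. -/
def guess (M : UniformRIV) (C : Finset ℝ) (k : ℕ) (tie : Finset ℝ → ℝ) : Finset ℝ :=
  (Finset.Icc 1 M.σ).biUnion fun t => guessIn M C k tie t

/-- The query positions `P_t`: the candidates of `Ŵ_t`, and the left and right neighbours in `C_t`
of the points `t + j / (15 k)`, `1 ≤ j ≤ 15 k`. -/
def positions (M : UniformRIV) (C : Finset ℝ) (k : ℕ) (tie : Finset ℝ → ℝ) (t : ℕ) :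
    Multiset ℝ :=
  (guessIn M C k tie t).val +
    (Finset.Icc 1 (15 * k)).val.bind fun j =>
      {leftNbr t (candidatesIn C t) (t + (j : ℝ) / (15 * k)),
        rightNbr t (candidatesIn C t) (t + (j : ℝ) / (15 * k))}

/-! ### Validation of the guess -/

/-- The positions at which point queries of a dialogue were answered by `r`. -/
def pointAnswers {ι : Type} (r : Bool) (I : Dialogue ι) : Finset ℝ :=
  (I.filterMap fun e => match e with
    | (_, .point x, r') => if r' = r then some x else none
    | (_, .interval _ _, _) => none).toFinset

/-- Given the dialogue `I` with a voter, it is possible that the voter approves `c` and disapproves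
all of `S`. A voter whose only approved query is an interval query between neighbouring candidates
approves no candidate. -/
def Poss {ι : Type} (I : Dialogue ι) (c : ℝ) (S : Finset ℝ) : Prop :=
  c ∉ S ∧ ∃ h : (pointAnswers true I).Nonempty,
    let D := pointAnswers false I
    let φ₂ := (pointAnswers true I).min' h
    let φ₃ := (pointAnswers true I).max' h
    let φ₁ := leftNbr (segmentOf φ₂) D φ₂
    let φ₄ := rightNbr (segmentOf φ₃) D φ₃
    (Set.Ioc φ₁ φ₂ ∩ Set.Ioc (leftNbr (segmentOf c) S c) c).Nonempty ∧
      (Set.Ico φ₃ φ₄ ∩ Set.Ico c (rightNbr (segmentOf c) S c)).Nonempty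

/-- Some query of the dialogue was approved. -/
def ApprovedSome {ι : Type} (I : Dialogue ι) : Prop := ∃ e ∈ I, e.2.2 = true

/-- The slice `W[lo : hi]` of the sorted list of `W`: its elements of index `lo ≤ i < hi`, where the
first index is `0`. -/
def slice (W : Finset ℝ) (lo hi : ℤ) : Finset ℝ :=
  W.filter fun w => lo ≤ ((W.filter (· < w)).card : ℤ) ∧ ((W.filter (· < w)).card : ℤ) < hi

open scoped Classical in
/-- `u`: the number of voters that approved no query of their dialogue. -/
def unapproving {n : ℕ} (I : Fin n → Dialogue (Fin n)) : ℕ :=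
  (Finset.univ.filter fun v => ¬ ApprovedSome (I v)).card

open scoped Classical in
/-- `s_{ℓ,c,j}`: the number of voters that approved some query and that may approve `c` and no member
of the guess outside `R = Ŵ[ρ - j : ρ + ℓ - 1 - j]`, where `ρ` is the number of members to the left
of `c`. -/
def possibleCount {n : ℕ} (W : Finset ℝ) (I : Fin n → Dialogue (Fin n)) (ℓ : ℕ) (c : ℝ) (j : ℕ) :
    ℕ :=
  let ρ : ℤ := (W.filter (· < c)).card
  let R := slice W (ρ - j) (ρ + ℓ - 1 - j)
  (Finset.univ.filter fun v => ApprovedSome (I v) ∧ Poss (I v) c (W \ R)).card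

/-- The test that the guess `W` has to pass. -/
def Validated {n : ℕ} (C : Finset ℝ) (k : ℕ) (W : Finset ℝ) (I : Fin n → Dialogue (Fin n)) : Prop :=
  ∀ ℓ ∈ Finset.Icc 1 k, ∀ c ∈ C \ W, ∀ j ∈ Finset.range ℓ,
    (possibleCount W I ℓ c j : ℝ) + unapproving I < (n : ℝ) * ℓ / k

/-! ### The Method of Equal Shares -/

/-- Add candidates, one at a time, until the committee has `k` members. -/
def complete (C : Finset ℝ) (k : ℕ) (tie : Finset ℝ → ℝ) (W : Finset ℝ) : Finset ℝ :=
  (fun W' => insert (tie (C \ W')) W')^[k - W.card] W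

/-- The least `r ≥ 0` such that the supporters of `c`, each paying `r` or all that she has left, can
jointly pay the price `1` of `c`. -/
def mesPrice {n : ℕ} (A : Fin n → Finset ℝ) (b : Fin n → ℝ) (c : ℝ) : ℝ :=
  sInf {r : ℝ | 0 ≤ r ∧ 1 ≤ ∑ v ∈ Finset.univ.filter (fun v => c ∈ A v), min (b v) r}

/-- The candidates outside `W` whose supporters have enough money left to buy them. -/
def affordable {n : ℕ} (C : Finset ℝ) (A : Fin n → Finset ℝ) (W : Finset ℝ) (b : Fin n → ℝ) :
    Finset ℝ :=
  (C \ W).filter fun c => 1 ≤ ∑ v ∈ Finset.univ.filter (fun v => c ∈ A v), b v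

/-- At most `N` purchases of the Method of Equal Shares, from committee `W` and budgets `b`. -/
def mesLoop {n : ℕ} (C : Finset ℝ) (tie : Finset ℝ → ℝ) (A : Fin n → Finset ℝ) :
    ℕ → Finset ℝ → (Fin n → ℝ) → Finset ℝ
  | 0, W, _ => W
  | N + 1, W, b =>
      if (affordable C A W b).Nonempty then
        let c := tie (argmin (affordable C A W b) (mesPrice A b))
        mesLoop C tie A N (insert c W) fun v =>
          if c ∈ A v then b v - min (b v) (mesPrice A b c) else b v
      else W

/-- The Method of Equal Shares with initial budgets `k / n`, completed to a committee of size `k`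
(there are at most `|C|` purchases). -/
def mes {n : ℕ} (C : Finset ℝ) (k : ℕ) (tie : Finset ℝ → ℝ) (A : Fin n → Finset ℝ) : Finset ℝ :=
  complete C k tie (mesLoop C tie A C.card ∅ fun _ => (k : ℝ) / n)

/-! ### The algorithm -/

open scoped Classical in
/-- The algorithm: guess a committee, query every voter about the positions `P_t` of her segment,
output the guess (completed to size `k`) if it passes the test, and otherwise elicit all ballots and
run the Method of Equal Shares. -/
def findCommittee (M : UniformRIV) (C : Finset ℝ) (k n : ℕ) (tie : Finset ℝ → ℝ) (multi : Bool) :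
    Elicit (Fin n) (Finset ℝ) :=
  bind (forEach ([] : Dialogue (Fin n)) (fun v =>
      bind (segmentSearch v (List.range' 1 M.σ)) fun o => match o with
        | none => done []
        | some t =>
            bind (resolve M.σ C multi v (positions M C k tie t)) fun z => done (z.2.getD []))
    (List.finRange n)) fun I =>
  if Validated C k (guess M C k tie) I then done (complete C k tie (guess M C k tie))
  else
    bind (forEach (∅ : Finset ℝ) (fun v =>
        bind (resolve M.σ C multi v C.val) fun z => done z.1) (List.finRange n)) fun A =>
    done (mes C k tie A)

/-- The committee that the algorithm outputs on voters with endpoints `ω`. -/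
def output (M : UniformRIV) (C : Finset ℝ) (k n : ℕ) (tie : Finset ℝ → ℝ) (multi : Bool)
    (ω : Fin n → ℝ × ℝ) : Finset ℝ :=
  ((findCommittee M C k n tie multi).run fun v => answer C (ω v)).1

/-- The number of queries that the algorithm puts to voter `v`. -/
def queries (M : UniformRIV) (C : Finset ℝ) (k n : ℕ) (tie : Finset ℝ → ℝ) (multi : Bool)
    (v : Fin n) (ω : Fin n → ℝ × ℝ) : ℕ :=
  queryCount ((findCommittee M C k n tie multi).run fun v => answer C (ω v)).2 v

end RIV

end

open MeasureTheory

noncomputable section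

namespace RIV

/-! ### Execution of elicitation programs: composition, truthfulness, measurability -/

namespace Elicit

variable {ι α β : Type}

/-! Almost surely every approval interval lies in the interior of a segment of positive probability
(`GoodProfile`). All statements about the algorithm are deterministic on such profiles; probability
enters only through the law of one interval and through Hoeffding's inequality.

PJR+. If the test fails, all ballots are elicited correctly and the Method of Equal Shares is run. A
group `G` with a common unbought candidate ends with less than one unit of money, and it has spent
at most one unit on each bought candidate that some member approves, so it gets its `ℓ`
representatives (`mesLoop_spec`, `pjrPlus_mes`). If the test succeeds, suppose that `G`, `ℓ` and a
common candidate `c` violate PJR+. The ballots of `G` are intervals around `c`, so the members of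
the guess approved by someone in `G` form a block around `c` with fewer than `ℓ` elements, and one
of the tested slices `R` contains it (`subset_slice`). Every voter of `G` approves `c` and nothing
in the guess outside `R`, so she is counted by `s` or by `u`. This makes the tested sum at least `n
ℓ / k`, contrary to the test (`pjrPlus_of_validated`).

Cost of resolution. An interval of length at least `2⁻ⁱ` contains a point of the grid of mesh `2⁻ⁱ`,
and the pair of such a point cannot fail; hence the resolution stops by round `i`, after `O(2ⁱ)`
queries and two binary searches (`run_resolveIn`). An interval is shorter than `s` with probability
at most `2 s`, so each of the `O(log k)` dyadic scales contributes a constant to the expectation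
(`integral_costBound_le`).

The test rarely fails. Fix `c`, `ℓ` and a slice `R` with at most `ℓ - 1` members, and let `y < c <
z` be the neighbours of `c` in the rest of the guess. A voter counted by `s` has her left end
between `y` and the next grid point after `c`, and her right end between the last grid point before
`c` and `z` (`bounds_of_poss`); a voter counted by `u` has a very short interval. The heart of the
matter is that `2 (k_t + 1) (c - y) (z - c) + 1/3 ≤ |R| + 1` (`box_le`). Since `c` was never
selected, each marked point nearer to `c` than to `y` and `z` had a candidate of `(y, z)` selected
for it, and that candidate must be in `R`; there are about `(k_t + 2) (z - y) / 2` such marked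
points, and an inequality of AM-GM type does the rest (`exists_marked_range`, `box_bound`). As `p_t
k ≤ k_t + 1`, the slack `1/3` pays for the grid error and for the short intervals, and the counted
event has probability at most `ℓ / k - 1 / (20 k)` (`probability_arith`). Hoeffding's inequality and
a union bound over at most `m³` triples finish the argument: the failure probability outweighs the
`O(m)` queries of full elicitation once `n ≥ C₀ k² log m`. -/

theorem run_bind (ans : ι → Query → Bool) (e : Elicit ι α) (f : α → Elicit ι β) :
    (e.bind f).run ans =
      (((f (e.run ans).1).run ans).1, (e.run ans).2 ++ ((f (e.run ans).1).run ans).2) := by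
  induction e with
  | done a => simp [bind, run]
  | ask v q next ih => simp [bind, run, ih]

theorem run_listen (ans : ι → Query → Bool) (e : Elicit ι α) :
    (listen e).run ans = (e.run ans, (e.run ans).2) := by
  induction e with
  | done a => simp [listen, run]
  | ask v q next ih => simp [listen, run, run_bind, ih]

theorem run_forEach [DecidableEq ι] (ans : ι → Query → Bool) (d : β) (f : ι → Elicit ι β)
    (l : List ι) :
    (forEach d f l).run ans =
      (fun v => if v ∈ l then ((f v).run ans).1 else d, l.flatMap fun v => ((f v).run ans).2) := by
  induction l with
  | nil => simp [forEach, run]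
  | cons w l ih =>
    simp only [forEach, run_bind, ih, run, List.flatMap_cons, List.append_nil, Prod.mk.injEq,
      and_true]
    funext v
    by_cases h : v = w
    · subst h; simp
    · simp [h]

/-- All queries of the program are put to voter `v`, and point queries only at positions in `C`. -/
def AsksOnly (C : Finset ℝ) (v : ι) : Elicit ι α → Prop
  | done _ => True
  | ask w q next => (w = v ∧ ∀ x, q = .point x → x ∈ C) ∧ ∀ r, AsksOnly C v (next r)

variable {C : Finset ℝ} {v : ι} {e : Elicit ι α}

theorem AsksOnly.bind {f : α → Elicit ι β} (he : AsksOnly C v e)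
    (hf : ∀ a, AsksOnly C v (f a)) : AsksOnly C v (e.bind f) := by
  induction e with
  | done a => exact hf a
  | ask w q next ih => exact ⟨he.1, fun r => ih r (he.2 r)⟩

theorem AsksOnly.listen (he : AsksOnly C v e) : AsksOnly C v e.listen := by
  induction e with
  | done a => trivial
  | ask w q next ih => exact ⟨he.1, fun r => (ih r (he.2 r)).bind fun _ => trivial⟩

theorem AsksOnly.of_mem (he : AsksOnly C v e) (ans : ι → Query → Bool)
    {x : ι × Query × Bool} (hx : x ∈ (e.run ans).2) :
    x.1 = v ∧ ∀ y, x.2.1 = .point y → y ∈ C := by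
  induction e with
  | done a => simp [run] at hx
  | ask w q next ih =>
    simp only [run, List.mem_cons] at hx
    rcases hx with rfl | hx
    · exact he.1
    · exact ih _ (he.2 _) hx

theorem AsksOnly.eq_of_mem (he : AsksOnly C v e) (ans : ι → Query → Bool)
    {x : ι × Query × Bool} (hx : x ∈ (e.run ans).2) : x.1 = v :=
  (he.of_mem ans hx).1

theorem truthful (e : Elicit ι α) (ans : ι → Query → Bool) {x : ι × Query × Bool}
    (hx : x ∈ (e.run ans).2) : x.2.2 = ans x.1 x.2.1 := by
  induction e with
  | done a => simp [run] at hx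
  | ask w q next ih =>
    simp only [run, List.mem_cons] at hx
    rcases hx with rfl | hx
    · rfl
    · exact ih _ hx

/-- A program is a well-founded binary tree, so its dialogues are bounded uniformly in the answers.
This makes the query counts integrable. -/
theorem exists_length_le (e : Elicit ι α) :
    ∃ B : ℕ, ∀ ans : ι → Query → Bool, (e.run ans).2.length ≤ B := by
  induction e with
  | done a => exact ⟨0, fun _ => by simp [run]⟩
  | ask w q next ih =>
    choose B hB using ih
    refine ⟨max (B true) (B false) + 1, fun ans => ?_⟩
    simp only [run, List.length_cons, add_le_add_iff_right]
    rcases ans w q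
    · exact (hB false ans).trans (le_max_right _ _)
    · exact (hB true ans).trans (le_max_left _ _)

/-- A program is a decision tree: at each node the outcome is glued from those of the two subtrees
along a measurable set. Hence no measurable structure on results or dialogues is needed. -/
theorem measurable_run {Ω γ : Type*} [MeasurableSpace Ω] [MeasurableSpace γ]
    {ans : Ω → ι → Query → Bool}
    (h : ∀ v q, Measurable fun ω => ans ω v q) (e : Elicit ι α) (f : α × Dialogue ι → γ) :
    Measurable fun ω => f (e.run (ans ω)) := by
  induction e generalizing f with
  | done a => simp only [run]; exact measurable_const
  | ask w q next ih =>
    have key : (fun ω => f ((ask w q next).run (ans ω))) = fun ω =>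
        if ans ω w q = true then
          (fun z : α × Dialogue ι => f (z.1, (w, q, true) :: z.2)) ((next true).run (ans ω))
        else
          (fun z : α × Dialogue ι => f (z.1, (w, q, false) :: z.2)) ((next false).run (ans ω)) := by
      funext ω
      simp only [run]
      cases ans ω w q <;> simp
    rw [key]
    exact Measurable.ite (h w q (measurableSet_singleton true)) 
      (ih true fun z => f (z.1, (w, q, true) :: z.2))
      (ih false fun z => f (z.1, (w, q, false) :: z.2))

end Elicit

/-! ### Answers as functions of the interval endpoints -/

theorem answer_point {C : Finset ℝ} {u : ℝ × ℝ} {x : ℝ} :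
    answer C u (.point x) = true ↔ x ∈ C ∧ u.1 ≤ x ∧ x ≤ u.2 := by
  simp [answer, ballot]

theorem answer_interval {C : Finset ℝ} {u : ℝ × ℝ} (hu : u.1 ≤ u.2) {x y : ℝ} :
    answer C u (.interval x y) = true ↔ x ≤ u.1 ∧ u.2 ≤ y := by
  simp [answer, Set.Icc_subset_Icc_iff hu]

theorem measurable_answer (C : Finset ℝ) (q : Query) : Measurable fun u : ℝ × ℝ => answer C u q := by
  cases q with
  | point x =>
    refine measurable_to_bool ?_
    have : (fun u : ℝ × ℝ => answer C u (.point x)) ⁻¹' {true} =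
        {u : ℝ × ℝ | x ∈ C ∧ u.1 ≤ x ∧ x ≤ u.2} := by
      ext u; simp only [Set.mem_preimage, Set.mem_singleton_iff, answer_point, Set.mem_ofPred_eq]
    rw [this]
    exact (MeasurableSet.const _).inter
      ((measurableSet_le measurable_fst measurable_const).inter
        (measurableSet_le measurable_const measurable_snd))
  | interval x y =>
    refine measurable_to_bool ?_
    -- For reversed endpoints the interval is empty and the query is approved vacuously.
    have : (fun u : ℝ × ℝ => answer C u (.interval x y)) ⁻¹' {true} =
        {u : ℝ × ℝ | u.2 < u.1 ∨ (x ≤ u.1 ∧ u.2 ≤ y)} := by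
      ext u
      simp only [Set.mem_preimage, Set.mem_singleton_iff, Set.mem_ofPred_eq]
      by_cases hu : u.1 ≤ u.2
      · rw [answer_interval hu]; simp [not_lt.2 hu]
      · simp [answer, not_le.1 hu]
    rw [this]
    exact (measurableSet_lt measurable_snd measurable_fst).union
      ((measurableSet_le measurable_const measurable_fst).inter
        (measurableSet_le measurable_snd measurable_const))

open Elicit

theorem take_append_getD_cons_drop {α : Type*} (L : List α) (d : α) {m : ℕ} (h : m < L.length) :
    L = L.take m ++ L.getD m d :: L.drop (m + 1) := by
  rw [List.getD_eq_getElem _ _ h, ← List.drop_eq_getElem_cons h, List.take_append_drop]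

theorem take_succ_getD {α : Type*} (L : List α) (d : α) {m : ℕ} (h : m < L.length) :
    L.take (m + 1) = L.take m ++ [L.getD m d] := by
  rw [List.getD_eq_getElem _ _ h, List.take_concat_get' _ _ h]

/-! ### Segment search -/

section

variable {ι : Type} {C : Finset ℝ} {v : ι} {ans : ι → Query → Bool} {u : ℝ × ℝ}

theorem run_askPoint (hans : ∀ q, ans v q = answer C u q) (x : ℝ) :
    (askPoint C v x).run ans = (answer C u (.point x),
      if x ∈ C then [(v, .point x, answer C u (.point x))] else []) := by
  unfold askPoint
  split_ifs with h
  · simp [run, hans]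
  · have : answer C u (.point x) = false := by
      rw [← Bool.not_eq_true, answer_point]; tauto
    simp [run, this]

theorem asksOnly_askPoint (x : ℝ) : AsksOnly C v (askPoint C v x) := by
  unfold askPoint
  split_ifs with h
  · exact ⟨⟨rfl, by rintro _ ⟨⟩; exact h⟩, fun _ => trivial⟩
  · trivial

theorem asksOnly_segmentSearch (L : List ℕ) : AsksOnly C v (segmentSearch v L) := by
  induction L using segmentSearch.induct with
  | case1 => simp [segmentSearch, AsksOnly]
  | case2 t => rw [segmentSearch]; exact ⟨⟨rfl, by simp⟩, fun _ => trivial⟩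
  | case3 s s' T mid ih₁ ih₂ =>
    rw [segmentSearch]
    refine ⟨⟨rfl, by simp⟩, fun r => ?_⟩
    cases r
    · exact ih₂
    · exact ih₁

theorem asksOnly_firstApproved (L : List ℝ) : AsksOnly C v (firstApproved C v L) := by
  induction L using firstApproved.induct with
  | case1 => simp [firstApproved, AsksOnly]
  | case2 a l mid ih₁ ih₂ =>
    rw [firstApproved]
    refine (asksOnly_askPoint _).bind fun r => ?_
    cases r
    · exact ih₂
    · exact ih₁.bind fun _ => trivial

theorem asksOnly_lastApproved (L : List ℝ) : AsksOnly C v (lastApproved C v L) := by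
  induction L using lastApproved.induct with
  | case1 => simp [lastApproved, AsksOnly]
  | case2 a l mid ih₁ ih₂ =>
    rw [lastApproved]
    refine (asksOnly_askPoint _).bind fun r => ?_
    cases r
    · exact ih₂
    · exact ih₁.bind fun _ => trivial

theorem asksOnly_askAll (L : List ℝ) : AsksOnly C v (askAll C v L) := by
  induction L with
  | nil => trivial
  | cons x l ih => exact (asksOnly_askPoint _).bind fun _ => ih.bind fun _ => trivial

theorem asksOnly_resolveIn (P : Finset ℝ) (t : ℕ) (l : List (ℕ × ℕ)) :
    AsksOnly C v (resolveIn C P v t l) := by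
  induction l with
  | nil => exact asksOnly_askAll _
  | cons p l ih =>
    obtain ⟨i, j⟩ := p
    refine (asksOnly_askPoint _).bind fun r₁ => (asksOnly_askPoint _).bind fun r₂ => ?_
    by_cases hr : (r₁ || r₂) = true
    · rw [if_pos hr]
      exact (asksOnly_firstApproved _).bind fun _ => (asksOnly_lastApproved _).bind fun _ => trivial
    · rw [if_neg hr]
      refine ⟨⟨rfl, by simp⟩, fun r => ?_⟩
      cases r
      · exact ih
      · trivial

theorem asksOnly_resolve (σ : ℕ) (multi : Bool) (P : Multiset ℝ) :
    AsksOnly C v (resolve σ C multi v P) := by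
  refine (asksOnly_segmentSearch _).bind fun o => ?_
  cases o with
  | none => trivial
  | some t => exact (asksOnly_resolveIn _ _ _).listen.bind fun _ => trivial

/-- The approval interval `[u.1, u.2]` lies inside the open segment `(t, t + 1)`. -/
structure InSegment (u : ℝ × ℝ) (t : ℕ) : Prop where
  left : (t : ℝ) < u.1
  le : u.1 ≤ u.2
  right : u.2 < t + 1

theorem InSegment.answer_segments {t : ℕ} (h : InSegment u t) (s e : ℕ) :
    answer C u (.interval s (e + 1)) = true ↔ s ≤ t ∧ t ≤ e := by
  have h1 := h.left
  have h2 := h.le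
  have h3 := h.right
  rw [answer_interval h.le]
  constructor
  · rintro ⟨h4, h5⟩
    have : (s : ℝ) < t + 1 := by linarith
    have h' : (t : ℝ) < e + 1 := by linarith
    norm_cast at this h'
    omega
  · rintro ⟨h4, h5⟩
    have : (s : ℝ) ≤ t := by exact_mod_cast h4
    have h' : (t : ℝ) ≤ e := by exact_mod_cast h5
    constructor <;> linarith

/-- The query from the first to the middle entry `e` is approved exactly when `s ≤ t ≤ e`. Either
way the discarded half does not contain `t`, so the answer is right even when `t` is missing from
the list. Both halves have length at most `(L.length + 1) / 2`, and the last singleton costs the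
additional query. -/
theorem run_segmentSearch (hans : ∀ q, ans v q = answer C u q) {t : ℕ} (h : InSegment u t)
    (L : List ℕ) (hL : L.Pairwise (· < ·)) :
    ((segmentSearch v L).run ans).1 = (if t ∈ L then some t else none) ∧
      ((segmentSearch v L).run ans).2.length ≤ Nat.clog 2 L.length + 1 := by
  induction L using segmentSearch.induct with
  | case1 => simp [segmentSearch, run]
  | case2 s =>
    simp only [segmentSearch, run, hans]
    have := h.answer_segments (C := C) s s
    constructor
    · by_cases hs : t = s
      · subst hs; simp [this.2]
      · have : ¬ answer C u (.interval s (s + 1)) = true := by rw [this]; omega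
        simp [this, hs]
    · simp
  | case3 s s' T mid ih₁ ih₂ =>
    set L := s :: s' :: T with hLdef
    have hmid : mid < L.length := by simp [hLdef, mid]; omega
    have hsplit := take_append_getD_cons_drop L 0 hmid
    have htake := take_succ_getD L 0 hmid
    set e := L.getD mid 0 with he
    have hL' := hL
    rw [hsplit, List.pairwise_append] at hL'
    obtain ⟨-, h2, h3⟩ := hL'
    rw [List.pairwise_cons] at h2
    have hs : ∀ x ∈ L, s ≤ x := by
      intro x hx
      rw [hLdef, List.pairwise_cons] at hL
      rcases List.mem_cons.1 hx with rfl | hx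
      · exact le_rfl
      · exact (hL.1 x hx).le
    have hclog : Nat.clog 2 L.length = Nat.clog 2 ((L.length + 1) / 2) + 1 := by
      rw [Nat.clog_of_two_le (by norm_num) (by simp [hLdef])]; rfl
    have hmem : t ∈ L ↔ t ∈ L.take mid ∨ t = e ∨ t ∈ L.drop (mid + 1) := by
      conv_lhs => rw [hsplit]
      simp
    have hans' := h.answer_segments (C := C) s e
    have hrun : (segmentSearch v L).run ans =
        (((if ans v (.interval s ((e : ℝ) + 1)) then segmentSearch v (L.take (mid + 1))
            else segmentSearch v (L.drop (mid + 1))).run ans).1,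
          (v, .interval s ((e : ℝ) + 1), ans v (.interval s ((e : ℝ) + 1))) ::
          ((if ans v (.interval s ((e : ℝ) + 1)) then segmentSearch v (L.take (mid + 1))
            else segmentSearch v (L.drop (mid + 1))).run ans).2) := by
      rw [hLdef, segmentSearch]
      rfl
    rw [hrun, hans]
    by_cases hq : answer C u (.interval s ((e : ℝ) + 1)) = true
    · rw [if_pos hq]
      rw [hans'] at hq
      obtain ⟨e1, e2⟩ := ih₁ (hL.sublist (List.take_sublist _ _))
      have : t ∉ L.drop (mid + 1) := fun hx => by have := h2.1 t hx; omega
      refine ⟨?_, ?_⟩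
      · rw [e1, htake]; simp [hmem, this]
      · simp only [List.length_cons]
        refine (Nat.add_le_add_right e2 1).trans ?_
        rw [hclog]
        gcongr
        simp [hLdef, mid]; omega
    · rw [if_neg hq]
      rw [hans'] at hq
      obtain ⟨e1, e2⟩ := ih₂ (hL.sublist (List.drop_sublist _ _))
      refine ⟨?_, ?_⟩
      · rw [e1]
        congr 1
        rw [hmem, eq_iff_iff]
        constructor
        · exact fun h => Or.inr (Or.inr h)
        · rintro (hx | hx | hx)
          · have := h3 t hx e (by simp)
            have := hs t (hmem.2 (Or.inl hx))
            omega
          · have := hs t (hmem.2 (Or.inr (Or.inl hx)))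
            omega
          · exact hx
      · simp only [List.length_cons]
        refine (Nat.add_le_add_right e2 1).trans ?_
        rw [hclog]
        gcongr
        simp [hLdef, mid]; omega
end

/-! ### Binary searches for the ends of the approval set -/

section

variable {ι : Type} {C : Finset ℝ} {v : ι} {ans : ι → Query → Bool} {u : ℝ × ℝ}

theorem clog_succ_eq {n : ℕ} (hn : 1 ≤ n) : Nat.clog 2 (n + 1) = Nat.clog 2 (n / 2 + 1) + 1 := by
  rw [Nat.clog_of_two_le (by norm_num) (by omega)]
  congr 2
  omega

/-- The outcome of a binary search for the first approved position of `L`. -/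
structure FirstApprovedSpec (v : ι) (u : ℝ × ℝ) (L : List ℝ) (z : Option ℝ × Dialogue ι) :
    Prop where
  some : ∀ x, z.1 = some x → x ∈ L ∧ u.1 ≤ x ∧ (v, Query.point x, true) ∈ z.2
  least : ∀ y ∈ L, u.1 ≤ y → ∃ x, z.1 = Option.some x ∧ x ≤ y
  below : ∀ y ∈ L, y < u.1 → ∃ y' ∈ L, y ≤ y' ∧ y' < u.1 ∧ (v, Query.point y', false) ∈ z.2
  length_le : z.2.length ≤ Nat.clog 2 (L.length + 1)

/-- The outcome of a binary search for the last approved position of `L`. -/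
structure LastApprovedSpec (v : ι) (u : ℝ × ℝ) (L : List ℝ) (z : Option ℝ × Dialogue ι) :
    Prop where
  some : ∀ x, z.1 = some x → x ∈ L ∧ x ≤ u.2 ∧ (v, Query.point x, true) ∈ z.2
  greatest : ∀ y ∈ L, y ≤ u.2 → ∃ x, z.1 = Option.some x ∧ y ≤ x
  above : ∀ y ∈ L, u.2 < y → ∃ y' ∈ L, y' ≤ y ∧ u.2 < y' ∧ (v, Query.point y', false) ∈ z.2
  length_le : z.2.length ≤ Nat.clog 2 (L.length + 1)

/-- All entries are candidates not beyond `u.2`, so approval of an entry `x` means `u.1 ≤ x` and is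
monotone along the list. Besides the result, the lemma records that the search brackets `u.1`: a
disapproved query remains at or after every disapproved entry. -/
theorem run_firstApproved (hans : ∀ q, ans v q = answer C u q) (L : List ℝ)
    (hL : L.Pairwise (· < ·)) (hC : ∀ x ∈ L, x ∈ C ∧ x ≤ u.2) :
    FirstApprovedSpec v u L ((firstApproved C v L).run ans) := by
  induction L using firstApproved.induct with
  | case1 => constructor <;> simp [firstApproved, run]
  | case2 a l mid ih₁ ih₂ =>
    set L := a :: l with hLdef
    have hmid : mid < L.length := by simp [hLdef, mid]; omega
    have hsplit := take_append_getD_cons_drop L 0 hmid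
    set e := L.getD mid 0 with he
    have hmem : ∀ y, y ∈ L ↔ y ∈ L.take mid ∨ y = e ∨ y ∈ L.drop (mid + 1) := by
      intro y
      conv_lhs => rw [hsplit]
      simp
    have hL' := hL
    rw [hsplit, List.pairwise_append] at hL'
    obtain ⟨-, h2, h3⟩ := hL'
    rw [List.pairwise_cons] at h2
    have heL : e ∈ L := (hmem e).2 (Or.inr (Or.inl rfl))
    have hclog := clog_succ_eq (n := L.length) (by simp [hLdef])
    have hlen : L.length / 2 = mid := rfl
    have hrun : (firstApproved C v L).run ans =
        ((if answer C u (.point e) then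
            bind (firstApproved C v (L.take mid)) fun o => done (some (o.getD e))
          else firstApproved C v (L.drop (mid + 1))).run ans).map id
            ((v, Query.point e, answer C u (.point e)) :: ·) := by
      rw [hLdef, firstApproved, run_bind, run_askPoint hans]
      change (_, (if e ∈ C then [(v, Query.point e, answer C u (.point e))] else []) ++ _) = _
      rw [if_pos (hC e heL).1]
      rfl
    rw [hrun]
    have hq := answer_point (C := C) (u := u) (x := e)
    by_cases h : u.1 ≤ e
    · have hq' := hq.2 ⟨(hC e heL).1, h, (hC e heL).2⟩
      rw [hq', if_pos rfl, run_bind]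
      obtain ⟨s1, s2, s3, s4⟩ := ih₁ (hL.sublist (List.take_sublist _ _))
        (fun x hx => hC x (List.mem_of_mem_take hx))
      refine ⟨?_, ?_, ?_, ?_⟩
      · simp only [run, Prod.map_apply, id, List.append_nil, Option.some.injEq]
        rintro x rfl
        cases ho : ((firstApproved C v (L.take mid)).run ans).1 with
        | none => simp [heL, h]
        | some x =>
          obtain ⟨q1, q2, q3⟩ := s1 x ho
          simp [List.mem_of_mem_take q1, q2, q3]
      · intro y hy hay
        simp only [run, Prod.map_apply, id, Option.some.injEq, exists_eq_left']
        rcases (hmem y).1 hy with hy | rfl | hy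
        · obtain ⟨x, hx, hxy⟩ := s2 y hy hay
          rw [hx]; exact hxy
        all_goals
          cases ho : ((firstApproved C v (L.take mid)).run ans).1 with
          | none => first | exact le_rfl | exact (h2.1 y hy).le
          | some x =>
            have h4 := h3 x (s1 x ho).1 e (by simp)
            first | exact h4.le | exact (h4.trans (h2.1 y hy)).le
      · intro y hy hay
        simp only [run, Prod.map_apply, id, List.append_nil]
        rcases (hmem y).1 hy with hy | rfl | hy
        · obtain ⟨y', q1, q2, q3, q4⟩ := s3 y hy hay
          exact ⟨y', List.mem_of_mem_take q1, q2, q3, List.mem_cons_of_mem _ q4⟩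
        · exact absurd hay (not_lt.2 h)
        · exact absurd hay (not_lt.2 (h.trans (h2.1 y hy).le))
      · simp only [run, Prod.map_apply, List.append_nil, List.length_cons, hclog, hlen]
        refine Nat.add_le_add_right (s4.trans (Nat.clog_mono_right _ ?_)) 1
        simp
    · have hq' : answer C u (.point e) = false := by
        rw [← Bool.not_eq_true, hq]; tauto
      rw [hq', if_neg (by simp)]
      obtain ⟨s1, s2, s3, s4⟩ := ih₂ (hL.sublist (List.drop_sublist _ _))
        (fun x hx => hC x (List.mem_of_mem_drop hx))
      rw [not_le] at h
      refine ⟨?_, ?_, ?_, ?_⟩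
      · simp only [Prod.map_fst, Prod.map_snd, id]
        intro x hx
        obtain ⟨q1, q2, q3⟩ := s1 x hx
        exact ⟨List.mem_of_mem_drop q1, q2, List.mem_cons_of_mem _ q3⟩
      · intro y hy hay
        simp only [Prod.map_fst, id]
        rcases (hmem y).1 hy with hy | rfl | hy
        · exact absurd hay (not_le.2 ((h3 y hy e (by simp)).trans h))
        · exact absurd hay (not_le.2 h)
        · exact s2 y hy hay
      · intro y hy hay
        simp only [Prod.map_snd]
        rcases (hmem y).1 hy with hy | rfl | hy
        · exact ⟨e, heL, (h3 y hy e (by simp)).le, h, by simp⟩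
        · exact ⟨e, heL, le_rfl, h, by simp⟩
        · obtain ⟨y', q1, q2, q3, q4⟩ := s3 y hy hay
          exact ⟨y', List.mem_of_mem_drop q1, q2, q3, List.mem_cons_of_mem _ q4⟩
      · simp only [Prod.map_snd, List.length_cons, hclog, hlen]
        refine Nat.add_le_add_right (s4.trans (Nat.clog_mono_right _ ?_)) 1
        simp only [List.length_drop]
        omega

/-- The mirror image of `run_firstApproved`: the entries are not before `u.1`, so approval means `x
≤ u.2`. -/
theorem run_lastApproved (hans : ∀ q, ans v q = answer C u q) (L : List ℝ)
    (hL : L.Pairwise (· < ·)) (hC : ∀ x ∈ L, x ∈ C ∧ u.1 ≤ x) :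
    LastApprovedSpec v u L ((lastApproved C v L).run ans) := by
  induction L using lastApproved.induct with
  | case1 => constructor <;> simp [lastApproved, run]
  | case2 a l mid ih₁ ih₂ =>
    set L := a :: l with hLdef
    have hmid : mid < L.length := by simp [hLdef, mid]; omega
    have hsplit := take_append_getD_cons_drop L 0 hmid
    set e := L.getD mid 0 with he
    have hmem : ∀ y, y ∈ L ↔ y ∈ L.take mid ∨ y = e ∨ y ∈ L.drop (mid + 1) := by
      intro y
      conv_lhs => rw [hsplit]
      simp
    have hL' := hL
    rw [hsplit, List.pairwise_append] at hL'
    obtain ⟨-, h2, h3⟩ := hL'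
    rw [List.pairwise_cons] at h2
    have heL : e ∈ L := (hmem e).2 (Or.inr (Or.inl rfl))
    have hclog := clog_succ_eq (n := L.length) (by simp [hLdef])
    have hlen : L.length / 2 = mid := rfl
    have hrun : (lastApproved C v L).run ans =
        ((if answer C u (.point e) then
            bind (lastApproved C v (L.drop (mid + 1))) fun o => done (some (o.getD e))
          else lastApproved C v (L.take mid)).run ans).map id
            ((v, Query.point e, answer C u (.point e)) :: ·) := by
      rw [hLdef, lastApproved, run_bind, run_askPoint hans]
      change (_, (if e ∈ C then [(v, Query.point e, answer C u (.point e))] else []) ++ _) = _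
      rw [if_pos (hC e heL).1]
      rfl
    rw [hrun]
    have hq := answer_point (C := C) (u := u) (x := e)
    by_cases h : e ≤ u.2
    · have hq' := hq.2 ⟨(hC e heL).1, (hC e heL).2, h⟩
      rw [hq', if_pos rfl, run_bind]
      obtain ⟨s1, s2, s3, s4⟩ := ih₁ (hL.sublist (List.drop_sublist _ _))
        (fun x hx => hC x (List.mem_of_mem_drop hx))
      refine ⟨?_, ?_, ?_, ?_⟩
      · simp only [run, Prod.map_apply, id, List.append_nil, Option.some.injEq]
        rintro x rfl
        cases ho : ((lastApproved C v (L.drop (mid + 1))).run ans).1 with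
        | none => simp [heL, h]
        | some x =>
          obtain ⟨q1, q2, q3⟩ := s1 x ho
          simp [List.mem_of_mem_drop q1, q2, q3]
      · intro y hy hay
        simp only [run, Prod.map_apply, id, Option.some.injEq, exists_eq_left']
        rcases (hmem y).1 hy with hy | rfl | hy
        rotate_left 2
        · obtain ⟨x, hx, hxy⟩ := s2 y hy hay
          rw [hx]; exact hxy
        all_goals
          cases ho : ((lastApproved C v (L.drop (mid + 1))).run ans).1 with
          | none => first | exact le_rfl | exact (h3 y hy e (by simp)).le
          | some x =>
            have h4 := h2.1 x (s1 x ho).1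
            first | exact h4.le | exact ((h3 y hy e (by simp)).trans h4).le
      · intro y hy hay
        simp only [run, Prod.map_apply, id, List.append_nil]
        rcases (hmem y).1 hy with hy | rfl | hy
        · exact absurd hay (not_lt.2 ((h3 y hy e (by simp)).le.trans h))
        · exact absurd hay (not_lt.2 h)
        · obtain ⟨y', q1, q2, q3, q4⟩ := s3 y hy hay
          exact ⟨y', List.mem_of_mem_drop q1, q2, q3, List.mem_cons_of_mem _ q4⟩
      · simp only [run, Prod.map_apply, List.append_nil, List.length_cons, hclog, hlen]
        refine Nat.add_le_add_right (s4.trans (Nat.clog_mono_right _ ?_)) 1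
        simp only [List.length_drop]
        omega
    · have hq' : answer C u (.point e) = false := by
        rw [← Bool.not_eq_true, hq]; tauto
      rw [hq', if_neg (by simp)]
      obtain ⟨s1, s2, s3, s4⟩ := ih₂ (hL.sublist (List.take_sublist _ _))
        (fun x hx => hC x (List.mem_of_mem_take hx))
      rw [not_le] at h
      refine ⟨?_, ?_, ?_, ?_⟩
      · simp only [Prod.map_fst, Prod.map_snd, id]
        intro x hx
        obtain ⟨q1, q2, q3⟩ := s1 x hx
        exact ⟨List.mem_of_mem_take q1, q2, List.mem_cons_of_mem _ q3⟩
      · intro y hy hay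
        simp only [Prod.map_fst, id]
        rcases (hmem y).1 hy with hy | rfl | hy
        · exact s2 y hy hay
        · exact absurd hay (not_le.2 h)
        · exact absurd hay (not_le.2 (h.trans (h2.1 y hy)))
      · intro y hy hay
        simp only [Prod.map_snd]
        rcases (hmem y).1 hy with hy | rfl | hy
        · obtain ⟨y', q1, q2, q3, q4⟩ := s3 y hy hay
          exact ⟨y', List.mem_of_mem_take q1, q2, q3, List.mem_cons_of_mem _ q4⟩
        · exact ⟨e, heL, le_rfl, h, by simp⟩
        · exact ⟨e, heL, (h2.1 y hy).le, h, by simp⟩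
      · simp only [Prod.map_snd, List.length_cons, hclog, hlen]
        refine Nat.add_le_add_right (s4.trans (Nat.clog_mono_right _ ?_)) 1
        simp

theorem run_askAll (hans : ∀ q, ans v q = answer C u q) (L : List ℝ) :
    ((askAll C v L).run ans).1 = L.toFinset.filter (fun x => x ∈ ballot C u) ∧
      ((askAll C v L).run ans).2.length ≤ L.length ∧
      (∀ x ∈ L, x ∈ C → (v, Query.point x, answer C u (.point x)) ∈ ((askAll C v L).run ans).2) ∧
      ∀ e ∈ ((askAll C v L).run ans).2, ∃ x, e.2.1 = .point x := by
  induction L with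
  | nil => simp [askAll, run]
  | cons y L ih =>
    obtain ⟨h1, h2, h3, h4⟩ := ih
    have hq := answer_point (C := C) (u := u) (x := y)
    simp only [askAll, run_bind, run_askPoint hans, run, List.append_nil]
    refine ⟨?_, ?_, ?_, ?_⟩
    · rw [h1, List.toFinset_cons, Finset.filter_insert]
      have : (y ∈ ballot C u) ↔ answer C u (.point y) = true := by rw [hq]; simp [ballot]
      simp only [this]
    · split_ifs <;> simp <;> omega
    · intro x hx hxC
      rcases List.mem_cons.1 hx with rfl | hx
      · simp [hxC]
      · exact List.mem_append_right _ (h3 x hx hxC)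
    · intro e he
      rcases List.mem_append.1 he with he | he
      · split_ifs at he <;> simp at he
        exact ⟨y, by rw [he]⟩
      · exact h4 e he

end

/-! ### The course of a resolution -/

/-- The point `t + j / 2 ^ i` of segment `t` that belongs to the pair `(i, j)`. -/
def gridPoint (t : ℕ) (p : ℕ × ℕ) : ℝ := t + (p.2 : ℝ) / 2 ^ p.1

/-- The left neighbouring candidate of the point of a pair. -/
def gridLeft (C : Finset ℝ) (t : ℕ) (p : ℕ × ℕ) : ℝ := leftNbr t C (gridPoint t p)

/-- The right neighbouring candidate of the point of a pair. -/
def gridRight (C : Finset ℝ) (t : ℕ) (p : ℕ × ℕ) : ℝ := rightNbr t C (gridPoint t p)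

/-- The positions searched for the first approved one when the pair `p` is successful. -/
def searchLeft (P : Finset ℝ) (t : ℕ) (p : ℕ × ℕ) : List ℝ :=
  between P (t + ((p.2 : ℝ) - 1) / 2 ^ p.1) (gridPoint t p)

/-- The positions searched for the last approved one when the pair `p` is successful. -/
def searchRight (P : Finset ℝ) (t : ℕ) (p : ℕ × ℕ) : List ℝ :=
  between P (gridPoint t p) (t + ((p.2 : ℝ) + 1) / 2 ^ p.1)

section

variable {ι : Type}

/-- All three queries of the pair `p` are answered in the negative. -/
def Failed (C : Finset ℝ) (u : ℝ × ℝ) (t : ℕ) (p : ℕ × ℕ) : Prop :=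
  answer C u (.point (gridLeft C t p)) = false ∧ answer C u (.point (gridRight C t p)) = false ∧
    answer C u (.interval (gridLeft C t p) (gridRight C t p)) = false

/-- The dialogue records the point queries of the pair `p`. -/
def Recorded (C : Finset ℝ) (v : ι) (u : ℝ × ℝ) (t : ℕ) (D : Dialogue ι) (p : ℕ × ℕ) : Prop :=
  (gridLeft C t p ∈ C →
    (v, Query.point (gridLeft C t p), answer C u (.point (gridLeft C t p))) ∈ D) ∧
  (gridRight C t p ∈ C →
    (v, Query.point (gridRight C t p), answer C u (.point (gridRight C t p))) ∈ D)

/-- The resolution ends at pair `p`, where a point query is approved, after `m` failures. -/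
structure EndsByHit (C P : Finset ℝ) (v : ι) (ans : ι → Query → Bool) (u : ℝ × ℝ) (t : ℕ)
    (p : ℕ × ℕ) (m : ℕ) (z : Finset ℝ × Dialogue ι) : Prop where
  approved : answer C u (.point (gridLeft C t p)) = true ∨
    answer C u (.point (gridRight C t p)) = true
  recorded : Recorded C v u t z.2 p
  first_subset : ∀ e ∈ ((firstApproved C v (searchLeft P t p)).run ans).2, e ∈ z.2
  last_subset : ∀ e ∈ ((lastApproved C v (searchRight P t p)).run ans).2, e ∈ z.2
  result : z.1 = P.filter fun c =>
    ((firstApproved C v (searchLeft P t p)).run ans).1.getD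
        (if answer C u (.point (gridLeft C t p)) then gridLeft C t p else gridRight C t p) ≤ c ∧
      c ≤ ((lastApproved C v (searchRight P t p)).run ans).1.getD
        (if answer C u (.point (gridRight C t p)) then gridRight C t p else gridLeft C t p)
  length_le : z.2.length ≤ 3 * m + 2 + ((firstApproved C v (searchLeft P t p)).run ans).2.length +
    ((lastApproved C v (searchRight P t p)).run ans).2.length

/-- The resolution ends at pair `p`, where the interval query is approved, after `m` failures. -/
structure EndsByInterval (C : Finset ℝ) (v : ι) (u : ℝ × ℝ) (t : ℕ)
    (p : ℕ × ℕ) (m : ℕ) (z : Finset ℝ × Dialogue ι) : Prop where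
  left : answer C u (.point (gridLeft C t p)) = false
  right : answer C u (.point (gridRight C t p)) = false
  interval : answer C u (.interval (gridLeft C t p) (gridRight C t p)) = true
  recorded : Recorded C v u t z.2 p
  interval_mem : (v, Query.interval (gridLeft C t p) (gridRight C t p), true) ∈ z.2
  result : z.1 = ∅
  length_le : z.2.length ≤ 3 * m + 3

/-- The resolution ends with queries at all positions, after `m` failures. -/
structure EndsByAsking (C P : Finset ℝ) (v : ι) (u : ℝ × ℝ) (t : ℕ)
    (m : ℕ) (z : Finset ℝ × Dialogue ι) : Prop where
  result : z.1 = P.filter fun c => ((t : ℝ) ≤ c ∧ c ≤ t + 1) ∧ c ∈ ballot C u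
  asked : ∀ x ∈ P, (t : ℝ) ≤ x → x ≤ t + 1 → x ∈ C →
    (v, Query.point x, answer C u (.point x)) ∈ z.2
  point_of_approved : ∀ e ∈ z.2, e.2.2 = true → ∃ x, e.2.1 = .point x
  length_le : z.2.length ≤ 3 * m + P.card

variable {C P : Finset ℝ} {v : ι} {ans : ι → Query → Bool} {u : ℝ × ℝ} {t : ℕ}

theorem Recorded.mono {D D' : Dialogue ι} {p : ℕ × ℕ} (h : Recorded C v u t D p)
    (hD : ∀ e ∈ D, e ∈ D') : Recorded C v u t D' p :=
  ⟨fun h' => hD _ (h.1 h'), fun h' => hD _ (h.2 h')⟩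

/-- The schedule is split at its first successful pair. Each earlier pair costs at most three
queries and leaves its point answers in the dialogue. All later reasoning about a resolution starts
from these three ways to end, without running the program again. -/
theorem resolveIn_ends (hans : ∀ q, ans v q = answer C u q) (l : List (ℕ × ℕ)) :
    ∃ l₁ l₂, l = l₁ ++ l₂ ∧
      (∀ p ∈ l₁, Failed C u t p ∧ Recorded C v u t ((resolveIn C P v t l).run ans).2 p) ∧
      ((l₂ = [] ∧ EndsByAsking C P v u t l₁.length ((resolveIn C P v t l).run ans)) ∨
        ∃ p l₃, l₂ = p :: l₃ ∧
          (EndsByHit C P v ans u t p l₁.length ((resolveIn C P v t l).run ans) ∨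
            EndsByInterval C v u t p l₁.length ((resolveIn C P v t l).run ans))) := by
  induction l with
  | nil =>
    refine ⟨[], [], rfl, by simp, Or.inl ⟨rfl, ?_⟩⟩
    obtain ⟨h1, h2, h3, h4⟩ :=
      run_askAll hans ((P.filter fun c => (t : ℝ) ≤ c ∧ c ≤ t + 1).sort (· ≤ ·))
    rw [resolveIn]
    refine ⟨?_, ?_, ?_, ?_⟩
    · rw [h1, Finset.sort_toFinset, Finset.filter_filter]
    · intro x hx h5 h6 hxC
      exact h3 x (by simp [hx, h5, h6]) hxC
    · intro e he _
      exact h4 e he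
    · refine h2.trans ?_
      simp only [Finset.length_sort, List.length_nil, mul_zero, zero_add]
      exact Finset.card_filter_le _ _
  | cons p l ih =>
    obtain ⟨i, j⟩ := p
    set r₁ := answer C u (.point (gridLeft C t (i, j))) with hr₁
    set r₂ := answer C u (.point (gridRight C t (i, j))) with hr₂
    have hrun : (resolveIn C P v t ((i, j) :: l)).run ans =
        (((if r₁ || r₂ then
            bind (firstApproved C v (searchLeft P t (i, j))) fun α =>
            bind (lastApproved C v (searchRight P t (i, j))) fun β =>
            done (P.filter fun c =>
              α.getD (if r₁ then gridLeft C t (i, j) else gridRight C t (i, j)) ≤ c ∧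
                c ≤ β.getD (if r₂ then gridRight C t (i, j) else gridLeft C t (i, j)))
          else ask v (.interval (gridLeft C t (i, j)) (gridRight C t (i, j))) fun r =>
            if r then done ∅ else resolveIn C P v t l).run ans)).map id
          (fun D => (if gridLeft C t (i, j) ∈ C then
              [(v, Query.point (gridLeft C t (i, j)), r₁)] else []) ++
            ((if gridRight C t (i, j) ∈ C then
              [(v, Query.point (gridRight C t (i, j)), r₂)] else []) ++ D)) := by
      rw [resolveIn]
      simp only [run_bind, run_askPoint hans]
      rfl
    rw [hrun]
    have hlen : ((if gridLeft C t (i, j) ∈ C then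
        [(v, Query.point (gridLeft C t (i, j)), r₁)] else []) : Dialogue ι).length ≤ 1 ∧
        ((if gridRight C t (i, j) ∈ C then
        [(v, Query.point (gridRight C t (i, j)), r₂)] else []) : Dialogue ι).length ≤ 1 := by
      constructor <;> split_ifs <;> simp
    have hrec : ∀ D : Dialogue ι, Recorded C v u t ((if gridLeft C t (i, j) ∈ C then
              [(v, Query.point (gridLeft C t (i, j)), r₁)] else []) ++
            ((if gridRight C t (i, j) ∈ C then
              [(v, Query.point (gridRight C t (i, j)), r₂)] else []) ++ D)) (i, j) := by
      intro D
      constructor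
      · intro h; simp [h, hr₁]
      · intro h; simp [h, hr₂]
    by_cases h : (r₁ || r₂) = true
    · refine ⟨[], (i, j) :: l, rfl, by simp, Or.inr ⟨(i, j), l, rfl, Or.inl ?_⟩⟩
      rw [if_pos h]
      simp only [run_bind, run, List.append_nil]
      refine ⟨?_, hrec _, ?_, ?_, rfl, ?_⟩
      · simpa using h
      · intro e he; simp [he]
      · intro e he; simp [he]
      · simp only [Prod.map_snd, List.length_append, List.length_nil]
        omega
    · have h' : r₁ = false ∧ r₂ = false := by simpa using h
      rw [if_neg h]
      simp only [run, hans]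
      by_cases hI : answer C u (.interval (gridLeft C t (i, j)) (gridRight C t (i, j))) = true
      · refine ⟨[], (i, j) :: l, rfl, by simp, Or.inr ⟨(i, j), l, rfl, Or.inr ?_⟩⟩
        simp only [hI, if_true, run]
        refine ⟨h'.1, h'.2, hI, hrec _, by simp, rfl, ?_⟩
        simp only [Prod.map_snd, List.length_append, List.length_nil, List.length_cons]
        omega
      · have hI' : answer C u (.interval (gridLeft C t (i, j)) (gridRight C t (i, j))) = false := by
          simpa using hI
        simp only [hI', Bool.false_eq_true, if_false]
        obtain ⟨l₁, l₂, hl, hf, hc⟩ := ih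
        set z := (resolveIn C P v t l).run ans
        have hsub : ∀ e ∈ z.2, e ∈ ((if gridLeft C t (i, j) ∈ C then
              [(v, Query.point (gridLeft C t (i, j)), r₁)] else []) ++
            ((if gridRight C t (i, j) ∈ C then
              [(v, Query.point (gridRight C t (i, j)), r₂)] else []) ++
            (v, Query.interval (gridLeft C t (i, j)) (gridRight C t (i, j)), false) :: z.2)) := by
          intro e he; simp [he]
        refine ⟨(i, j) :: l₁, l₂, by rw [hl]; rfl, ?_, ?_⟩
        · intro p hp
          rcases List.mem_cons.1 hp with rfl | hp
          · exact ⟨⟨h'.1, h'.2, hI'⟩, hrec _⟩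
          · exact ⟨(hf p hp).1, (hf p hp).2.mono hsub⟩
        · rcases hc with ⟨hl₂, hc⟩ | ⟨p, l₃, hl₂, hc | hc⟩
          · refine Or.inl ⟨hl₂, hc.result, fun x h1 h2 h3 h4 => hsub _ (hc.asked x h1 h2 h3 h4),
              ?_, ?_⟩
            · intro e he het
              simp only [Prod.map_snd, List.mem_append, List.mem_cons, h'.1, h'.2] at he
              rcases he with he | he | rfl | he
              · split_ifs at he <;> simp at he
                simp [he] at het
              · split_ifs at he <;> simp at he
                simp [he] at het
              · simp at het
              · exact hc.point_of_approved e he het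
            · have := hc.length_le
              simp only [Prod.map_snd, List.length_append, List.length_cons]
              omega
          · refine Or.inr ⟨p, l₃, hl₂, Or.inl ⟨hc.approved, hc.recorded.mono hsub,
              fun e he => hsub e (hc.first_subset e he),
              fun e he => hsub e (hc.last_subset e he), hc.result, ?_⟩⟩
            have := hc.length_le
            simp only [Prod.map_snd, List.length_append, List.length_cons]
            omega
          · refine Or.inr ⟨p, l₃, hl₂, Or.inr ⟨hc.left, hc.right, hc.interval,
              hc.recorded.mono hsub, hsub _ hc.interval_mem, hc.result, ?_⟩⟩
            have := hc.length_le
            simp only [Prod.map_snd, List.length_append, List.length_cons]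
            omega

end

/-! ### Neighbours of a point in a finite set -/

section Neighbours

variable {t : ℕ} {T : Finset ℝ} {x c : ℝ}

theorem start_le_leftNbr : (t : ℝ) ≤ leftNbr t T x :=
  Finset.le_max' _ _ (Finset.mem_insert_self _ _)

theorem rightNbr_le_end : rightNbr t T x ≤ t + 1 :=
  Finset.min'_le _ _ (Finset.mem_insert_self _ _)

theorem leftNbr_mem : leftNbr t T x = t ∨ leftNbr t T x ∈ T ∧ leftNbr t T x ≤ x := by
  simpa [leftNbr] using
    Finset.max'_mem (insert (t : ℝ) (T.filter fun c => c ≤ x)) (Finset.insert_nonempty _ _)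

theorem rightNbr_mem : rightNbr t T x = t + 1 ∨ rightNbr t T x ∈ T ∧ x ≤ rightNbr t T x := by
  simpa [rightNbr] using
    Finset.min'_mem (insert ((t : ℝ) + 1) (T.filter fun c => x ≤ c)) (Finset.insert_nonempty _ _)

theorem le_leftNbr (hc : c ∈ T) (h : c ≤ x) : c ≤ leftNbr t T x :=
  Finset.le_max' _ _ (Finset.mem_insert_of_mem (Finset.mem_filter.2 ⟨hc, h⟩))

theorem rightNbr_le (hc : c ∈ T) (h : x ≤ c) : rightNbr t T x ≤ c :=
  Finset.min'_le _ _ (Finset.mem_insert_of_mem (Finset.mem_filter.2 ⟨hc, h⟩))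

theorem leftNbr_le (h : (t : ℝ) ≤ x) : leftNbr t T x ≤ x := by
  rcases leftNbr_mem (t := t) (T := T) (x := x) with h' | h'
  · rw [h']; exact h
  · exact h'.2

theorem le_rightNbr (h : x ≤ t + 1) : x ≤ rightNbr t T x := by
  rcases rightNbr_mem (t := t) (T := T) (x := x) with h' | h'
  · rw [h']; exact h
  · exact h'.2

theorem leftNbr_mem_of_lt (h : (t : ℝ) < leftNbr t T x) : leftNbr t T x ∈ T := by
  rcases leftNbr_mem (t := t) (T := T) (x := x) with h' | h'
  · exact absurd h' h.ne'
  · exact h'.1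

theorem rightNbr_mem_of_lt (h : rightNbr t T x < t + 1) : rightNbr t T x ∈ T := by
  rcases rightNbr_mem (t := t) (T := T) (x := x) with h' | h'
  · exact absurd h' h.ne
  · exact h'.1

end Neighbours

/-! ### The dyadic grid and the order of its pairs -/

section Schedule

theorem mem_schedule {R : ℕ} {p : ℕ × ℕ} :
    p ∈ schedule R ↔ (1 ≤ p.1 ∧ p.1 ≤ R) ∧ 1 ≤ p.2 ∧ p.2 ≤ 2 ^ p.1 := by
  obtain ⟨i, j⟩ := p
  simp only [schedule, List.mem_flatMap, List.mem_range'_1, List.mem_map, Prod.mk.injEq]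
  constructor
  · rintro ⟨a, h1, b, h2, rfl, rfl⟩; omega
  · intro h; exact ⟨i, by omega, j, by omega, rfl, rfl⟩

theorem pairwise_schedule (R : ℕ) :
    (schedule R).Pairwise fun p q => p.1 < q.1 ∨ p.1 = q.1 ∧ p.2 < q.2 := by
  rw [schedule, List.pairwise_flatMap]
  constructor
  · intro i _
    rw [List.pairwise_map]
    exact (List.pairwise_lt_range' 1).imp fun h => Or.inr ⟨rfl, h⟩
  · refine (List.pairwise_lt_range' 1).imp fun h => ?_
    simp only [List.mem_map]
    rintro _ ⟨_, _, rfl⟩ _ ⟨_, _, rfl⟩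
    exact Or.inl h

theorem nodup_schedule (R : ℕ) : (schedule R).Nodup :=
  (pairwise_schedule R).imp fun {p q} h => by rintro rfl; simp at h

theorem length_schedule_add_two (R : ℕ) : (schedule R).length + 2 = 2 ^ (R + 1) := by
  induction R with
  | zero => simp [schedule]
  | succ R ih =>
    have : schedule (R + 1) = schedule R ++ (List.range' 1 (2 ^ (1 + R))).map fun j => (1 + R, j) := by
      simp [schedule, List.range'_concat]
    rw [this, List.length_append, List.length_map, List.length_range', add_comm 1 R]
    omega

/-- The schedule is sorted lexicographically, so every valid pair smaller than `p` has been tried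
before `p`. -/
theorem mem_of_schedule_eq {R : ℕ} {l₁ l₂ : List (ℕ × ℕ)} {p : ℕ × ℕ}
    (h : schedule R = l₁ ++ p :: l₂) {q : ℕ × ℕ} (hq : 1 ≤ q.1) (hq' : 1 ≤ q.2)
    (hq'' : q.2 ≤ 2 ^ q.1) (hlt : q.1 < p.1 ∨ q.1 = p.1 ∧ q.2 < p.2) : q ∈ l₁ := by
  have hp : p ∈ schedule R := by rw [h]; simp
  rw [mem_schedule] at hp
  have hqR : q ∈ schedule R := mem_schedule.2 ⟨⟨hq, by omega⟩, hq', hq''⟩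
  have hpw := pairwise_schedule R
  rw [h, List.pairwise_append, List.pairwise_cons] at hpw
  rw [h, List.mem_append, List.mem_cons] at hqR
  rcases hqR with h1 | rfl | h1
  · exact h1
  · omega
  · have := hpw.2.1.1 q h1
    omega

variable {t : ℕ} {p : ℕ × ℕ}

theorem start_le_gridPoint : (t : ℝ) ≤ gridPoint t p := by
  unfold gridPoint
  have : (0 : ℝ) ≤ (p.2 : ℝ) / 2 ^ p.1 := by positivity
  linarith

theorem gridPoint_le_end (h : p.2 ≤ 2 ^ p.1) : gridPoint t p ≤ t + 1 := by
  unfold gridPoint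
  have : (p.2 : ℝ) / 2 ^ p.1 ≤ 1 := by
    rw [div_le_one (by positivity)]
    exact_mod_cast h
  linarith

/-- Rounding `u.1` up to the grid moves it by less than the mesh. The index is neither `0` nor
beyond `2 ^ i` because the interval is inside the open segment. -/
theorem exists_gridPoint_mem {u : ℝ × ℝ} (hu : InSegment u t) {i : ℕ}
    (hi : ((2 : ℝ) ^ i)⁻¹ ≤ u.2 - u.1) :
    ∃ j, 1 ≤ j ∧ j ≤ 2 ^ i ∧ u.1 ≤ gridPoint t (i, j) ∧ gridPoint t (i, j) ≤ u.2 := by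
  have h1 := hu.left
  have h3 := hu.right
  have hpos : (0 : ℝ) < 2 ^ i := by positivity
  have ha : 0 < (u.1 - t) * 2 ^ i := mul_pos (by linarith) hpos
  have hj := Nat.le_ceil ((u.1 - t) * 2 ^ i)
  have hj' := Nat.ceil_lt_add_one ha.le
  set j := ⌈(u.1 - t) * 2 ^ i⌉₊
  have hup : gridPoint t (i, j) ≤ u.2 := by
    have : (j : ℝ) / 2 ^ i ≤ (u.1 - t) + (2 ^ i)⁻¹ := by
      rw [div_le_iff₀ hpos, add_mul, inv_mul_cancel₀ hpos.ne']
      exact hj'.le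
    simp only [gridPoint]
    linarith
  refine ⟨j, Nat.ceil_pos.2 ha, ?_, ?_, hup⟩
  · have : (j : ℝ) / 2 ^ i < 1 := by
      simp only [gridPoint] at hup
      linarith
    rw [div_lt_one hpos] at this
    exact_mod_cast this.le
  · have : u.1 - t ≤ (j : ℝ) / 2 ^ i := by rwa [le_div_iff₀ hpos]
    simp only [gridPoint]
    linarith

end Schedule

/-! ### What failed pairs say about the interval -/

section

variable {C : Finset ℝ} {u : ℝ × ℝ} {t : ℕ} {p : ℕ × ℕ}

/-- If the approval interval meets the range between the two neighbours, then either it stays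
inside, and the interval query is approved, or it sticks out over one of the two. In that case this
neighbour is not a segment end, hence a candidate, and it is approved. -/
theorem InSegment.lt_or_lt_of_failed (hu : InSegment u t) (h : Failed C u t p) :
    u.2 < gridLeft C t p ∨ gridRight C t p < u.1 := by
  obtain ⟨h1, h2, h3⟩ := h
  rw [← Bool.not_eq_true] at h1 h2 h3
  rw [answer_point] at h1 h2
  rw [answer_interval hu.le] at h3
  by_contra! hcon
  apply h3
  have a1 := hu.left
  have a2 := hu.le
  have a3 := hu.right
  constructor
  · by_contra! hlt
    have : gridLeft C t p ∈ C := leftNbr_mem_of_lt (a1.trans hlt)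
    exact h1 ⟨this, hlt.le, hcon.1⟩
  · by_contra! hlt
    have : gridRight C t p ∈ C := rightNbr_mem_of_lt (hlt.trans a3)
    exact h2 ⟨this, hcon.2, hlt.le⟩

theorem InSegment.gridPoint_not_mem_of_failed (hu : InSegment u t) (h : Failed C u t p)
    (hp : p.2 ≤ 2 ^ p.1) (h1 : u.1 ≤ gridPoint t p) (h2 : gridPoint t p ≤ u.2) : False := by
  have h3 : gridLeft C t p ≤ gridPoint t p := leftNbr_le start_le_gridPoint
  have h4 : gridPoint t p ≤ gridRight C t p := le_rightNbr (gridPoint_le_end hp)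
  rcases hu.lt_or_lt_of_failed h with h | h <;> linarith

theorem gridLeft_le_and_le_gridRight (hp : p.2 ≤ 2 ^ p.1)
    (happ : answer C u (.point (gridLeft C t p)) = true ∨
      answer C u (.point (gridRight C t p)) = true) :
    gridLeft C t p ≤ u.2 ∧ u.1 ≤ gridRight C t p := by
  have h3 : gridLeft C t p ≤ gridPoint t p := leftNbr_le start_le_gridPoint
  have h4 : gridPoint t p ≤ gridRight C t p := le_rightNbr (gridPoint_le_end hp)
  rw [answer_point, answer_point] at happ
  rcases happ with h | h <;> constructor <;> linarith [h.2.1, h.2.2]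

/-- When pair `p` is the first successful one, the approval interval lies between the two points
adjacent to the point of `p`, which belong to failed pairs or are not inside the segment. -/
theorem InSegment.bounds_of_hit (hu : InSegment u t) {R : ℕ} {l₁ l₂ : List (ℕ × ℕ)}
    (h : schedule R = l₁ ++ p :: l₂) (hf : ∀ q ∈ l₁, Failed C u t q)
    (happ : answer C u (.point (gridLeft C t p)) = true ∨
      answer C u (.point (gridRight C t p)) = true) :
    ((t + ((p.2 : ℝ) - 1) / 2 ^ p.1 = t ∨
        ∃ q ∈ l₁, gridPoint t q = t + ((p.2 : ℝ) - 1) / 2 ^ p.1) ∧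
      t + ((p.2 : ℝ) - 1) / 2 ^ p.1 < u.1) ∧
    ((t + 1 ≤ t + ((p.2 : ℝ) + 1) / 2 ^ p.1 ∨
        ∃ q ∈ l₁, gridPoint t q = t + ((p.2 : ℝ) + 1) / 2 ^ p.1) ∧
      u.2 < t + ((p.2 : ℝ) + 1) / 2 ^ p.1) := by
  have hp : p ∈ schedule R := by rw [h]; simp
  rw [mem_schedule] at hp
  have hs : ∀ q ∈ l₁, q.2 ≤ 2 ^ q.1 := fun q hq =>
    (mem_schedule.1 (show q ∈ schedule R by rw [h]; simp [hq])).2.2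
  obtain ⟨n1, n2⟩ := gridLeft_le_and_le_gridRight hp.2.2 happ
  have hxl : t + ((p.2 : ℝ) - 1) / 2 ^ p.1 < gridPoint t p := by
    unfold gridPoint; gcongr; linarith
  have hxr : gridPoint t p < t + ((p.2 : ℝ) + 1) / 2 ^ p.1 := by
    unfold gridPoint; gcongr; linarith
  have key : (t + ((p.2 : ℝ) - 1) / 2 ^ p.1 = t ∨
        ∃ q ∈ l₁, gridPoint t q = t + ((p.2 : ℝ) - 1) / 2 ^ p.1) ∧
      (t + 1 ≤ t + ((p.2 : ℝ) + 1) / 2 ^ p.1 ∨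
        ∃ q ∈ l₁, gridPoint t q = t + ((p.2 : ℝ) + 1) / 2 ^ p.1) := by
    -- In round 1 the adjacent points are ends of the segment, points beyond it, or the point of
    -- `(1, 1)`. In later rounds `j` is odd, so `j - 1` and `j + 1` are even and the adjacent points
    -- belong to the previous round or are ends of the segment.
    obtain ⟨i, j⟩ := p
    simp only at hp ⊢
    rcases Nat.lt_or_ge i 2 with hi | hi
    · have hi1 : i = 1 := by omega
      subst hi1
      have hj : j = 1 ∨ j = 2 := by simp at hp; omega
      rcases hj with rfl | rfl
      · norm_num
      · refine ⟨Or.inr ⟨(1, 1), ?_, ?_⟩, Or.inl ?_⟩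
        · exact mem_of_schedule_eq h (by norm_num) (by norm_num) (by norm_num) (by norm_num)
        · norm_num [gridPoint]
        · norm_num
    · obtain ⟨i', rfl⟩ : ∃ i', i = i' + 1 := ⟨i - 1, by omega⟩
      have hpow : (2 : ℕ) ^ (i' + 1) = 2 * 2 ^ i' := by ring
      rcases Nat.even_or_odd' j with ⟨j', rfl | rfl⟩
      -- For even `j` the point is that of `(i - 1, j / 2)`, which has already failed with the same
      -- two neighbours.
      · exfalso
        have hq : (i', j') ∈ l₁ :=
          mem_of_schedule_eq h (by simp; omega) (by simp; omega) (by simp; omega) (by simp)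
        have hg : gridPoint t (i', j') = gridPoint t (i' + 1, 2 * j') := by
          simp only [gridPoint, pow_succ]
          push_cast
          field_simp
        have hfq := hf _ hq
        simp only [Failed, gridLeft, gridRight, hg] at hfq
        simp only [gridLeft, gridRight, hfq.1, hfq.2.1] at happ
        simp at happ
      · have e1 : ((((2 * j' + 1 : ℕ) : ℝ)) - 1) / 2 ^ (i' + 1) = (j' : ℝ) / 2 ^ i' := by
          rw [pow_succ]; push_cast; field_simp; ring
        have e2 : ((((2 * j' + 1 : ℕ) : ℝ)) + 1) / 2 ^ (i' + 1) = ((j' + 1 : ℕ) : ℝ) / 2 ^ i' := by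
          rw [pow_succ]; push_cast; field_simp; ring
        rw [e1, e2]
        constructor
        · rcases Nat.eq_zero_or_pos j' with rfl | hj'
          · left; simp
          · right
            exact ⟨(i', j'), mem_of_schedule_eq h (by simp; omega) (by simp; omega)
              (by simp; omega) (by simp), rfl⟩
        · right
          exact ⟨(i', j' + 1), mem_of_schedule_eq h (by simp; omega) (by simp)
              (by simp; omega) (by simp), rfl⟩
  refine ⟨⟨key.1, ?_⟩, ⟨key.2, ?_⟩⟩
  · rcases key.1 with h0 | ⟨q, hq, hqe⟩
    · rw [h0]; exact hu.left
    · have h4 : gridPoint t q ≤ gridRight C t q := le_rightNbr (gridPoint_le_end (hs q hq))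
      have h3 : gridLeft C t q ≤ gridPoint t q := leftNbr_le start_le_gridPoint
      -- The interval cannot lie to the left of `gridLeft C t q`: that candidate is at most
      -- `gridLeft C t p`, which is at most `u.2` because pair `p` is successful.
      rcases hu.lt_or_lt_of_failed (hf q hq) with h5 | h5
      · exfalso
        have hm : gridLeft C t q ∈ C := leftNbr_mem_of_lt ((hu.left.trans_le hu.le).trans h5)
        have : gridLeft C t q ≤ gridLeft C t p := le_leftNbr hm (by linarith)
        linarith
      · linarith
  · rcases key.2 with h0 | ⟨q, hq, hqe⟩
    · exact hu.right.trans_le h0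
    · have h4 : gridPoint t q ≤ gridRight C t q := le_rightNbr (gridPoint_le_end (hs q hq))
      have h3 : gridLeft C t q ≤ gridPoint t q := leftNbr_le start_le_gridPoint
      rcases hu.lt_or_lt_of_failed (hf q hq) with h5 | h5
      · linarith
      · exfalso
        have hm : gridRight C t q ∈ C := rightNbr_mem_of_lt (h5.trans (hu.le.trans_lt hu.right))
        have : gridRight C t p ≤ gridRight C t q := rightNbr_le hm (by linarith)
        linarith

end

/-! ### What is learnt from a resolution, and its cost -/

section

variable {ι : Type} {C P : Finset ℝ} {v : ι} {ans : ι → Query → Bool} {u : ℝ × ℝ} {t : ℕ}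

theorem answer_point_eq_false {x : ℝ} (h : x < u.1 ∨ u.2 < x) :
    answer C u (.point x) = false := by
  rw [← Bool.not_eq_true, answer_point]
  rintro ⟨-, h1, h2⟩
  rcases h with h | h <;> linarith

theorem mem_between {x y c : ℝ} : c ∈ between P x y ↔ c ∈ P ∧ x < c ∧ c < y := by
  simp [between]

theorem length_between_le {x y : ℝ} : (between P x y).length ≤ P.card := by
  rw [between, Finset.length_sort]
  exact Finset.card_filter_le _ _

theorem pairwise_between {x y : ℝ} : (between P x y).Pairwise (· < ·) :=
  (Finset.sortedLT_sort _).pairwise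

/-- What is learnt from resolving a voter with approval interval `[u.1, u.2]` for `P`. -/
structure ResolveSpec (C P : Finset ℝ) (v : ι) (u : ℝ × ℝ) (t R : ℕ)
    (z : Finset ℝ × Dialogue ι) : Prop where
  result : z.1 = P.filter (· ∈ ballot C u)
  exists_point : ∀ c ∈ ballot C u, ApprovedSome z.2 → ∃ x, (v, Query.point x, true) ∈ z.2
  below : ∀ y ∈ P, (t : ℝ) < y → y < u.1 →
    ∃ y', (v, Query.point y', false) ∈ z.2 ∧ y ≤ y' ∧ y' < u.1
  above : ∀ y ∈ P, y < (t : ℝ) + 1 → u.2 < y →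
    ∃ y', (v, Query.point y', false) ∈ z.2 ∧ y' ≤ y ∧ u.2 < y'
  least : ∀ y ∈ P, u.1 ≤ y → y ≤ u.2 → ∃ y', (v, Query.point y', true) ∈ z.2 ∧ y' ≤ y
  greatest : ∀ y ∈ P, u.1 ≤ y → y ≤ u.2 → ∃ y', (v, Query.point y', true) ∈ z.2 ∧ y ≤ y'
  approvedSome : ((2 : ℝ) ^ R)⁻¹ ≤ u.2 - u.1 → ApprovedSome z.2
  length_le : z.2.length ≤ 3 * 2 ^ (R + 1) + 2 * Nat.clog 2 (P.card + 1) + P.card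
  length_le_of_long : ∀ i, 1 ≤ i → i ≤ R → ((2 : ℝ) ^ i)⁻¹ ≤ u.2 - u.1 →
    z.2.length ≤ 3 * 2 ^ (i + 1) + 2 * Nat.clog 2 (P.card + 1)

/-- No candidate is approved when the interval query of a pair is. -/
theorem not_approved_of_interval (hu : InSegment u t) {p : ℕ × ℕ} 
    (h1 : answer C u (.point (gridLeft C t p)) = false)
    (h2 : answer C u (.point (gridRight C t p)) = false)
    (h3 : answer C u (.interval (gridLeft C t p) (gridRight C t p)) = true)
    {c : ℝ} (hc : c ∈ C) (hc1 : u.1 ≤ c) (hc2 : c ≤ u.2) : False := by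
  rw [answer_interval hu.le] at h3
  rcases le_total c (gridPoint t p) with h | h
  · have h4 : c ≤ gridLeft C t p := le_leftNbr hc h
    have h5 : gridLeft C t p = c := by linarith
    rw [h5, answer_point.2 ⟨hc, hc1, hc2⟩] at h1
    exact absurd h1 (by simp)
  · have h4 : gridRight C t p ≤ c := rightNbr_le hc h
    have h5 : gridRight C t p = c := by linarith
    rw [h5, answer_point.2 ⟨hc, hc1, hc2⟩] at h2
    exact absurd h2 (by simp)

theorem approvedSome_of_mem {D : Dialogue ι} {q : Query} (h : (v, q, true) ∈ D) : ApprovedSome D :=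
  ⟨_, h, rfl⟩

/-- The validation test sees only the extreme approved queries and the nearest disapproved ones. The
fields `below`, `above`, `least` and `greatest` say that this is as good as having asked about every
position of `P`: binary searches and failed pairs leave answers at least as informative. -/
theorem run_resolveIn (hans : ∀ q, ans v q = answer C u q) (hu : InSegment u t)
    (hPC : ∀ x ∈ P, x ≠ t → x ≠ t + 1 → x ∈ C) (R : ℕ) :
    ResolveSpec C P v u t R ((resolveIn C P v t (schedule R)).run ans) := by
  obtain ⟨l₁, l₂, hl, hf, hc⟩ := resolveIn_ends (P := P) (t := t) hans (schedule R)
  set z := (resolveIn C P v t (schedule R)).run ans with hz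
  have hu1 := hu.left
  have hu2 := hu.le
  have hu3 := hu.right
  have hs : ∀ q ∈ schedule R, q.2 ≤ 2 ^ q.1 := fun q hq => (mem_schedule.1 hq).2.2
  have hR := length_schedule_add_two R
  have hlen : l₁.length + l₂.length = (schedule R).length := by rw [hl, List.length_append]
  have hP : ∀ x ∈ P, (t : ℝ) < x → x < t + 1 → x ∈ C := fun x hx h1 h2 => hPC x hx h1.ne' h2.ne
  have hPu : ∀ c ∈ P, u.1 ≤ c → c ≤ u.2 → c ∈ C := fun c hc h1 h2 =>
    hP c hc (hu1.trans_le h1) (h2.trans_lt hu3)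
  have hfailgrid : ∀ i j, (i, j) ∈ l₁ → j ≤ 2 ^ i → u.1 ≤ gridPoint t (i, j) →
      gridPoint t (i, j) ≤ u.2 → False := fun i j h h1 h2 h3 =>
    hu.gridPoint_not_mem_of_failed (hf _ h).1 h1 h2 h3
  -- A long interval contains a point of round `i`, and its pair cannot be among the failed ones. So
  -- the failed pairs and `p` all belong to `schedule i`, which has `2 ^ (i + 1) - 2` members.
  have hlong : ∀ i, 1 ≤ i → i ≤ R → ((2 : ℝ) ^ i)⁻¹ ≤ u.2 - u.1 →
      ∃ p l₃, l₂ = p :: l₃ ∧ l₁.length + 1 + 2 ≤ 2 ^ (i + 1) := by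
    intro i hi hiR hL
    obtain ⟨j, hj1, hj2, hj3, hj4⟩ := exists_gridPoint_mem hu hL
    have hmem : (i, j) ∈ schedule R := mem_schedule.2 ⟨⟨hi, hiR⟩, hj1, hj2⟩
    rw [hl, List.mem_append] at hmem
    rcases hmem with hmem | hmem
    · exact (hfailgrid i j hmem hj2 hj3 hj4).elim
    · cases l₂ with
      | nil => simp at hmem
      | cons p l₃ =>
        refine ⟨p, l₃, rfl, ?_⟩
        have hpw := pairwise_schedule R
        have hnd := nodup_schedule R
        have hmem' : ∀ q ∈ l₁ ++ p :: l₃, q ∈ schedule R := fun q hq => hl ▸ hq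
        rw [hl, List.pairwise_append, List.pairwise_cons] at hpw
        rw [hl] at hnd
        have hsub : ∀ q ∈ l₁ ++ [p], q ∈ schedule i := by
          intro q hq
          have hqR := mem_schedule.1 (hmem' q (by
            rcases List.mem_append.1 hq with h | h
            · simp [h]
            · simp at h; simp [h]))
          refine mem_schedule.2 ⟨⟨hqR.1.1, ?_⟩, hqR.2⟩
          rcases List.mem_append.1 hq with h | h
          · have := hpw.2.2 q h (i, j) hmem
            simp only at this
            omega
          · rw [List.mem_singleton] at h
            subst h
            rcases List.mem_cons.1 hmem with h | h
            · rw [← h]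
            · have := hpw.2.1.1 (i, j) h
              simp only at this
              omega
        have hnd' : (l₁ ++ [p]).Nodup := by
          have : (l₁ ++ [p]).Sublist (l₁ ++ p :: l₃) :=
            List.Sublist.append (List.Sublist.refl _) (by simp)
          exact hnd.sublist this
        have := (List.subperm_of_subset hnd' hsub).length_le
        have hi' := length_schedule_add_two i
        rw [List.length_append, List.length_singleton] at this
        omega
  have hlong0 : ((2 : ℝ) ^ R)⁻¹ ≤ u.2 - u.1 → ∃ p l₃, l₂ = p :: l₃ := by
    intro hL
    rcases Nat.eq_zero_or_pos R with rfl | hR0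
    · norm_num at hL; linarith
    · obtain ⟨p, l₃, h, -⟩ := hlong R hR0 le_rfl hL
      exact ⟨p, l₃, h⟩
  rcases hc with ⟨rfl, hc⟩ | ⟨p, l₃, rfl, hc⟩
  · -- all positions are asked
    have hasked : ∀ x ∈ P, (t : ℝ) < x → x < t + 1 →
        (v, Query.point x, answer C u (.point x)) ∈ z.2 := fun x hx h1 h2 =>
      hc.asked x hx h1.le h2.le (hP x hx h1 h2)
    refine ⟨?_, ?_, ?_, ?_, ?_, ?_, ?_, ?_, ?_⟩
    · rw [hc.result]
      ext c
      simp only [Finset.mem_filter, ballot]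
      constructor
      · rintro ⟨h1, -, h2⟩; exact ⟨h1, h2⟩
      · rintro ⟨h1, h2, h3, h4⟩; exact ⟨h1, ⟨by linarith, by linarith⟩, h2, h3, h4⟩
    · rintro c - ⟨e, he, het⟩
      obtain ⟨x, hx⟩ := hc.point_of_approved e he het
      have hev : e.1 = v := (asksOnly_resolveIn (C := C) P t (schedule R)).eq_of_mem ans he
      refine ⟨x, ?_⟩
      rwa [← hev, ← hx, ← het]
    · intro y hy h1 h2
      refine ⟨y, ?_, le_rfl, h2⟩
      have := hasked y hy h1 (by linarith)
      rwa [answer_point_eq_false (Or.inl h2)] at this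
    · intro y hy h1 h2
      refine ⟨y, ?_, le_rfl, h2⟩
      have := hasked y hy (by linarith) h1
      rwa [answer_point_eq_false (Or.inr h2)] at this
    · intro y hy h1 h2
      refine ⟨y, ?_, le_rfl⟩
      have := hasked y hy (by linarith) (by linarith)
      rwa [answer_point.2 ⟨hPu y hy h1 h2, h1, h2⟩] at this
    · intro y hy h1 h2
      refine ⟨y, ?_, le_rfl⟩
      have := hasked y hy (by linarith) (by linarith)
      rwa [answer_point.2 ⟨hPu y hy h1 h2, h1, h2⟩] at this
    · intro hL
      obtain ⟨p, l₃, h⟩ := hlong0 hL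
      simp at h
    · have := hc.length_le
      simp only [List.length_nil] at hlen
      omega
    · intro i hi hiR hL
      obtain ⟨p, l₃, h, -⟩ := hlong i hi hiR hL
      simp at h
  have hp : p ∈ schedule R := by rw [hl]; simp
  have hp2 := hs p hp
  rw [List.length_cons] at hlen
  set x := gridPoint t p with hx
  have hx0 : (t : ℝ) ≤ x := start_le_gridPoint
  have hx1 : x ≤ t + 1 := gridPoint_le_end hp2
  have hlo : gridLeft C t p ≤ x := leftNbr_le hx0
  have hhi : x ≤ gridRight C t p := le_rightNbr hx1
  have hlo' : ∀ y ∈ C, y ≤ x → y ≤ gridLeft C t p := fun y hy h => le_leftNbr hy h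
  have hhi' : ∀ y ∈ C, x ≤ y → gridRight C t p ≤ y := fun y hy h => rightNbr_le hy h
  have hloC : (t : ℝ) < gridLeft C t p → gridLeft C t p ∈ C := leftNbr_mem_of_lt
  have hhiC : gridRight C t p < t + 1 → gridRight C t p ∈ C := rightNbr_mem_of_lt
  rcases hc with hc | hc
  · -- a point query is approved
    obtain ⟨n1, n2⟩ := gridLeft_le_and_le_gridRight hp2 hc.approved
    obtain ⟨⟨hxl, hxl'⟩, hxr, hxr'⟩ := hu.bounds_of_hit hl (fun q hq => (hf q hq).1) hc.approved
    set xl := t + ((p.2 : ℝ) - 1) / 2 ^ p.1 with hxldef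
    set xr := t + ((p.2 : ℝ) + 1) / 2 ^ p.1 with hxrdef
    have hxl0 : (t : ℝ) ≤ xl := by
      have h1 : (1 : ℝ) ≤ p.2 := by exact_mod_cast (mem_schedule.1 hp).2.1
      have : (0 : ℝ) ≤ ((p.2 : ℝ) - 1) / 2 ^ p.1 := div_nonneg (by linarith) (by positivity)
      linarith
    have hmemL : ∀ y, y ∈ searchLeft P t p ↔ y ∈ P ∧ xl < y ∧ y < x := fun y => mem_between
    have hmemR : ∀ y, y ∈ searchRight P t p ↔ y ∈ P ∧ x < y ∧ y < xr := fun y => mem_between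
    have hlo_app : answer C u (.point (gridLeft C t p)) = true → u.1 ≤ gridLeft C t p :=
      fun h => (answer_point.1 h).2.1
    have hhi_app : answer C u (.point (gridRight C t p)) = true → gridRight C t p ≤ u.2 :=
      fun h => (answer_point.1 h).2.2
    -- A position left of `x` is at most `gridLeft C t p`, hence at most `u.2`: the precondition of
    -- the search.
    have F := run_firstApproved hans (searchLeft P t p) pairwise_between (by
      intro y hy
      rw [hmemL] at hy
      have hyC := hP y hy.1 (by linarith) (by linarith)
      exact ⟨hyC, (hlo' y hyC hy.2.2.le).trans n1⟩)
    -- If `x` is the right end of the segment, the right search may run into the next segment. Its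
    -- entries are then beyond `t + 1`, hence still candidates, so the search remains correct.
    have hxr1 : xr ≤ t + 1 ∨ t + 1 ≤ x := by
      rcases Nat.lt_or_ge p.2 (2 ^ p.1) with h | h
      · left
        have : ((p.2 : ℝ) + 1) / 2 ^ p.1 ≤ 1 := by
          rw [div_le_one (by positivity)]
          exact_mod_cast h
        linarith
      · right
        have : (1 : ℝ) ≤ (p.2 : ℝ) / 2 ^ p.1 := by
          rw [one_le_div (by positivity)]
          exact_mod_cast h
        rw [hx, gridPoint]; linarith
    have G := run_lastApproved hans (searchRight P t p) pairwise_between (by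
      intro y hy
      rw [hmemR] at hy
      have hyC := hPC y hy.1 (by linarith) (by rcases hxr1 with h | h <;> intro h' <;> linarith)
      exact ⟨hyC, n2.trans (hhi' y hyC hy.2.1.le)⟩)
    have hres := hc.result
    have hfirst := hc.first_subset
    have hlast := hc.last_subset
    have hlenz := hc.length_le
    have hF4 := F.length_le.trans (Nat.clog_mono_right 2
      (Nat.add_le_add_right (length_between_le (P := P)) 1))
    have hG4 := G.length_le.trans (Nat.clog_mono_right 2
      (Nat.add_le_add_right (length_between_le (P := P)) 1))
    set α := (firstApproved C v (searchLeft P t p)).run ans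
    set β := (lastApproved C v (searchRight P t p)).run ans
    have htruth : ∀ y r, (v, Query.point y, r) ∈ z.2 → r = answer C u (.point y) := by
      intro y r h
      rw [← hans]
      exact truthful _ ans h
    have hlo_mem : answer C u (.point (gridLeft C t p)) = true →
        (v, Query.point (gridLeft C t p), true) ∈ z.2 := fun h => by
      have := hc.recorded.1 (answer_point.1 h).1
      rwa [h] at this
    have hhi_mem : answer C u (.point (gridRight C t p)) = true →
        (v, Query.point (gridRight C t p), true) ∈ z.2 := fun h => by
      have := hc.recorded.2 (answer_point.1 h).1
      rwa [h] at this
    obtain ⟨A, hA⟩ : ∃ A, A = α.1.getD (if answer C u (.point (gridLeft C t p)) then gridLeft C t p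
      else gridRight C t p) := ⟨_, rfl⟩
    obtain ⟨B, hB⟩ : ∃ B, B = β.1.getD (if answer C u (.point (gridRight C t p)) then
      gridRight C t p else gridLeft C t p) := ⟨_, rfl⟩
    rw [← hA, ← hB] at hres
    have hAmem : (v, Query.point A, true) ∈ z.2 := by
      rw [hA]
      cases ho : α.1 with
      | some y => exact hfirst _ (F.some y ho).2.2
      | none =>
        simp only [Option.getD_none]
        split_ifs with h
        · exact hlo_mem h
        · exact hhi_mem (hc.approved.resolve_left h)
    have hBmem : (v, Query.point B, true) ∈ z.2 := by
      rw [hB]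
      cases ho : β.1 with
      | some y => exact hlast _ (G.some y ho).2.2
      | none =>
        simp only [Option.getD_none]
        split_ifs with h
        · exact hhi_mem h
        · exact hlo_mem (hc.approved.resolve_right h)
    have hAle : ∀ y ∈ P, u.1 ≤ y → y ≤ u.2 → A ≤ y := by
      intro y hy h1 h2
      have hyC := hPu y hy h1 h2
      rcases lt_or_ge y x with h | h
      · obtain ⟨x', hx', hx'y⟩ := F.least y ((hmemL y).2 ⟨hy, by linarith, h⟩) h1
        rw [hA, hx']; exact hx'y
      · rw [hA]
        cases ho : α.1 with
        | some y' => exact (((hmemL y').1 (F.some y' ho).1).2.2.trans_le h).le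
        | none =>
          simp only [Option.getD_none]
          split_ifs
          · exact hlo.trans h
          · exact hhi' y hyC h
    have hleB : ∀ y ∈ P, u.1 ≤ y → y ≤ u.2 → y ≤ B := by
      intro y hy h1 h2
      have hyC := hPu y hy h1 h2
      rcases lt_or_ge x y with h | h
      · obtain ⟨x', hx', hx'y⟩ := G.greatest y ((hmemR y).2 ⟨hy, h, by linarith⟩) h2
        rw [hB, hx']; exact hx'y
      · rw [hB]
        cases ho : β.1 with
        | some y' => exact (h.trans_lt ((hmemR y').1 (G.some y' ho).1).2.1).le
        | none =>
          simp only [Option.getD_none]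
          split_ifs
          · exact h.trans hhi
          · exact hlo' y hyC h
    refine ⟨?_, ?_, ?_, ?_, ?_, ?_, ?_, ?_, ?_⟩
    · rw [hres]
      ext c
      simp only [Finset.mem_filter, ballot, and_congr_right_iff]
      intro hcP
      constructor
      · rintro ⟨h1, h2⟩
        have h3 := (answer_point.1 (htruth _ _ hAmem).symm).2.1
        have h4 := (answer_point.1 (htruth _ _ hBmem).symm).2.2
        exact ⟨hPu c hcP (h3.trans h1) (h2.trans h4), h3.trans h1, h2.trans h4⟩
      · rintro ⟨-, h1, h2⟩
        exact ⟨hAle c hcP h1 h2, hleB c hcP h1 h2⟩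
    · exact fun c _ _ => ⟨A, hAmem⟩
    · intro y hy h1 h2
      have hyC := hP y hy h1 (by linarith)
      have hyx : y < x := by
        by_contra! h
        have h4 := hhi' y hyC h
        linarith
      have hylo := hlo' y hyC hyx.le
      by_cases hlo1 : gridLeft C t p < u.1
      · refine ⟨_, ?_, hylo, hlo1⟩
        have := hc.recorded.1 (hloC (h1.trans_le hylo))
        rwa [answer_point_eq_false (Or.inl hlo1)] at this
      · by_cases hyl : xl < y
        · obtain ⟨y', -, q2, q3, q4⟩ := F.below y ((hmemL y).2 ⟨hy, hyl, hyx⟩) h2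
          exact ⟨y', hfirst _ q4, q2, q3⟩
        -- The search does not reach positions up to `xl`. But `xl` is the point of a failed pair,
        -- and its left neighbour is a recorded disapproval between `y` and `u.1`.
        · obtain ⟨q, hq, hqe⟩ := hxl.resolve_left (by intro h; linarith)
          have h5 : y ≤ gridLeft C t q := le_leftNbr hyC (by rw [hqe]; linarith)
          have h6 : gridLeft C t q ≤ gridPoint t q := leftNbr_le start_le_gridPoint
          refine ⟨_, ?_, h5, by linarith⟩
          have := (hf q hq).2.1 (leftNbr_mem_of_lt (h1.trans_le h5))
          rwa [(hf q hq).1.1] at this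
    · intro y hy h1 h2
      have hyC := hP y hy (by linarith) h1
      have hyx : x < y := by
        by_contra! h
        have h4 := hlo' y hyC h
        linarith
      have hyhi := hhi' y hyC hyx.le
      by_cases hhi1 : u.2 < gridRight C t p
      · refine ⟨_, ?_, hyhi, hhi1⟩
        have := hc.recorded.2 (hhiC (hyhi.trans_lt h1))
        rwa [answer_point_eq_false (Or.inr hhi1)] at this
      · by_cases hyr : y < xr
        · obtain ⟨y', -, q2, q3, q4⟩ := G.above y ((hmemR y).2 ⟨hy, hyx, hyr⟩) h2
          exact ⟨y', hlast _ q4, q2, q3⟩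
        · obtain ⟨q, hq, hqe⟩ := hxr.resolve_left (by intro h; linarith)
          have h5 : gridRight C t q ≤ y := rightNbr_le hyC (by rw [hqe]; linarith)
          have h6 : gridPoint t q ≤ gridRight C t q := le_rightNbr
            (gridPoint_le_end (hs q (by rw [hl]; simp [hq])))
          refine ⟨_, ?_, h5, by linarith⟩
          have := (hf q hq).2.2 (rightNbr_mem_of_lt (h5.trans_lt h1))
          rwa [(hf q hq).1.2.1] at this
    · exact fun y hy h1 h2 => ⟨A, hAmem, hAle y hy h1 h2⟩
    · exact fun y hy h1 h2 => ⟨B, hBmem, hleB y hy h1 h2⟩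
    · exact fun _ => approvedSome_of_mem hAmem
    · omega
    · intro i hi hiR hL
      obtain ⟨-, -, -, h⟩ := hlong i hi hiR hL
      omega
  · -- the interval query is approved
    -- Nothing is approved in this case, so a neighbour of `x` between a position and the interval
    -- cannot lie inside the interval, and its disapproval is the required record.
    have hno := fun c hcC h1 h2 =>
      not_approved_of_interval (c := c) hu hc.left hc.right hc.interval hcC h1 h2
    have hI := (answer_interval hu2).1 hc.interval
    refine ⟨?_, ?_, ?_, ?_, ?_, ?_, ?_, ?_, ?_⟩
    · rw [hc.result]
      ext c
      simp only [Finset.mem_filter, ballot, Finset.notMem_empty, false_iff]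
      rintro ⟨-, h1, h2, h3⟩
      exact hno c h1 h2 h3
    · intro c h
      simp only [ballot, Finset.mem_filter] at h
      exact (hno c h.1 h.2.1 h.2.2).elim
    · intro y hy h1 h2
      have hyC := hP y hy h1 (by linarith)
      have hyx : y < x := by
        by_contra! h
        have h4 := hhi' y hyC h
        linarith
      have hylo := hlo' y hyC hyx.le
      have hm := hloC (h1.trans_le hylo)
      have h4 : gridLeft C t p < u.1 := by
        by_contra! h
        exact hno _ hm h (by linarith)
      refine ⟨_, ?_, hylo, h4⟩
      have := hc.recorded.1 hm
      rwa [hc.left] at this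
    · intro y hy h1 h2
      have hyC := hP y hy (by linarith) h1
      have hyx : x < y := by
        by_contra! h
        have h4 := hlo' y hyC h
        linarith
      have hyhi := hhi' y hyC hyx.le
      have hm := hhiC (hyhi.trans_lt h1)
      have h4 : u.2 < gridRight C t p := by
        by_contra! h
        exact hno _ hm (by linarith) h
      refine ⟨_, ?_, hyhi, h4⟩
      have := hc.recorded.2 hm
      rwa [hc.right] at this
    · exact fun y hy h1 h2 => (hno y (hPu y hy h1 h2) h1 h2).elim
    · exact fun y hy h1 h2 => (hno y (hPu y hy h1 h2) h1 h2).elim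
    · exact fun _ => approvedSome_of_mem hc.interval_mem
    · have := hc.length_le
      omega
    · intro i hi hiR hL
      obtain ⟨-, -, -, h⟩ := hlong i hi hiR hL
      have := hc.length_le
      omega

end

/-! ### Greedy selection, the guessed committee and the query positions -/

theorem argmin_nonempty {s : Finset ℝ} (hs : s.Nonempty) (f : ℝ → ℝ) : (argmin s f).Nonempty := by
  obtain ⟨c, hc, hmin⟩ := s.exists_min_image f hs
  exact ⟨c, Finset.mem_filter.2 ⟨hc, hmin⟩⟩

theorem argmin_subset (s : Finset ℝ) (f : ℝ → ℝ) : argmin s f ⊆ s := Finset.filter_subset _ _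

/-- Greedy selection: for `ξ = 2, …, N + 1` a not yet selected element with least `f ξ` is added. -/
def greedy (S : Finset ℝ) (tie : Finset ℝ → ℝ) (f : ℕ → ℝ → ℝ) (N : ℕ) : Finset ℝ :=
  (List.range' 2 N).foldl
    (fun W ξ => if (S \ W).Nonempty then insert (tie (argmin (S \ W) (f ξ))) W else W) ∅

theorem greedy_succ (S : Finset ℝ) (tie : Finset ℝ → ℝ) (f : ℕ → ℝ → ℝ) (N : ℕ) :
    greedy S tie f (N + 1) =
      if (S \ greedy S tie f N).Nonempty then
        insert (tie (argmin (S \ greedy S tie f N) (f (N + 2)))) (greedy S tie f N)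
      else greedy S tie f N := by
  rw [greedy, List.range'_concat, List.foldl_append, one_mul, add_comm 2 N]
  rfl

variable {tie : Finset ℝ → ℝ}

theorem greedy_subset (htie : ∀ s : Finset ℝ, s.Nonempty → tie s ∈ s) (S : Finset ℝ)
    (f : ℕ → ℝ → ℝ) (N : ℕ) : greedy S tie f N ⊆ S := by
  induction N with
  | zero => simp [greedy]
  | succ N ih =>
    rw [greedy_succ]
    split_ifs with h
    · have := argmin_subset _ _ (htie _ (argmin_nonempty h (f (N + 2))))
      exact Finset.insert_subset (Finset.mem_sdiff.1 this).1 ih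
    · exact ih

theorem card_greedy_le (S : Finset ℝ) (f : ℕ → ℝ → ℝ) (N : ℕ) : (greedy S tie f N).card ≤ N := by
  induction N with
  | zero => simp [greedy]
  | succ N ih =>
    rw [greedy_succ]
    split_ifs with h
    · exact (Finset.card_insert_le _ _).trans (by omega)
    · omega

/-- `d ξ` is the element selected at step `ξ`. If an element is left at the end, no step was
skipped, and a leftover element was available at every step; so each choice was at least as good as
the leftover for its own `f ξ`. -/
theorem exists_greedy_enumeration (htie : ∀ s : Finset ℝ, s.Nonempty → tie s ∈ s) (S : Finset ℝ)
    (f : ℕ → ℝ → ℝ) (N : ℕ) (hN : (S \ greedy S tie f N).Nonempty) :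
    ∃ d : ℕ → ℝ, Set.InjOn d (Set.Icc 2 (N + 1)) ∧
      (∀ w, w ∈ greedy S tie f N ↔ ∃ ξ ∈ Set.Icc 2 (N + 1), d ξ = w) ∧
      ∀ ξ ∈ Set.Icc 2 (N + 1), ∀ c ∈ S \ greedy S tie f N, f ξ (d ξ) ≤ f ξ c := by
  induction N with
  | zero =>
    refine ⟨fun _ => 0, ?_, ?_, ?_⟩
    · intro ξ hξ
      simp only [Set.mem_Icc] at hξ; omega
    · intro w
      simp only [greedy, List.range'_zero, List.foldl_nil, Finset.notMem_empty, false_iff]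
      rintro ⟨ξ, hξ, -⟩
      simp only [Set.mem_Icc] at hξ; omega
    · intro ξ hξ
      simp only [Set.mem_Icc] at hξ; omega
  | succ N ih =>
    rw [greedy_succ] at hN ⊢
    by_cases h : (S \ greedy S tie f N).Nonempty
    swap
    · rw [if_neg h] at hN; exact absurd hN h
    obtain ⟨d, hinj, hmem, hle⟩ := ih h
    set W := greedy S tie f N with hW
    rw [if_pos h]
    have hnew := htie _ (argmin_nonempty h (f (N + 2)))
    set a := tie (argmin (S \ W) (f (N + 2))) with ha
    have haW : a ∉ W := (Finset.mem_sdiff.1 (argmin_subset _ _ hnew)).2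
    have hd : ∀ ξ ∈ Set.Icc 2 (N + 1), Function.update d (N + 2) a ξ = d ξ := by
      intro ξ hξ
      simp only [Set.mem_Icc] at hξ
      exact Function.update_of_ne (by omega) _ _
    have hd' : Function.update d (N + 2) a (N + 2) = a := Function.update_self _ _ _
    have hcases : ∀ ξ ∈ Set.Icc 2 (N + 1 + 1), ξ ∈ Set.Icc 2 (N + 1) ∨ ξ = N + 2 := by
      intro ξ hξ
      simp only [Set.mem_Icc] at hξ ⊢; omega
    refine ⟨Function.update d (N + 2) a, ?_, ?_, ?_⟩
    · intro ξ hξ ξ' hξ' he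
      rcases hcases ξ hξ with h1 | rfl <;> rcases hcases ξ' hξ' with h2 | rfl
      · rw [hd ξ h1, hd ξ' h2] at he; exact hinj h1 h2 he
      · rw [hd ξ h1, hd'] at he
        exact absurd ((hmem a).2 ⟨ξ, h1, he⟩) haW
      · rw [hd ξ' h2, hd'] at he
        exact absurd ((hmem a).2 ⟨ξ', h2, he.symm⟩) haW
      · rfl
    · intro w
      rw [Finset.mem_insert, hmem]
      constructor
      · rintro (rfl | ⟨ξ, hξ, rfl⟩)
        · exact ⟨N + 2, by simp, hd'⟩
        · refine ⟨ξ, ?_, hd ξ hξ⟩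
          simp only [Set.mem_Icc] at hξ ⊢; omega
      · rintro ⟨ξ, hξ, rfl⟩
        rcases hcases ξ hξ with h1 | rfl
        · exact Or.inr ⟨ξ, h1, (hd ξ h1).symm⟩
        · exact Or.inl hd'
    · intro ξ hξ c hc
      have hc' : c ∈ S \ W := by
        simp only [Finset.mem_sdiff, Finset.mem_insert] at hc ⊢; tauto
      rcases hcases ξ hξ with h1 | rfl
      · rw [hd ξ h1]; exact hle ξ h1 c hc'
      · rw [hd']
        exact (Finset.mem_filter.1 hnew).2 c hc'

/-- The offset in its segment of the marked point number `ξ` for `κ` seats. -/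
def markedPoint (κ ξ : ℕ) : ℝ := (2 * (ξ : ℝ) - 1) / (2 * ((κ : ℝ) + 2))

variable {M : UniformRIV} {C : Finset ℝ} {k t : ℕ}

theorem guessIn_eq_greedy : guessIn M C k tie t = greedy (candidatesIn C t) tie
    (fun ξ c => |c - t - markedPoint (seats M k t) ξ|) (seats M k t) := by
  -- In `guessIn` the index list is cast to a list of reals, and the cast is a monadic bind. As a
  -- map it can be moved into the fold, which then runs over natural numbers.
  have h : ∀ l : List ℕ, (do let a ← l; pure (a : ℝ) : List ℝ) = l.map fun a : ℕ => (a : ℝ) := by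
    intro l
    simp [List.map_eq_flatMap]
  simp only [guessIn, greedy, markedPoint, h, List.foldl_map]

theorem mem_candidatesIn {c : ℝ} : c ∈ candidatesIn C t ↔ c ∈ C ∧ (t : ℝ) ≤ c ∧ c ≤ t + 1 := by
  simp [candidatesIn]

theorem guessIn_subset (htie : ∀ s : Finset ℝ, s.Nonempty → tie s ∈ s) :
    guessIn M C k tie t ⊆ candidatesIn C t := by
  rw [guessIn_eq_greedy]; exact greedy_subset htie _ _ _

theorem card_guessIn_le : (guessIn M C k tie t).card ≤ seats M k t := by
  rw [guessIn_eq_greedy]; exact card_greedy_le _ _ _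

theorem guess_subset (htie : ∀ s : Finset ℝ, s.Nonempty → tie s ∈ s) :
    guess M C k tie ⊆ C := by
  intro c hc
  obtain ⟨t, -, hc⟩ := Finset.mem_biUnion.1 hc
  exact (mem_candidatesIn.1 (guessIn_subset htie hc)).1

theorem seats_le_mul (ht : t ∈ Finset.Icc 1 M.σ) : (seats M k t : ℝ) ≤ M.p t * k :=
  Nat.floor_le (mul_nonneg (M.p_nonneg t ht) (Nat.cast_nonneg _))

theorem UniformRIV.p_le_one (ht : t ∈ Finset.Icc 1 M.σ) : M.p t ≤ 1 := by
  rw [← M.sum_p]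
  exact Finset.single_le_sum (f := M.p) (fun s hs => M.p_nonneg s hs) ht

theorem seats_le (ht : t ∈ Finset.Icc 1 M.σ) : seats M k t ≤ k := by
  have h := seats_le_mul (k := k) ht
  have : M.p t * k ≤ 1 * k := by gcongr; exact M.p_le_one ht
  exact_mod_cast h.trans (this.trans (one_mul _).le)

/-- The seats are rounded down and the quotas `p t * k` sum to `k`. -/
theorem card_guess_le : (guess M C k tie).card ≤ k := by
  have h1 : ((guess M C k tie).card : ℝ) ≤ k := by
    calc ((guess M C k tie).card : ℝ)
        ≤ ((∑ t ∈ Finset.Icc 1 M.σ, seats M k t : ℕ) : ℝ) := by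
          exact_mod_cast Finset.card_biUnion_le.trans
            (Finset.sum_le_sum fun t _ => card_guessIn_le)
      _ = ∑ t ∈ Finset.Icc 1 M.σ, (seats M k t : ℝ) := by push_cast; rfl
      _ ≤ ∑ t ∈ Finset.Icc 1 M.σ, M.p t * k := Finset.sum_le_sum fun t ht => seats_le_mul ht
      _ = k := by rw [← Finset.sum_mul, M.sum_p, one_mul]
  exact_mod_cast h1

theorem mem_positions {x : ℝ} : x ∈ (positions M C k tie t).toFinset ↔
    x ∈ guessIn M C k tie t ∨ ∃ j, (1 ≤ j ∧ j ≤ 15 * k) ∧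
      (x = leftNbr t (candidatesIn C t) (t + (j : ℝ) / (15 * k)) ∨
        x = rightNbr t (candidatesIn C t) (t + (j : ℝ) / (15 * k))) := by
  simp only [positions, Multiset.toFinset_add, Finset.val_toFinset, Finset.mem_union,
    Multiset.mem_toFinset, Multiset.mem_bind, Finset.mem_val, Finset.mem_Icc, Multiset.insert_eq_cons,
    Multiset.mem_cons, Multiset.mem_singleton]

theorem candidate_of_mem_positions (htie : ∀ s : Finset ℝ, s.Nonempty → tie s ∈ s) {x : ℝ}
    (hx : x ∈ (positions M C k tie t).toFinset) (h : x ≠ t) (h' : x ≠ t + 1) : x ∈ C := by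
  rw [mem_positions] at hx
  rcases hx with hx | ⟨j, -, rfl | rfl⟩
  · exact (mem_candidatesIn.1 (guessIn_subset htie hx)).1
  · exact (mem_candidatesIn.1 (leftNbr_mem.resolve_left h).1).1
  · exact (mem_candidatesIn.1 (rightNbr_mem.resolve_left h').1).1

theorem card_positions :
    (positions M C k tie t).card = (guessIn M C k tie t).card + 30 * k := by
  simp [positions]
  ring

/-- Guarantees that the segment search inside the resolution finds the voter's segment again. -/
theorem exists_mem_positions (hk : 1 ≤ k) :
    ∃ c ∈ (positions M C k tie t).toFinset, (t : ℝ) ≤ c ∧ c ≤ t + 1 := by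
  have hk' : (1 : ℝ) ≤ k := by exact_mod_cast hk
  have h1 : ((1 : ℕ) : ℝ) / (15 * k) ≤ 1 := by
    rw [div_le_one (by positivity)]; push_cast; linarith
  have h0 : (0 : ℝ) ≤ ((1 : ℕ) : ℝ) / (15 * k) := by positivity
  exact ⟨_, mem_positions.2 (Or.inr ⟨1, by omega, Or.inl rfl⟩), start_le_leftNbr,
    (leftNbr_le (by linarith)).trans (by linarith)⟩

theorem size_le_card (multi : Bool) (P : Multiset ℝ) : size multi P ≤ P.card := by
  unfold size
  split_ifs
  · exact le_rfl
  · exact Multiset.toFinset_card_le P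

theorem card_positions_le (ht : t ∈ Finset.Icc 1 M.σ) :
    (positions M C k tie t).card ≤ 31 * k := by
  have h1 := card_guessIn_le (M := M) (C := C) (k := k) (tie := tie) (t := t)
  have h2 := seats_le (M := M) (k := k) ht
  rw [card_positions]
  omega

/-! ### Resolution including the segment search -/

section

variable {ι : Type} {v : ι} {ans : ι → Query → Bool} {u : ℝ × ℝ}

theorem run_resolve (hans : ∀ q, ans v q = answer C u q) {σ : ℕ} (hu : InSegment u t)
    (ht : t ∈ Finset.Icc 1 σ) (multi : Bool) (P : Multiset ℝ) :
    ((resolve σ C multi v P).run ans).1 =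
        (if ∃ c ∈ P.toFinset, (t : ℝ) ≤ c ∧ c ≤ t + 1 then
          (((resolveIn C P.toFinset v t (schedule (Nat.clog 2 (size multi P)))).run ans).1,
            some ((resolveIn C P.toFinset v t (schedule (Nat.clog 2 (size multi P)))).run ans).2)
        else (∅, none)) ∧
      ((resolve σ C multi v P).run ans).2.length ≤ Nat.clog 2 σ + 1 +
        ((resolveIn C P.toFinset v t (schedule (Nat.clog 2 (size multi P)))).run ans).2.length := by
  obtain ⟨h1, h2⟩ := run_segmentSearch (C := C) hans hu
    ((List.range' 1 σ).filter fun t : ℕ => decide (∃ c ∈ P.toFinset, (t : ℝ) ≤ c ∧ c ≤ t + 1))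
    ((List.pairwise_lt_range' 1).filter _)
  have hlen : ((List.range' 1 σ).filter fun t : ℕ =>
      decide (∃ c ∈ P.toFinset, (t : ℝ) ≤ c ∧ c ≤ t + 1)).length ≤ σ := by
    refine (List.length_filter_le _ _).trans ?_
    simp
  have h3 := h2.trans (Nat.add_le_add_right (Nat.clog_mono_right 2 hlen) 1)
  have hmem : (t ∈ (List.range' 1 σ).filter fun t : ℕ =>
      decide (∃ c ∈ P.toFinset, (t : ℝ) ≤ c ∧ c ≤ t + 1)) ↔
      ∃ c ∈ P.toFinset, (t : ℝ) ≤ c ∧ c ≤ t + 1 := by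
    rw [Finset.mem_Icc] at ht
    rw [List.mem_filter, List.mem_range'_1, decide_eq_true_iff]
    constructor
    · exact fun h => h.2
    · exact fun h => ⟨by omega, h⟩
  simp only [hmem] at h1
  rw [resolve, run_bind, h1]
  split_ifs with h
  · simp only [run_bind, run_listen, run, List.append_nil, List.length_append]
    exact ⟨trivial, by omega⟩
  · simp only [run, List.append_nil]
    exact ⟨trivial, by omega⟩

/-- The second step of the algorithm for one voter. -/
def elicitPositions (M : UniformRIV) (C : Finset ℝ) (k : ℕ) (tie : Finset ℝ → ℝ) (multi : Bool)
    (v : ι) : Elicit ι (Dialogue ι) :=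
  bind (segmentSearch v (List.range' 1 M.σ)) fun o => match o with
    | none => done []
    | some t => bind (resolve M.σ C multi v (positions M C k tie t)) fun z => done (z.2.getD [])

theorem run_elicitPositions (hans : ∀ q, ans v q = answer C u q) (hu : InSegment u t)
    (ht : t ∈ Finset.Icc 1 M.σ) (hk : 1 ≤ k) (multi : Bool) :
    ((elicitPositions M C k tie multi v).run ans).1 =
        ((resolveIn C (positions M C k tie t).toFinset v t
          (schedule (Nat.clog 2 (size multi (positions M C k tie t))))).run ans).2 ∧
      ((elicitPositions M C k tie multi v).run ans).2.length ≤ 2 * (Nat.clog 2 M.σ + 1) +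
        ((resolveIn C (positions M C k tie t).toFinset v t
          (schedule (Nat.clog 2 (size multi (positions M C k tie t))))).run ans).2.length := by
  obtain ⟨h1, h2⟩ := run_segmentSearch (C := C) hans hu (List.range' 1 M.σ)
    (List.pairwise_lt_range' 1)
  obtain ⟨h3, h4⟩ := run_resolve (C := C) hans hu ht multi (positions M C k tie t)
  rw [if_pos (exists_mem_positions hk)] at h3
  have hmem : t ∈ List.range' 1 M.σ := by
    rw [Finset.mem_Icc] at ht
    rw [List.mem_range'_1]; omega
  rw [if_pos hmem] at h1
  rw [List.length_range'] at h2
  rw [elicitPositions, run_bind, h1]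
  simp only [run_bind, h3, run, Option.getD_some, List.append_nil, List.length_append]
  exact ⟨trivial, by omega⟩

theorem asksOnly_elicitPositions (multi : Bool) :
    AsksOnly C v (elicitPositions M C k tie multi v) := by
  refine (asksOnly_segmentSearch _).bind fun o => ?_
  cases o with
  | none => trivial
  | some t => exact (asksOnly_resolve _ _ _).bind fun _ => trivial

end

/-! ### Completion to `k` members -/

section Completion

variable {C : Finset ℝ} {k : ℕ} {tie : Finset ℝ → ℝ}

theorem subset_complete (W : Finset ℝ) : W ⊆ complete C k tie W := by
  unfold complete
  induction k - W.card generalizing W with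
  | zero => simp
  | succ N ih =>
    rw [Function.iterate_succ_apply]
    exact (Finset.subset_insert _ _).trans (ih _)

theorem complete_subset_and_card (htie : ∀ s : Finset ℝ, s.Nonempty → tie s ∈ s)
    (hk : k ≤ C.card) {W : Finset ℝ} (hW : W ⊆ C) (hWk : W.card ≤ k) :
    complete C k tie W ⊆ C ∧ (complete C k tie W).card = k := by
  unfold complete
  obtain ⟨N, hN⟩ : ∃ N, N = k - W.card := ⟨_, rfl⟩
  rw [← hN]
  induction N generalizing W with
  | zero => exact ⟨hW, by simp; omega⟩
  | succ N ih =>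
    rw [Function.iterate_succ_apply]
    have hne : (C \ W).Nonempty := by
      rw [Finset.sdiff_nonempty]
      intro h
      have := Finset.card_le_card h
      omega
    have h := Finset.mem_sdiff.1 (htie _ hne)
    have hcard := Finset.card_insert_of_notMem h.2
    exact ih (Finset.insert_subset h.1 hW) (by omega) (by omega)

end Completion

/-! ### The Method of Equal Shares satisfies PJR+ -/

section EqualShares

variable {n : ℕ} {C : Finset ℝ} {k : ℕ} {tie : Finset ℝ → ℝ} {A : Fin n → Finset ℝ}

/-- The amount collected is continuous in `r` and vanishes at `0`. The infimum is attained by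
closedness, and by the intermediate value theorem an amount above `1` would be undercut by a smaller
`r`. -/
theorem mesPrice_spec {b : Fin n → ℝ} (hb : ∀ v, 0 ≤ b v) {c : ℝ}
    (hc : 1 ≤ ∑ v ∈ Finset.univ.filter (fun v => c ∈ A v), b v) :
    0 ≤ mesPrice A b c ∧
      ∑ v ∈ Finset.univ.filter (fun v => c ∈ A v), min (b v) (mesPrice A b c) = 1 := by
  set F : ℝ → ℝ := fun r => ∑ v ∈ Finset.univ.filter (fun v => c ∈ A v), min (b v) r with hF
  have hcont : Continuous F := by fun_prop
  have hF0 : F 0 = 0 := Finset.sum_eq_zero fun v _ => min_eq_right (hb v)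
  have hclosed : IsClosed {r : ℝ | 0 ≤ r ∧ 1 ≤ F r} :=
    (isClosed_le continuous_const continuous_id).inter (isClosed_le continuous_const hcont)
  have hne : {r : ℝ | 0 ≤ r ∧ 1 ≤ F r}.Nonempty := by
    refine ⟨∑ v, b v, Finset.sum_nonneg fun v _ => hb v, hc.trans (Finset.sum_le_sum fun v _ => ?_)⟩
    exact le_min le_rfl (Finset.single_le_sum (fun w _ => hb w) (Finset.mem_univ v))
  have hbdd : BddBelow {r : ℝ | 0 ≤ r ∧ 1 ≤ F r} := ⟨0, fun r hr => hr.1⟩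
  have hmem := hclosed.csInf_mem hne hbdd
  change 0 ≤ mesPrice A b c ∧ 1 ≤ F (mesPrice A b c) at hmem
  refine ⟨hmem.1, le_antisymm ?_ hmem.2⟩
  change F (mesPrice A b c) ≤ 1
  by_contra! hlt
  obtain ⟨r, hr, hr1⟩ := intermediate_value_Icc hmem.1 hcont.continuousOn
    (show (1 : ℝ) ∈ Set.Icc (F 0) (F (mesPrice A b c)) from ⟨by rw [hF0]; norm_num, hlt.le⟩)
  have h1 : mesPrice A b c ≤ r := csInf_le hbdd ⟨hr.1, hr1.ge⟩
  have : r = mesPrice A b c := le_antisymm hr.2 h1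
  rw [this] at hr1
  linarith

/-- The committee bought by the Method of Equal Shares: the total budget bounds its size, and no
group can afford a candidate that is left out. -/
theorem mesLoop_spec (htie : ∀ s : Finset ℝ, s.Nonempty → tie s ∈ s) (N : ℕ) (W : Finset ℝ)
    (b : Fin n → ℝ) (hW : W ⊆ C) (hb : ∀ v, 0 ≤ b v) (hN : C.card ≤ W.card + N) :
    mesLoop C tie A N W b ⊆ C ∧ W ⊆ mesLoop C tie A N W b ∧
      ((mesLoop C tie A N W b).card : ℝ) ≤ W.card + ∑ v, b v ∧
      ∀ c ∈ C \ mesLoop C tie A N W b, ∀ G : Finset (Fin n), (∀ v ∈ G, c ∈ A v) →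
        ∑ v ∈ G, b v <
          1 + (((mesLoop C tie A N W b ∩ G.biUnion A).card : ℝ) - (W ∩ G.biUnion A).card) := by
  induction N generalizing W b with
  | zero =>
    -- The purchase limit is reached only when every candidate has been bought.
    have hCW : W = C := Finset.eq_of_subset_of_card_le hW (by simpa using hN)
    refine ⟨hW, subset_rfl, ?_, ?_⟩
    · have := Finset.sum_nonneg fun v (_ : v ∈ Finset.univ) => hb v
      simp only [mesLoop]; linarith
    · intro c hc
      simp [mesLoop, hCW] at hc
  | succ N ih =>
    rw [mesLoop]
    split_ifs with h
    · set c₀ := tie (argmin (affordable C A W b) (mesPrice A b)) with hc₀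
      have hmem : c₀ ∈ affordable C A W b := argmin_subset _ _ (htie _ (argmin_nonempty h _))
      simp only [affordable, Finset.mem_filter, Finset.mem_sdiff] at hmem
      obtain ⟨⟨hC, hnW⟩, haff⟩ := hmem
      obtain ⟨hr0, hsum⟩ := mesPrice_spec hb haff
      set r := mesPrice A b c₀ with hr
      set b' : Fin n → ℝ := fun v => if c₀ ∈ A v then b v - min (b v) r else b v with hb'
      have hb'0 : ∀ v, 0 ≤ b' v := by
        intro v
        simp only [hb']
        split_ifs
        · linarith [min_le_left (b v) r]
        · exact hb v
      have hcard := Finset.card_insert_of_notMem hnW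
      obtain ⟨h1, h2, h3, h4⟩ := ih (insert c₀ W) b' (Finset.insert_subset hC hW) hb'0
        (by omega)
      set W' := mesLoop C tie A N (insert c₀ W) b' with hW'
      have hb'eq : ∀ v, b' v = b v - if c₀ ∈ A v then min (b v) r else 0 := by
        intro v; simp only [hb']; split_ifs <;> ring
      have hsum' : ∑ v, b' v = ∑ v, b v - 1 := by
        simp only [hb'eq, Finset.sum_sub_distrib]
        rw [← Finset.sum_filter, hsum]
      refine ⟨h1, (Finset.subset_insert _ _).trans h2, ?_, ?_⟩
      · rw [hcard] at h3
        push_cast at h3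
        rw [hsum'] at h3
        linarith
      · intro c hc G hG
        have h5 := h4 c hc G hG
        have h6 : ∑ v ∈ G, b v = ∑ v ∈ G, b' v + ∑ v ∈ G, if c₀ ∈ A v then min (b v) r else 0 := by
          rw [← Finset.sum_add_distrib]
          refine Finset.sum_congr rfl fun v _ => ?_
          rw [hb'eq]; ring
        have hpos : ∀ v, 0 ≤ min (b v) r := fun v => le_min (hb v) hr0
        by_cases hc₀G : c₀ ∈ G.biUnion A
        · have h7 : (insert c₀ W ∩ G.biUnion A).card = (W ∩ G.biUnion A).card + 1 := by
            rw [Finset.insert_inter_of_mem hc₀G, Finset.card_insert_of_notMem]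
            simp [hnW]
          -- All supporters together pay exactly `1`, so the members of `G` pay at most `1`. The
          -- purchase is matched by one more member of the committee in the union of the ballots of
          -- `G`.
          have h8 : ∑ v ∈ G, (if c₀ ∈ A v then min (b v) r else 0) ≤ 1 := by
            rw [← hsum, ← Finset.sum_filter]
            exact Finset.sum_le_sum_of_subset_of_nonneg
              (Finset.filter_subset_filter _ (Finset.subset_univ _)) fun v _ _ => hpos v
          rw [h7] at h5
          push_cast at h5
          linarith
        · have h7 : (insert c₀ W ∩ G.biUnion A) = W ∩ G.biUnion A :=
            Finset.insert_inter_of_notMem hc₀G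
          have h8 : ∑ v ∈ G, (if c₀ ∈ A v then min (b v) r else 0) = 0 := by
            refine Finset.sum_eq_zero fun v hv => if_neg fun hcv => hc₀G ?_
            exact Finset.mem_biUnion.2 ⟨v, hv, hcv⟩
          rw [h7] at h5
          linarith
    · refine ⟨hW, subset_rfl, ?_, ?_⟩
      · have := Finset.sum_nonneg fun v (_ : v ∈ Finset.univ) => hb v
        linarith
      · intro c hc G hG
        rw [Finset.not_nonempty_iff_eq_empty] at h
        have hna : c ∉ affordable C A W b := by rw [h]; simp
        simp only [affordable, Finset.mem_filter, not_and, not_le] at hna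
        have h1 := hna hc
        have h2 : ∑ v ∈ G, b v ≤ ∑ v ∈ Finset.univ.filter (fun v => c ∈ A v), b v :=
          Finset.sum_le_sum_of_subset_of_nonneg (fun v hv => by simp [hG v hv]) fun v _ _ => hb v
        linarith

/-- A group of at least `n ℓ / k` voters starts with at least `ℓ` units of money, so `mesLoop_spec`
gives `ℓ < 1 + |W ∩ ⋃ A|`. Completion only helps: it can only increase representation, and a
candidate left out afterwards was left out before. -/
theorem pjrPlus_mes (htie : ∀ s : Finset ℝ, s.Nonempty → tie s ∈ s) (hk : k ≤ C.card)
    (hk1 : 1 ≤ k) (hn : 1 ≤ n) : PJRPlus C k A (mes C k tie A) := by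
  have hn' : (0 : ℝ) < n := by exact_mod_cast hn
  have hk' : (0 : ℝ) < k := by exact_mod_cast hk1
  obtain ⟨h1, -, h3, h4⟩ := mesLoop_spec (C := C) (A := A) htie C.card ∅ (fun _ => (k : ℝ) / n)
    (by simp) (fun _ => by positivity) (by simp)
  set W := mesLoop C tie A C.card ∅ fun _ => (k : ℝ) / n with hW
  have hWk : W.card ≤ k := by
    have : ((0 : ℕ) : ℝ) + ∑ v : Fin n, (k : ℝ) / n = k := by
      simp; field_simp
    rw [Finset.card_empty, this] at h3
    exact_mod_cast h3
  obtain ⟨h5, h6⟩ := complete_subset_and_card htie hk h1 hWk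
  have hsub : W ⊆ complete C k tie W := subset_complete W
  refine ⟨h5, h6, ?_⟩
  rintro ℓ - G hG ⟨c, hc, hcG⟩
  have hc' : c ∈ C \ W := by
    rw [Finset.mem_sdiff] at hc ⊢
    exact ⟨hc.1, fun h => hc.2 (hsub h)⟩
  have h7 := h4 c hc' G hcG
  rw [Finset.sum_const, nsmul_eq_mul, Finset.empty_inter, Finset.card_empty] at h7
  have h8 : (ℓ : ℝ) ≤ G.card * (k / n) := by
    rw [Fintype.card_fin] at hG
    have := mul_le_mul_of_nonneg_right hG (show 0 ≤ (k : ℝ) / n by positivity)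
    calc (ℓ : ℝ) = n * ℓ / k * (k / n) := by field_simp
      _ ≤ _ := this
  have h9 : (ℓ : ℝ) < 1 + (W ∩ G.biUnion A).card := by
    push_cast at h7; linarith
  have h10 : ℓ ≤ (W ∩ G.biUnion A).card := by
    have : ℓ < 1 + (W ∩ G.biUnion A).card := by exact_mod_cast h9
    omega
  exact h10.trans (Finset.card_le_card (Finset.inter_subset_inter_right hsub))

end EqualShares

/-! ### Dialogues and the possibility test -/

section Dialogues

variable {ι : Type} {C : Finset ℝ} {v : ι} {u : ℝ × ℝ} {t : ℕ} {D : Dialogue ι}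

/-- A dialogue with voter `v` about positions in `C`, answered according to the approval interval
`[u.1, u.2]`. -/
def Sincere (C : Finset ℝ) (v : ι) (u : ℝ × ℝ) (D : Dialogue ι) : Prop :=
  ∀ e ∈ D, e.1 = v ∧ (∀ y, e.2.1 = .point y → y ∈ C) ∧ e.2.2 = answer C u e.2.1

theorem Elicit.AsksOnly.sincere {α : Type} {e : Elicit ι α} (he : AsksOnly C v e)
    {ans : ι → Query → Bool} (hans : ∀ q, ans v q = answer C u q) :
    Sincere C v u (e.run ans).2 := by
  intro x hx
  obtain ⟨h1, h2⟩ := he.of_mem ans hx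
  refine ⟨h1, h2, ?_⟩
  rw [truthful e ans hx, h1, hans]

theorem Sincere.mem_pointAnswers (hD : Sincere C v u D) {r : Bool} {x : ℝ} :
    x ∈ pointAnswers r D ↔ (v, Query.point x, r) ∈ D := by
  simp only [pointAnswers, List.mem_toFinset, List.mem_filterMap]
  constructor
  · rintro ⟨⟨w, q, r'⟩, he, h⟩
    have hw := (hD _ he).1
    simp only at hw
    subst hw
    cases q with
    | point y =>
      simp only at h
      split_ifs at h with hr
      simp only [Option.some.injEq] at h
      rwa [hr, h] at he
    | interval y z => simp at h
  · intro h
    exact ⟨_, h, by simp⟩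

theorem Sincere.mem_pointAnswers_true (hD : Sincere C v u D) {x : ℝ}
    (hx : x ∈ pointAnswers true D) : x ∈ C ∧ u.1 ≤ x ∧ x ≤ u.2 :=
  answer_point.1 (hD _ (hD.mem_pointAnswers.1 hx)).2.2.symm

theorem Sincere.mem_pointAnswers_false (hD : Sincere C v u D) {x : ℝ}
    (hx : x ∈ pointAnswers false D) : x ∈ C ∧ (x < u.1 ∨ u.2 < x) := by
  have h := hD _ (hD.mem_pointAnswers.1 hx)
  have hC := h.2.1 x rfl
  refine ⟨hC, ?_⟩
  by_contra! hcon
  have h3 := h.2.2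
  simp only at h3
  rw [answer_point.2 ⟨hC, hcon⟩] at h3
  exact absurd h3 (by simp)

theorem InSegment.segmentOf_eq (hu : InSegment u t) {x : ℝ} (h1 : u.1 ≤ x) (h2 : x ≤ u.2) :
    segmentOf x = t := by
  have h3 := hu.left
  have h4 := hu.right
  have h0 : (0 : ℝ) ≤ t := Nat.cast_nonneg t
  exact (Nat.floor_eq_iff (by linarith)).2 ⟨by linarith, by linarith⟩

/-- Completeness of the possibility test: the true ends `u.1` and `u.2` of the interval are common
points of the respective pairs of intervals, as disapproved positions and members of `S` lie outside
`[u.1, u.2]`. -/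
theorem Sincere.poss (hD : Sincere C v u D) (hu : InSegment u t) {c : ℝ} {S : Finset ℝ}
    (hS : S ⊆ C) (hc : c ∈ ballot C u) (hcS : ∀ s ∈ S, s ∉ ballot C u)
    (hne : (pointAnswers true D).Nonempty) : Poss D c S := by
  simp only [ballot, Finset.mem_filter] at hc
  refine ⟨fun h => hcS c h (by simpa [ballot] using hc), hne, ?_⟩
  have h2 := hD.mem_pointAnswers_true (Finset.min'_mem _ hne)
  have h3 := hD.mem_pointAnswers_true (Finset.max'_mem _ hne)
  set φ₂ := (pointAnswers true D).min' hne
  set φ₃ := (pointAnswers true D).max' hne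
  have hSout : ∀ s ∈ S, s < u.1 ∨ u.2 < s := by
    intro s hs
    have := hcS s hs
    simp only [ballot, Finset.mem_filter, not_and, not_le] at this
    rcases lt_or_ge s u.1 with h | h
    · exact Or.inl h
    · exact Or.inr (this (hS hs) h)
  have hDout : ∀ s ∈ pointAnswers false D, s < u.1 ∨ u.2 < s := fun s hs =>
    (hD.mem_pointAnswers_false hs).2
  have key : ∀ (T : Finset ℝ) (x : ℝ), (∀ s ∈ T, s < u.1 ∨ u.2 < s) → u.1 ≤ x → x ≤ u.2 →
      leftNbr (segmentOf x) T x < u.1 ∧ u.2 < rightNbr (segmentOf x) T x := by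
    intro T x hT hx1 hx2
    rw [hu.segmentOf_eq hx1 hx2]
    constructor
    · rcases leftNbr_mem (t := t) (T := T) (x := x) with h | h
      · rw [h]; exact hu.left
      · rcases hT _ h.1 with h' | h'
        · exact h'
        · linarith
    · rcases rightNbr_mem (t := t) (T := T) (x := x) with h | h
      · rw [h]; exact hu.right
      · rcases hT _ h.1 with h' | h'
        · linarith
        · exact h'
  obtain ⟨hcl, hcr⟩ := key S c hSout hc.2.1 hc.2.2
  exact ⟨⟨u.1, ⟨(key _ _ hDout h2.2.1 h2.2.2).1, h2.2.1⟩, hcl, hc.2.1⟩,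
    ⟨u.2, ⟨h3.2.2, (key _ _ hDout h3.2.1 h3.2.2).2⟩, hc.2.2, hcr⟩⟩

theorem queryCount_flatMap [DecidableEq ι] {l : List ι} (hl : l.Nodup) {g : ι → Dialogue ι}
    (hg : ∀ w, ∀ e ∈ g w, e.1 = w) (v : ι) :
    queryCount (l.flatMap g) v = if v ∈ l then (g v).length else 0 := by
  unfold queryCount
  induction l with
  | nil => simp
  | cons w l ih =>
    rw [List.nodup_cons] at hl
    rw [List.flatMap_cons, List.countP_append, ih hl.2]
    by_cases h : v = w
    · subst h
      have : (g v).countP (fun e => decide (e.1 = v)) = (g v).length :=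
        List.countP_eq_length.2 fun e he => by simp [hg v e he]
      rw [this]
      simp [hl.1]
    · have : (g w).countP (fun e => decide (e.1 = v)) = 0 :=
        List.countP_eq_zero.2 fun e he => by simp [hg w e he, Ne.symm h]
      rw [this]
      simp [h]

end Dialogues

/-! ### The run of the algorithm and PJR+ of its output -/

section Algorithm

variable {M : UniformRIV} {C : Finset ℝ} {k n : ℕ} {tie : Finset ℝ → ℝ} {multi : Bool}

/-- The dialogues of the second step of the algorithm. -/
def dialogues (M : UniformRIV) (C : Finset ℝ) (k : ℕ) {n : ℕ} (tie : Finset ℝ → ℝ) (multi : Bool)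
    (ω : Fin n → ℝ × ℝ) (v : Fin n) : Dialogue (Fin n) :=
  ((elicitPositions M C k tie multi v).run fun v => answer C (ω v)).1

open scoped Classical in
theorem run_findCommittee (ω : Fin n → ℝ × ℝ) :
    (findCommittee M C k n tie multi).run (fun v => answer C (ω v)) =
      if Validated C k (guess M C k tie) (dialogues M C k tie multi ω) then
        (complete C k tie (guess M C k tie), (List.finRange n).flatMap fun v =>
          ((elicitPositions M C k tie multi v).run fun v => answer C (ω v)).2)
      else
        (mes C k tie fun v => ((resolve M.σ C multi v C.val).run fun v => answer C (ω v)).1.1,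
          ((List.finRange n).flatMap fun v =>
            ((elicitPositions M C k tie multi v).run fun v => answer C (ω v)).2) ++
          (List.finRange n).flatMap fun v =>
            ((resolve M.σ C multi v C.val).run fun v => answer C (ω v)).2) := by
  have h : findCommittee M C k n tie multi =
      bind (forEach ([] : Dialogue (Fin n)) (elicitPositions M C k tie multi) (List.finRange n))
        fun I => if Validated C k (guess M C k tie) I then done (complete C k tie (guess M C k tie))
        else bind (forEach (∅ : Finset ℝ) (fun v =>
            bind (resolve M.σ C multi v C.val) fun z => done z.1) (List.finRange n)) fun A =>
          done (mes C k tie A) := rfl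
  rw [h, run_bind, run_forEach]
  simp only [List.mem_finRange, if_true]
  by_cases hV : Validated C k (guess M C k tie) (dialogues M C k tie multi ω)
  · have hV' : Validated C k (guess M C k tie) fun v =>
      ((elicitPositions M C k tie multi v).run fun v => answer C (ω v)).1 := hV
    rw [if_pos hV, if_pos hV']
    simp only [run, List.append_nil]
  · have hV' : ¬ Validated C k (guess M C k tie) fun v =>
      ((elicitPositions M C k tie multi v).run fun v => answer C (ω v)).1 := hV
    rw [if_neg hV, if_neg hV', run_bind, run_forEach]
    simp only [run, run_bind, List.append_nil, List.mem_finRange, if_true]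

open scoped Classical in
theorem queries_eq (ω : Fin n → ℝ × ℝ) (v : Fin n) :
    queries M C k n tie multi v ω =
      ((elicitPositions M C k tie multi v).run fun v => answer C (ω v)).2.length +
      if Validated C k (guess M C k tie) (dialogues M C k tie multi ω) then 0
      else ((resolve M.σ C multi v C.val).run fun v => answer C (ω v)).2.length := by
  have h1 : ∀ w : Fin n, ∀ e ∈ ((elicitPositions M C k tie multi w).run
      fun v => answer C (ω v)).2, e.1 = w := fun w e he =>
    (asksOnly_elicitPositions (C := C) multi).eq_of_mem _ he
  have h2 : ∀ w : Fin n, ∀ e ∈ ((resolve M.σ C multi w C.val).run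
      fun v => answer C (ω v)).2, e.1 = w := fun w e he =>
    (asksOnly_resolve (C := C) M.σ multi C.val).eq_of_mem _ he
  have h3 := queryCount_flatMap (List.nodup_finRange n) h1 v
  have h4 := queryCount_flatMap (List.nodup_finRange n) h2 v
  rw [if_pos (List.mem_finRange v)] at h3 h4
  rw [queries, run_findCommittee]
  split_ifs with hV
  · exact h3
  · simp only
    rw [← h3, ← h4, queryCount, queryCount, queryCount, List.countP_append]

/-- The members of `W` on both sides of `c` in a set `B` without gaps form a slice. -/
theorem subset_slice {W B : Finset ℝ} {c : ℝ} {ℓ : ℕ} (hcW : c ∉ W) (hB : B ⊆ W)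
    (hgap : ∀ w ∈ B, ∀ w' ∈ W, (w ≤ w' ∧ w' ≤ c) ∨ (c ≤ w' ∧ w' ≤ w) → w' ∈ B)
    (hcard : B.card < ℓ) :
    B ⊆ slice W (((W.filter (· < c)).card : ℤ) - (B.filter (· < c)).card)
      (((W.filter (· < c)).card : ℤ) + ℓ - 1 - (B.filter (· < c)).card) := by
  intro w hw
  have hsplit := Finset.card_filter_add_card_filter_not (s := B) (· < c)
  rw [slice, Finset.mem_filter]
  refine ⟨hB hw, ?_⟩
  have hwc : w ≠ c := fun h => hcW (h ▸ hB hw)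
  rcases lt_or_gt_of_ne hwc with h | h
  -- The members of `W` from `w` up to `c` all belong to `B`, so the index of `w` is at least `ρ -
  -- j`.
  · have h1 : W.filter (· < c) ⊆ W.filter (· < w) ∪ B.filter (· < c) := by
      intro x hx
      simp only [Finset.mem_union, Finset.mem_filter] at hx ⊢
      rcases lt_or_ge x w with h' | h'
      · exact Or.inl ⟨hx.1, h'⟩
      · exact Or.inr ⟨hgap w hw x hx.1 (Or.inl ⟨h', hx.2.le⟩), hx.2⟩
    have h2 := (Finset.card_le_card h1).trans (Finset.card_union_le _ _)
    have h3 : W.filter (· < w) ⊂ W.filter (· < c) := by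
      refine Finset.ssubset_iff_subset_ne.2 ⟨fun x hx => ?_, fun he => ?_⟩
      · simp only [Finset.mem_filter] at hx ⊢; exact ⟨hx.1, hx.2.trans h⟩
      · have : w ∈ W.filter (· < w) := by rw [he]; simp [hB hw, h]
        simp at this
    have h4 := Finset.card_lt_card h3
    constructor <;> omega
  -- The members of `W` from `c` up to `w`, with `w` included, belong to `B`. So the index of `w` is
  -- at most `ρ + (|B| - j) - 1`, and `|B| ≤ ℓ - 1`.
  · have h1 : insert w (W.filter (· < w)) ⊆
        W.filter (· < c) ∪ B.filter (fun x => ¬ x < c) := by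
      intro x hx
      simp only [Finset.mem_union, Finset.mem_filter, Finset.mem_insert] at hx ⊢
      rcases hx with rfl | hx
      · exact Or.inr ⟨hw, not_lt.2 h.le⟩
      · rcases lt_or_ge x c with h' | h'
        · exact Or.inl ⟨hx.1, h'⟩
        · exact Or.inr ⟨hgap w hw x hx.1 (Or.inr ⟨h', hx.2.le⟩), not_lt.2 h'⟩
    have h2 := (Finset.card_le_card h1).trans (Finset.card_union_le _ _)
    rw [Finset.card_insert_of_notMem (by simp)] at h2
    have h3 : (W.filter (· < c)).card ≤ (W.filter (· < w)).card :=
      Finset.card_le_card fun x hx => by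
        simp only [Finset.mem_filter] at hx ⊢; exact ⟨hx.1, hx.2.trans h⟩
    constructor <;> omega

/-- All voters have approval intervals inside the open segments of the model. -/
def GoodProfile (M : UniformRIV) (ω : Fin n → ℝ × ℝ) : Prop :=
  ∀ v, ∃ t ∈ Finset.Icc 1 M.σ, 0 < M.p t ∧ InSegment (ω v) t

/-- The specification of the second step for a voter in segment `t`. -/
theorem dialogues_spec (htie : ∀ s : Finset ℝ, s.Nonempty → tie s ∈ s) (hk : 1 ≤ k)
    {ω : Fin n → ℝ × ℝ} {v : Fin n} {t : ℕ} (ht : t ∈ Finset.Icc 1 M.σ)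
    (hu : InSegment (ω v) t) :
    Sincere C v (ω v) (dialogues M C k tie multi ω v) ∧
      ∃ s, ResolveSpec C (positions M C k tie t).toFinset v (ω v) t
        (Nat.clog 2 (size multi (positions M C k tie t)))
        (s, dialogues M C k tie multi ω v) := by
  have hans : ∀ q, (fun v => answer C (ω v)) v q = answer C (ω v) q := fun _ => rfl
  obtain ⟨h1, -⟩ := run_elicitPositions (M := M) (k := k) (tie := tie)
    (ans := fun w => answer C (ω w)) (v := v) hans hu ht hk multi
  rw [dialogues, h1]
  refine ⟨(asksOnly_resolveIn _ _ _).sincere hans, _,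
    run_resolveIn (ans := fun w => answer C (ω w)) (v := v) hans hu ?_ _⟩
  exact fun x hx h h' => candidate_of_mem_positions htie hx h h'

/-- Soundness of the test. From a violating group a triple `(ℓ, c, j)` is constructed whose
inequality fails; `j` is the number of approved members of the guess to the left of `c`, so that the
slice `R` contains all members of the guess approved in the group. -/
theorem pjrPlus_of_validated (htie : ∀ s : Finset ℝ, s.Nonempty → tie s ∈ s) (hk1 : 1 ≤ k)
    (hk : k ≤ C.card) {ω : Fin n → ℝ × ℝ} (hω : GoodProfile M ω)
    (hV : Validated C k (guess M C k tie) (dialogues M C k tie multi ω)) :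
    PJRPlus C k (fun v => ballot C (ω v)) (complete C k tie (guess M C k tie)) := by
  classical
  obtain ⟨h1, h2⟩ := complete_subset_and_card (W := guess M C k tie) htie hk (guess_subset htie)
    card_guess_le
  refine ⟨h1, h2, ?_⟩
  rintro ℓ hℓ G hG ⟨c, hc, hcG⟩
  set W := guess M C k tie with hW
  have hsub : W ⊆ complete C k tie W := subset_complete W
  by_contra! hlt
  rw [Finset.mem_sdiff] at hc
  have hcW : c ∉ W := fun h => hc.2 (hsub h)
  set B := W ∩ G.biUnion fun v => ballot C (ω v) with hB
  have hBcard : B.card < ℓ :=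
    (Finset.card_le_card (Finset.inter_subset_inter_right hsub)).trans_lt hlt
  have hslice := subset_slice (B := B) hcW Finset.inter_subset_left (by
    intro w hw w' hw' h
    simp only [hB, Finset.mem_inter, Finset.mem_biUnion, ballot, Finset.mem_filter] at hw ⊢
    obtain ⟨-, v, hv, hwC, hw1, hw2⟩ := hw
    have hcv := hcG v hv
    simp only [ballot, Finset.mem_filter] at hcv
    refine ⟨hw', v, hv, guess_subset htie hw', ?_⟩
    rcases h with h | h <;> constructor <;> linarith [hcv.2.1, hcv.2.2]) hBcard
  set j := (B.filter (· < c)).card with hj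
  have hjℓ : j < ℓ := (Finset.card_filter_le _ _).trans_lt hBcard
  have hval := hV ℓ hℓ c (Finset.mem_sdiff.2 ⟨hc.1, hcW⟩) j (Finset.mem_range.2 hjℓ)
  rw [Fintype.card_fin] at hG
  refine absurd (hval.trans_le hG) (not_lt.2 ?_)
  rw [possibleCount, unapproving]
  rw [← Nat.cast_add, Nat.cast_le]
  -- Each voter of `G` is counted by `s` or by `u`.
  refine le_trans (Finset.card_le_card ?_) (Finset.card_union_le _ _)
  intro v hv
  simp only [Finset.mem_union, Finset.mem_filter, Finset.mem_univ, true_and]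
  by_cases happ : ApprovedSome (dialogues M C k tie multi ω v)
  · refine Or.inl ⟨happ, ?_⟩
    obtain ⟨t, ht, -, hu⟩ := hω v
    obtain ⟨hD, s, hspec⟩ := dialogues_spec (C := C) (multi := multi) htie hk1 ht hu
    obtain ⟨x, hx⟩ := hspec.exists_point c (hcG v hv) happ
    refine hD.poss hu (Finset.sdiff_subset.trans (guess_subset htie)) (hcG v hv) ?_
      ⟨x, hD.mem_pointAnswers.2 hx⟩
    intro w hw hwb
    rw [Finset.mem_sdiff] at hw
    refine hw.2 (hslice ?_)
    rw [hB, Finset.mem_inter]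
    exact ⟨hw.1, Finset.mem_biUnion.2 ⟨v, hv, hwb⟩⟩
  · exact Or.inr happ

theorem run_resolve_all {ω : Fin n → ℝ × ℝ} {v : Fin n} {t : ℕ} (ht : t ∈ Finset.Icc 1 M.σ)
    (hu : InSegment (ω v) t) :
    ((resolve M.σ C multi v C.val).run fun v => answer C (ω v)).1.1 = ballot C (ω v) := by
  have hans : ∀ q, (fun v => answer C (ω v)) v q = answer C (ω v) q := fun _ => rfl
  obtain ⟨h1, -⟩ := run_resolve (ans := fun w => answer C (ω w)) (v := v) hans hu ht multi C.val
  have h2 := (run_resolveIn (ans := fun w => answer C (ω w)) (v := v) (P := C) hans hu (fun x hx _ _ => hx)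
    (Nat.clog 2 (size multi C.val))).result
  rw [h1]
  rw [Finset.val_toFinset]
  split_ifs with h
  · rw [h2]
    ext c
    simp [ballot]
  · symm
    rw [ballot, Finset.filter_eq_empty_iff]
    rintro c hc ⟨h3, h4⟩
    exact h ⟨c, hc, by linarith [hu.left], by linarith [hu.right]⟩

theorem pjrPlus_output (htie : ∀ s : Finset ℝ, s.Nonempty → tie s ∈ s) (hk1 : 1 ≤ k)
    (hk : k ≤ C.card) (hn : 1 ≤ n) {ω : Fin n → ℝ × ℝ} (hω : GoodProfile M ω) :
    PJRPlus C k (fun v => ballot C (ω v)) (output M C k n tie multi ω) := by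
  rw [output, run_findCommittee]
  split_ifs with hV
  · exact pjrPlus_of_validated htie hk1 hk hω hV
  · have : (fun v => ((resolve M.σ C multi v C.val).run fun v => answer C (ω v)).1.1) =
        fun v => ballot C (ω v) := by
      funext v
      obtain ⟨t, ht, -, hu⟩ := hω v
      exact run_resolve_all ht hu
    rw [this]
    exact pjrPlus_mes htie hk hk1 hn

end Algorithm

/-! ### The law of one approval interval -/

section VoterLaw

instance (t : ℕ) : IsProbabilityMeasure (segmentLaw t) :=
  ⟨by simp [segmentLaw]⟩

/-- The law of two independent uniform points of segment `t`. -/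
def pairLaw (t : ℕ) : Measure (ℝ × ℝ) := (segmentLaw t).prod (segmentLaw t)

instance (t : ℕ) : IsProbabilityMeasure (pairLaw t) := by
  unfold pairLaw; infer_instance

/-- Two points in increasing order. -/
def ordered (z : ℝ × ℝ) : ℝ × ℝ := (min z.1 z.2, max z.1 z.2)

theorem measurable_ordered : Measurable ordered :=
  (measurable_fst.min measurable_snd).prodMk (measurable_fst.max measurable_snd)

variable (M : UniformRIV)

theorem voterLaw_apply (S : Set (ℝ × ℝ)) :
    voterLaw M S =
      ∑ t ∈ Finset.Icc 1 M.σ, ENNReal.ofReal (M.p t) * (pairLaw t).map ordered S := by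
  rw [voterLaw, Measure.finsetSum_apply]
  rfl

instance : IsProbabilityMeasure (voterLaw M) := by
  constructor
  rw [voterLaw_apply]
  have : ∀ t ∈ Finset.Icc 1 M.σ,
      ENNReal.ofReal (M.p t) * (pairLaw t).map ordered Set.univ = ENNReal.ofReal (M.p t) := by
    intro t _
    rw [Measure.map_apply measurable_ordered MeasurableSet.univ]
    simp
  rw [Finset.sum_congr rfl this, ← ENNReal.ofReal_sum_of_nonneg M.p_nonneg, M.sum_p]
  simp

instance (n : ℕ) : IsProbabilityMeasure (profileLaw M n) := by
  unfold profileLaw; infer_instance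

theorem ae_segmentLaw (t : ℕ) : ∀ᵐ x ∂(segmentLaw t), (t : ℝ) < x ∧ x < t + 1 := by
  rw [segmentLaw, ← Measure.restrict_congr_set (Ioo_ae_eq_Icc (μ := volume))]
  exact ae_restrict_mem measurableSet_Ioo

theorem ae_pairLaw (t : ℕ) : ∀ᵐ z ∂(pairLaw t), InSegment (ordered z) t := by
  have h1 : ∀ᵐ z ∂(pairLaw t), (t : ℝ) < z.1 ∧ z.1 < (t : ℝ) + 1 :=
    Measure.quasiMeasurePreserving_fst.ae (ae_segmentLaw t)
  have h2 : ∀ᵐ z ∂(pairLaw t), (t : ℝ) < z.2 ∧ z.2 < (t : ℝ) + 1 :=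
    Measure.quasiMeasurePreserving_snd.ae (ae_segmentLaw t)
  filter_upwards [h1, h2] with z h1 h2
  exact ⟨lt_min h1.1 h2.1, min_le_max, max_lt h1.2 h2.2⟩

theorem measurableSet_inSegment (t : ℕ) : MeasurableSet {u : ℝ × ℝ | InSegment u t} := by
  have : {u : ℝ × ℝ | InSegment u t} = {u | (t : ℝ) < u.1 ∧ u.1 ≤ u.2 ∧ u.2 < (t : ℝ) + 1} := by
    ext u
    exact ⟨fun h => ⟨h.1, h.2, h.3⟩, fun h => ⟨h.1, h.2.1, h.2.2⟩⟩
  rw [this]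
  exact (measurableSet_lt measurable_const measurable_fst).inter
    ((measurableSet_le measurable_fst measurable_snd).inter
      (measurableSet_lt measurable_snd measurable_const))

theorem ae_map_ordered (t : ℕ) : ∀ᵐ u ∂((pairLaw t).map ordered), InSegment u t := by
  rw [ae_map_iff measurable_ordered.aemeasurable (measurableSet_inSegment t)]
  exact ae_pairLaw t

theorem ae_voterLaw :
    ∀ᵐ u ∂(voterLaw M), ∃ t ∈ Finset.Icc 1 M.σ, 0 < M.p t ∧ InSegment u t := by
  rw [ae_iff, voterLaw_apply]
  refine Finset.sum_eq_zero fun t ht => ?_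
  rcases (M.p_nonneg t ht).eq_or_lt with h | h
  · rw [← h]; simp
  · rw [mul_eq_zero]
    right
    refine measure_mono_null ?_ (ae_iff.1 (ae_map_ordered t))
    intro u hu hu'
    exact hu ⟨t, ht, h, hu'⟩

theorem ae_goodProfile (n : ℕ) : ∀ᵐ ω ∂(profileLaw M n), GoodProfile M ω := by
  refine ae_all_iff.2 fun v => ?_
  exact (measurePreserving_eval (fun _ : Fin n => voterLaw M) v).quasiMeasurePreserving.ae
    (ae_voterLaw M)

theorem measurableSet_short (s : ℝ) : MeasurableSet {u : ℝ × ℝ | u.2 - u.1 < s} :=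
  measurableSet_lt (measurable_snd.sub measurable_fst) measurable_const

/-- Given one of the two points, the other must fall into the ball of radius `s` around it, which
has length `2 s`. -/
theorem pairLaw_short_le (t : ℕ) (s : ℝ) :
    (pairLaw t).map ordered {u | u.2 - u.1 < s} ≤ ENNReal.ofReal (2 * s) := by
  rw [Measure.map_apply measurable_ordered (measurableSet_short s), pairLaw,
    Measure.prod_apply (measurable_ordered (measurableSet_short s))]
  calc ∫⁻ x, segmentLaw t (Prod.mk x ⁻¹' (ordered ⁻¹' {u | u.2 - u.1 < s})) ∂(segmentLaw t)
      ≤ ∫⁻ _, ENNReal.ofReal (2 * s) ∂(segmentLaw t) := by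
        refine lintegral_mono fun x => ?_
        refine (Measure.restrict_le_self _).trans ?_
        rw [← Real.volume_ball x s]
        refine measure_mono fun y hy => ?_
        simp only [Set.mem_preimage, ordered, Set.mem_ofPred_eq, max_sub_min_eq_abs] at hy
        rw [Metric.mem_ball, Real.dist_eq]
        exact hy
    _ = ENNReal.ofReal (2 * s) := by simp

theorem voterLaw_short_le (s : ℝ) :
    voterLaw M {u | u.2 - u.1 < s} ≤ ENNReal.ofReal (2 * s) := by
  rw [voterLaw_apply]
  calc _ ≤ ∑ t ∈ Finset.Icc 1 M.σ, ENNReal.ofReal (M.p t) * ENNReal.ofReal (2 * s) :=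
        Finset.sum_le_sum fun t _ => mul_le_mul_right (pairLaw_short_le t s) _
    _ = ENNReal.ofReal (2 * s) := by
        rw [← Finset.sum_mul, ← ENNReal.ofReal_sum_of_nonneg M.p_nonneg, M.sum_p]
        simp

/-- Approval intervals inside segment `t` with left end in `(y, x]` and right end in `[x', z)`. -/
def boxEvent (t : ℕ) (y x x' z : ℝ) : Set (ℝ × ℝ) :=
  {u | InSegment u t} ∩ (Set.Ioc y x ×ˢ Set.Ico x' z)

theorem measurableSet_boxEvent (t : ℕ) (y x x' z : ℝ) : MeasurableSet (boxEvent t y x x' z) :=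
  (measurableSet_inSegment t).inter (measurableSet_Ioc.prod measurableSet_Ico)

theorem InSegment.unique {u : ℝ × ℝ} {s t : ℕ} (h : InSegment u s) (h' : InSegment u t) :
    s = t := by
  rw [← h.segmentOf_eq le_rfl h.le, ← h'.segmentOf_eq le_rfl h'.le]

/-- The factor `2` accounts for the two orders in which the points can be drawn. Only segment `t`
contributes, since an interval lies inside at most one open segment. -/
theorem voterLaw_boxEvent_le {t : ℕ} (ht : t ∈ Finset.Icc 1 M.σ) {y x x' z : ℝ} (hyx : y ≤ x) :
    voterLaw M (boxEvent t y x x' z) ≤ ENNReal.ofReal (M.p t * (2 * ((x - y) * (z - x')))) := by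
  rw [voterLaw_apply, Finset.sum_eq_single_of_mem t ht]
  · rw [ENNReal.ofReal_mul (M.p_nonneg t ht)]
    refine mul_le_mul_right ?_ _
    rw [Measure.map_apply measurable_ordered (measurableSet_boxEvent t y x x' z)]
    have hsub : ordered ⁻¹' boxEvent t y x x' z ⊆
        (Set.Ioc y x ×ˢ Set.Ico x' z) ∪ (Set.Ico x' z ×ˢ Set.Ioc y x) := by
      rintro ⟨a, b⟩ ⟨-, h1, h2⟩
      simp only [ordered] at h1 h2
      rcases le_total a b with h | h
      · rw [min_eq_left h] at h1; rw [max_eq_right h] at h2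
        exact Or.inl ⟨h1, h2⟩
      · rw [min_eq_right h] at h1; rw [max_eq_left h] at h2
        exact Or.inr ⟨h2, h1⟩
    have h1 : segmentLaw t (Set.Ioc y x) ≤ ENNReal.ofReal (x - y) := by
      rw [← Real.volume_Ioc]; exact Measure.restrict_le_self _
    have h2 : segmentLaw t (Set.Ico x' z) ≤ ENNReal.ofReal (z - x') := by
      rw [← Real.volume_Ico]; exact Measure.restrict_le_self _
    refine (measure_mono hsub).trans ((measure_union_le _ _).trans ?_)
    rw [pairLaw, Measure.prod_prod, Measure.prod_prod,
      mul_comm (segmentLaw t (Set.Ico x' z)), ← two_mul, ENNReal.ofReal_mul (by norm_num),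
      ENNReal.ofReal_mul (by linarith)]
    simp only [ENNReal.ofReal_ofNat]
    gcongr
  · intro s _ hst
    rw [mul_eq_zero]
    right
    refine measure_mono_null ?_ (ae_iff.1 (ae_map_ordered s))
    intro u hu hu'
    exact hst (hu'.unique hu.1)

end VoterLaw

/-! ### Concentration over independent voters -/

section Hoeffding

open ProbabilityTheory

theorem integrable_of_bounded {Ω : Type*} [MeasurableSpace Ω] {μ : Measure Ω}
    [IsFiniteMeasure μ] {f : Ω → ℝ} (hf : Measurable f) {B : ℝ} (h0 : ∀ u, 0 ≤ f u)
    (hB : ∀ u, f u ≤ B) : Integrable f μ :=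
  Integrable.of_bound hf.aestronglyMeasurable B
    (Filter.Eventually.of_forall fun u => by rw [Real.norm_of_nonneg (h0 u)]; exact hB u)

/-- **Hoeffding's inequality** for a sum over the voters of a profile. -/
theorem profileLaw_sum_ge_le (M : UniformRIV) (n : ℕ) {f : ℝ × ℝ → ℝ} (hf : Measurable f) {B : ℝ}
    (hB0 : 0 < B) (h0 : ∀ u, 0 ≤ f u) (hB : ∀ u, f u ≤ B) {m ε : ℝ}
    (hm : ∫ u, f u ∂(voterLaw M) ≤ m) (hε : 0 ≤ ε) (hn : 1 ≤ n) :
    profileLaw M n {ω | n * (m + ε) ≤ ∑ v, f (ω v)} ≤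
      ENNReal.ofReal (Real.exp (-(2 * n * ε ^ 2 / B ^ 2))) := by
  set I := ∫ u, f u ∂(voterLaw M) with hI
  have hX : HasSubgaussianMGF (fun u => f u - I) ((‖B - 0‖₊ / 2) ^ 2) (voterLaw M) :=
    hasSubgaussianMGF_of_mem_Icc hf.aemeasurable
      (Filter.Eventually.of_forall fun u => ⟨h0 u, hB u⟩)
  have hY : ∀ v : Fin n, HasSubgaussianMGF (fun ω : Fin n → ℝ × ℝ => f (ω v) - I)
      ((‖B - 0‖₊ / 2) ^ 2) (profileLaw M n) := by
    intro v
    have hmap : (profileLaw M n).map (fun ω => ω v) = voterLaw M :=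
      (measurePreserving_eval (fun _ : Fin n => voterLaw M) v).map_eq
    exact HasSubgaussianMGF.of_map (Y := fun ω : Fin n → ℝ × ℝ => ω v)
      (measurable_pi_apply v).aemeasurable (by rw [hmap]; exact hX)
  have hind : iIndepFun (fun v (ω : Fin n → ℝ × ℝ) => f (ω v) - I) (profileLaw M n) :=
    iIndepFun_pi (μ := fun _ : Fin n => voterLaw M) (X := fun _ u => f u - I)
      fun _ => (hf.sub_const I).aemeasurable
  have hn' : (0 : ℝ) < n := by exact_mod_cast hn
  have key := HasSubgaussianMGF.measure_sum_ge_le_of_iIndepFun hind (s := Finset.univ)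
    (fun v _ => hY v) (ε := n * ε) (by positivity)
  have hset : {ω : Fin n → ℝ × ℝ | n * (m + ε) ≤ ∑ v, f (ω v)} ⊆
      {ω | n * ε ≤ ∑ v, (f (ω v) - I)} := by
    intro ω hω
    simp only [Set.mem_ofPred_eq, Finset.sum_sub_distrib, Finset.sum_const, Finset.card_univ,
      Fintype.card_fin, nsmul_eq_mul] at hω ⊢
    have := mul_le_mul_of_nonneg_left hm hn'.le
    linarith
  refine (measure_mono hset).trans ?_
  rw [← ofReal_measureReal]
  refine ENNReal.ofReal_le_ofReal (key.trans (le_of_eq ?_))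
  congr 1
  simp only [Finset.sum_const, Finset.card_univ, Fintype.card_fin, nsmul_eq_mul, NNReal.coe_mul,
    NNReal.coe_natCast, NNReal.coe_pow, NNReal.coe_div, coe_nnnorm, sub_zero,
    Real.norm_of_nonneg hB0.le, NNReal.coe_ofNat]
  field_simp

end Hoeffding

/-! ### Marked points near an unselected candidate -/

section Counting

/-- The rank in `W` is injective and maps the slice into an integer interval. -/
theorem card_slice_le (W : Finset ℝ) (lo hi : ℤ) : (slice W lo hi).card ≤ (hi - lo).toNat := by
  rw [← Int.card_Ico]
  refine Finset.card_le_card_of_injOn (fun w => ((W.filter (· < w)).card : ℤ)) ?_ ?_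
  · intro w hw
    simp only [slice, Finset.coe_filter, Set.mem_ofPred_eq] at hw
    simpa using hw.2
  · have key : ∀ w ∈ W, ∀ w', w < w' → (W.filter (· < w)).card < (W.filter (· < w')).card := by
      intro w hw w' h
      refine Finset.card_lt_card (Finset.ssubset_iff_subset_ne.2 ⟨fun x hx => ?_, fun he => ?_⟩)
      · simp only [Finset.mem_filter] at hx ⊢; exact ⟨hx.1, hx.2.trans h⟩
      · have : w ∈ W.filter (· < w) := by rw [he]; simp [hw, h]
        simp at this
    intro w hw w' hw' he
    simp only [slice, Finset.coe_filter, Set.mem_ofPred_eq] at hw hw'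
    simp only [Nat.cast_inj] at he
    by_contra hne
    rcases lt_or_gt_of_ne hne with h | h
    · exact (key w hw.1 w' h).ne he
    · exact (key w' hw'.1 w h).ne' he

theorem mul_markedPoint (κ ξ : ℕ) : ((κ : ℝ) + 2) * markedPoint κ ξ = ξ - 1 / 2 := by
  unfold markedPoint
  have : (κ : ℝ) + 2 ≠ 0 := by positivity
  field_simp

/-- If nearest candidates `d ξ` to the marked points that lie near `c` belong to `R`, then `R` is
large. -/
theorem exists_marked_range {κ : ℕ} {t c y z : ℝ} {d : ℕ → ℝ} {R : Finset ℝ}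
    (hinj : Set.InjOn d (Set.Icc 2 (κ + 1)))
    (hle : ∀ ξ ∈ Set.Icc 2 (κ + 1), |d ξ - t - markedPoint κ ξ| ≤ |c - t - markedPoint κ ξ|)
    (hne : ∀ ξ ∈ Set.Icc 2 (κ + 1), d ξ ≠ c) (hyc : y < c) (hcz : c < z)
    (hlR : ∀ ξ ∈ Set.Icc 2 (κ + 1), y < d ξ → d ξ < c → d ξ ∈ R)
    (hrR : ∀ ξ ∈ Set.Icc 2 (κ + 1), c < d ξ → d ξ < z → d ξ ∈ R)
    (hl : (∃ ξ ∈ Set.Icc 2 (κ + 1), d ξ = y) ∨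
      (y = t ∧ ∀ ξ ∈ Set.Icc 2 (κ + 1), d ξ < c → d ξ ∈ R))
    (hr : (∃ ξ ∈ Set.Icc 2 (κ + 1), d ξ = z) ∨
      (z = t + 1 ∧ ∀ ξ ∈ Set.Icc 2 (κ + 1), c < d ξ → d ξ ∈ R)) :
    ∃ U V : ℤ, V - U ≤ R.card + 1 ∧
      ((y = t ∧ U = 1) ∨ (U : ℝ) ≤ ((κ : ℝ) + 2) * ((y - t + (c - t)) / 2) + 1 / 2) ∧
      ((z = t + 1 ∧ V = κ + 2) ∨ ((κ : ℝ) + 2) * ((c - t + (z - t)) / 2) + 1 / 2 ≤ V) := by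
  have hK : (0 : ℝ) < (κ : ℝ) + 2 := by positivity
  -- A marked point to the right of the midpoint of `y` and `c` is nearer to `c` than to anything up
  -- to `y`, so `d ξ`, which is at least as near as `c`, lies beyond `y`. By `mul_markedPoint` this
  -- applies to every `ξ` above `(κ + 2) · midpoint + 1/2`, whence the floor. If `y` is merely the
  -- segment end, nothing has to be avoided and `U = 1` works.
  obtain ⟨U, hU1, hU2, hU3⟩ : ∃ U : ℤ, 1 ≤ U ∧
      (∀ ξ ∈ Set.Icc 2 (κ + 1), U < (ξ : ℤ) → d ξ < c → d ξ ∈ R) ∧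
      ((y = t ∧ U = 1) ∨ (U : ℝ) ≤ ((κ : ℝ) + 2) * ((y - t + (c - t)) / 2) + 1 / 2) := by
    rcases hl with ⟨ξ₀, hξ₀, hy⟩ | ⟨hy, hl⟩
    · refine ⟨⌊((κ : ℝ) + 2) * ((y - t + (c - t)) / 2) + 1 / 2⌋, ?_, ?_, Or.inr (Int.floor_le _)⟩
      -- The bound `1 ≤ U` keeps the indices above `U` in the range of `d`. It holds because `y = d
      -- ξ₀` was preferred to `c`, so the marked point `ξ₀ ≥ 2` is not beyond the midpoint.
      · rw [Int.le_floor]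
        have h1 := hle ξ₀ hξ₀
        rw [hy] at h1
        have h2 : markedPoint κ ξ₀ ≤ (y - t + (c - t)) / 2 := by
          by_contra! h
          rw [abs_of_neg (by linarith), le_abs] at h1
          rcases h1 with h1 | h1 <;> linarith
        have h3 := mul_le_mul_of_nonneg_left h2 hK.le
        rw [mul_markedPoint] at h3
        have h4 : (2 : ℝ) ≤ ξ₀ := by exact_mod_cast hξ₀.1
        push_cast
        linarith
      · intro ξ hξ hUξ hdc
        refine hlR ξ hξ ?_ hdc
        rw [Int.floor_lt] at hUξ
        push_cast at hUξ
        have h2 : (y - t + (c - t)) / 2 < markedPoint κ ξ := by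
          have := mul_markedPoint κ ξ
          refine lt_of_mul_lt_mul_left ?_ hK.le
          linarith
        by_contra! h
        have h1 := hle ξ hξ
        rw [abs_of_neg (by linarith), le_abs] at h1
        rcases h1 with h1 | h1 <;> linarith
    · exact ⟨1, le_rfl, fun ξ hξ _ h => hl ξ hξ h, Or.inl ⟨hy, rfl⟩⟩
  obtain ⟨V, hV1, hV2, hV3⟩ : ∃ V : ℤ, V ≤ κ + 2 ∧
      (∀ ξ ∈ Set.Icc 2 (κ + 1), (ξ : ℤ) < V → c < d ξ → d ξ ∈ R) ∧
      ((z = t + 1 ∧ V = κ + 2) ∨ ((κ : ℝ) + 2) * ((c - t + (z - t)) / 2) + 1 / 2 ≤ V) := by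
    rcases hr with ⟨ξ₀, hξ₀, hz⟩ | ⟨hz, hr⟩
    · refine ⟨⌈((κ : ℝ) + 2) * ((c - t + (z - t)) / 2) + 1 / 2⌉, ?_, ?_, Or.inr (Int.le_ceil _)⟩
      · rw [Int.ceil_le]
        have h1 := hle ξ₀ hξ₀
        rw [hz] at h1
        have h2 : (c - t + (z - t)) / 2 ≤ markedPoint κ ξ₀ := by
          by_contra! h
          rw [abs_of_pos (by linarith), le_abs] at h1
          rcases h1 with h1 | h1 <;> linarith
        have h3 := mul_le_mul_of_nonneg_left h2 hK.le
        rw [mul_markedPoint] at h3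
        have h4 : (ξ₀ : ℝ) ≤ κ + 1 := by exact_mod_cast hξ₀.2
        push_cast
        linarith
      · intro ξ hξ hVξ hdc
        refine hrR ξ hξ hdc ?_
        rw [Int.lt_ceil] at hVξ
        push_cast at hVξ
        have h2 : markedPoint κ ξ < (c - t + (z - t)) / 2 := by
          have := mul_markedPoint κ ξ
          refine lt_of_mul_lt_mul_left ?_ hK.le
          linarith
        by_contra! h
        have h1 := hle ξ hξ
        rw [abs_of_pos (by linarith), le_abs] at h1
        rcases h1 with h1 | h1 <;> linarith
    · exact ⟨κ + 2, le_rfl, fun ξ hξ _ h => hr ξ hξ h, Or.inl ⟨hz, rfl⟩⟩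
  refine ⟨U, V, ?_, hU3, hV3⟩
  have hIcc : ∀ x ∈ Finset.Ioo U V, x.toNat ∈ Set.Icc 2 (κ + 1) := by
    intro x hx
    rw [Finset.mem_Ioo] at hx
    rw [Set.mem_Icc]
    omega
  -- Every index strictly between `U` and `V` yields a different element of `R`, on whichever side
  -- of `c` it lies; hence `V - U - 1 ≤ |R|`.
  have hcard : (Finset.Ioo U V).card ≤ R.card := by
    refine Finset.card_le_card_of_injOn (fun x => d x.toNat) ?_ ?_
    · intro x hx
      rw [Finset.mem_coe] at hx
      have hx' := hIcc x hx
      rw [Finset.mem_Ioo] at hx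
      rcases lt_or_gt_of_ne (hne _ hx') with h | h
      · exact hU2 _ hx' (by omega) h
      · exact hV2 _ hx' (by omega) h
    · intro x hx x' hx' he
      rw [Finset.mem_coe] at hx hx'
      have := hinj (hIcc x hx) (hIcc x' hx') he
      rw [Finset.mem_Ioo] at hx hx'
      omega
  rw [Int.card_Ioo] at hcard
  omega

/-- The case of a candidate next to one end of the segment. By AM-GM, `a + b / 2` may be replaced by
`s = √(2ab) < 1`. After multiplication by `s`, the hypothesis `m s² > 2/3` reduces the claim to `s²
- 3s/2 + 2/3 > 0`, which is seen by completing the square at `s = 3/4`. -/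
theorem edge_bound {a b m : ℝ} (ha : 0 < a) (hb : 0 < b) (hab : a + b ≤ 1)
    (h : 2 / 3 < 2 * m * (a * b)) : 5 / 6 ≤ (m + 1) * (a + b / 2) - 2 * m * (a * b) := by
  set s := √(2 * (a * b)) with hs
  have hab0 : 0 < a * b := mul_pos ha hb
  have hsq : s ^ 2 = 2 * (a * b) := Real.sq_sqrt (by positivity)
  have hs0 : 0 < s := Real.sqrt_pos.2 (by positivity)
  have hs1 : s < 1 := by
    have : s ^ 2 < 1 ^ 2 := by rw [hsq]; nlinarith [sq_nonneg (a - b)]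
    exact lt_of_pow_lt_pow_left₀ 2 (by norm_num) this
  have hsle : s ≤ a + b / 2 := by
    refine le_of_sq_le_sq ?_ (by positivity)
    rw [hsq]; nlinarith [sq_nonneg (a - b / 2)]
  have hm : 2 / 3 < m * s ^ 2 := by rw [hsq]; linarith
  have hm0 : 0 < m := by
    by_contra! hneg
    nlinarith [sq_nonneg s]
  have h1 : 0 < s * ((m + 1) * s - m * s ^ 2 - 5 / 6) := by
    nlinarith [mul_pos (sub_pos.2 hm) (sub_pos.2 hs1), sq_nonneg (s - 3 / 4)]
  have h2 := pos_of_mul_pos_right h1 hs0.le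
  have h3 : (m + 1) * s ≤ (m + 1) * (a + b / 2) := by gcongr
  have h4 : m * s ^ 2 = 2 * m * (a * b) := by rw [hsq]; ring
  linarith

/-- The case of neighbours on both sides. The product is largest for `a = b = w / 2`. After
multiplication by `w`, the bound `m w² > 4/3` reduces the claim to `w²/2 - w + 2/3 > 0`, a square at
`w = 1` plus `1/6`. -/
theorem middle_bound {a b m : ℝ} (ha : 0 < a) (hb : 0 < b) (hab : a + b ≤ 1)
    (h : 2 / 3 < 2 * m * (a * b)) : 1 / 3 ≤ (m + 1) * ((a + b) / 2) - 2 * m * (a * b) := by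
  have hab0 : 0 < a * b := mul_pos ha hb
  have hm0 : 0 < m := by
    by_contra! hneg
    nlinarith
  set w := a + b with hw
  have hw0 : 0 < w := by positivity
  have h1 : 4 * (a * b) ≤ w ^ 2 := by nlinarith [sq_nonneg (a - b)]
  have h2 : 2 * m * (a * b) ≤ m * w ^ 2 / 2 := by nlinarith
  have h3 : 4 / 3 < m * w ^ 2 := by linarith
  have h4 : 1 / 3 ≤ (m + 1) * (w / 2) - m * w ^ 2 / 2 := by
    have h5 : 0 < w * ((m + 1) * (w / 2) - m * w ^ 2 / 2 - 1 / 3) := by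
      rcases hab.eq_or_lt with h6 | h6
      · rw [h6]; linarith
      · nlinarith [mul_pos (sub_pos.2 h3) (sub_pos.2 h6), sq_nonneg (w - 1)]
    have := pos_of_mul_pos_right h5 hw0.le
    linarith
  linarith

/-- The number of marked points near `c` bounds the probability of the box around `c`. -/
theorem box_bound {m y c z U V N : ℝ} (hm : 1 ≤ m) (hy : 0 ≤ y) (hyc : y < c) (hcz : c < z)
    (hz : z ≤ 1) (hN : 1 ≤ N) (hUV : V - U ≤ N)
    (hU : (y = 0 ∧ U = 1) ∨ U ≤ (m + 1) * ((y + c) / 2) + 1 / 2)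
    (hV : (z = 1 ∧ V = m + 1) ∨ (m + 1) * ((c + z) / 2) + 1 / 2 ≤ V) :
    2 * m * ((c - y) * (z - c)) + 1 / 3 ≤ N := by
  -- For a product of at most `2/3` the trivial bound `1 ≤ N` suffices.
  by_cases h : 2 / 3 < 2 * m * ((c - y) * (z - c))
  swap
  · linarith
  have ha : 0 < c - y := by linarith
  have hb : 0 < z - c := by linarith
  rcases hU with ⟨rfl, rfl⟩ | hU <;> rcases hV with ⟨rfl, rfl⟩ | hV
  · have : (c - 0) * (1 - c) ≤ 1 / 4 := by nlinarith [sq_nonneg (c - 1 / 2)]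
    nlinarith
  -- At an edge the marked points give only `V - U ≥ (m + 1) (a + b / 2) - 1/2`; the `5/6` of
  -- `edge_bound` less this `1/2` is the required `1/3`.
  · have := edge_bound ha hb (by linarith) h
    nlinarith
  · have := edge_bound (m := m) hb ha (by linarith) (by rw [mul_comm (1 - c)]; exact h)
    nlinarith
  · have := middle_bound ha hb (by linarith) h
    nlinarith

end Counting

/-! ### The voters counted by the test -/

section Validation

variable {M : UniformRIV} {C : Finset ℝ} {k t : ℕ} {tie : Finset ℝ → ℝ} {multi : Bool}

theorem mem_guessIn_of_mem_guess (htie : ∀ s : Finset ℝ, s.Nonempty → tie s ∈ s) {y : ℝ}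
    (hy : y ∈ guess M C k tie) (h1 : (t : ℝ) < y) (h2 : y < t + 1) : y ∈ guessIn M C k tie t := by
  obtain ⟨s, -, hs⟩ := Finset.mem_biUnion.1 hy
  have h := mem_candidatesIn.1 (guessIn_subset htie hs)
  have h3 : (s : ℝ) < t + 1 := by linarith
  have h4 : (t : ℝ) < s + 1 := by linarith
  norm_cast at h3 h4
  have : s = t := by omega
  rwa [← this]

/-- Where the ends of the approval interval of a voter are who may approve `c` and no member of
`S`, in terms of the neighbours of `c` in `S` and in the grid of mesh `1 / (15 k)`. -/
theorem bounds_of_poss {ι : Type} {v : ι} {u : ℝ × ℝ} {D : Dialogue ι} {R : ℕ} {s : Finset ℝ}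
    (htie : ∀ s : Finset ℝ, s.Nonempty → tie s ∈ s) (hu : InSegment u t) (hD : Sincere C v u D)
    (hspec : ResolveSpec C (positions M C k tie t).toFinset v u t R (s, D)) {c : ℝ} (hc : c ∈ C)
    {S : Finset ℝ} (hS : S ⊆ guess M C k tie) (hP : Poss D c S) :
    segmentOf c = t ∧ ((t : ℝ) < c ∧ c < t + 1) ∧ c ∉ S ∧
      (leftNbr t S c < u.1 ∧ u.2 < rightNbr t S c) ∧
      (∀ j : ℕ, 1 ≤ j → j ≤ 15 * k → c ≤ t + (j : ℝ) / (15 * k) →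
        u.1 ≤ t + (j : ℝ) / (15 * k)) ∧
      (∀ j : ℕ, 1 ≤ j → j ≤ 15 * k → t + (j : ℝ) / (15 * k) ≤ c →
        t + (j : ℝ) / (15 * k) ≤ u.2) := by
  obtain ⟨hcS, hne, ⟨r, hr1, hr2⟩, ⟨r', hr1', hr2'⟩⟩ := hP
  have h2 := hD.mem_pointAnswers_true (Finset.min'_mem _ hne)
  have h3 := hD.mem_pointAnswers_true (Finset.max'_mem _ hne)
  have hmin : ∀ y, (v, Query.point y, true) ∈ D → (pointAnswers true D).min' hne ≤ y := fun y hy =>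
    Finset.min'_le _ _ (hD.mem_pointAnswers.2 hy)
  have hmax : ∀ y, (v, Query.point y, true) ∈ D → y ≤ (pointAnswers true D).max' hne := fun y hy =>
    Finset.le_max' _ _ (hD.mem_pointAnswers.2 hy)
  set φ₂ := (pointAnswers true D).min' hne
  set φ₃ := (pointAnswers true D).max' hne
  rw [hu.segmentOf_eq h2.2.1 h2.2.2] at hr1
  rw [hu.segmentOf_eq h3.2.1 h3.2.2] at hr1'
  have hu1 := hu.left
  have hu2 := hu.le
  have hu3 := hu.right
  have hseg : segmentOf c = t := by
    have a1 : (t : ℝ) < r := start_le_leftNbr.trans_lt hr1.1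
    have a2 : r < t + 1 := by linarith [hr1.2]
    have a3 : (segmentOf c : ℝ) < r := start_le_leftNbr.trans_lt hr2.1
    have a4 : c < segmentOf c + 1 := Nat.lt_floor_add_one c
    have a5 : (segmentOf c : ℝ) < t + 1 := by linarith
    have a6 : (t : ℝ) < segmentOf c + 1 := by linarith [hr2.2]
    norm_cast at a5 a6
    omega
  rw [hseg] at hr2 hr2'
  have hct : (t : ℝ) < c := start_le_leftNbr.trans_lt (hr2.1.trans_le hr2.2)
  have hct' : c < t + 1 := hr2'.1.trans_lt (hr2'.2.trans_le rightNbr_le_end)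
  have hcC : c ∈ candidatesIn C t := mem_candidatesIn.2 ⟨hc, hct.le, hct'.le⟩
  refine ⟨hseg, ⟨hct, hct'⟩, hcS, ⟨?_, ?_⟩, ?_, ?_⟩
  -- Otherwise this neighbour is a member of the guess inside the voter's interval, hence an
  -- approved position, and the least approved query `φ₂` is not to the right of it. Then `(φ₁, φ₂]`
  -- cannot meet the range from this neighbour to `c`.
  · by_contra! h
    have hm := leftNbr_mem_of_lt (hu1.trans_le h)
    have hle : leftNbr t S c ≤ c := leftNbr_le hct.le
    have hpos := mem_positions.2 (Or.inl (mem_guessIn_of_mem_guess htie (hS hm) (hu1.trans_le h)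
      (hle.trans_lt hct')))
    obtain ⟨y', hy', hy''⟩ := hspec.least _ hpos h (by linarith [hr2.1, hr1.2, h2.2.2])
    linarith [hmin y' hy', hr2.1, hr1.2]
  · by_contra! h
    have hm := rightNbr_mem_of_lt (h.trans_lt hu3)
    have hle : c ≤ rightNbr t S c := le_rightNbr hct'.le
    have hpos := mem_positions.2 (Or.inl (mem_guessIn_of_mem_guess htie (hS hm)
      (hct.trans_le hle) (h.trans_lt hu3)))
    obtain ⟨y', hy', hy''⟩ := hspec.greatest _ hpos (by linarith [hr2'.2, hr1'.1, h3.2.1]) h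
    linarith [hmax y' hy', hr2'.2, hr1'.1]
  -- If `u.1` were beyond this grid point, the left neighbour of the grid point, which is not left
  -- of `c`, would be a disapproved position. A disapproval at or after it is recorded, so `φ₁ ≥ c`,
  -- and `(φ₁, φ₂]` would miss everything up to `c`.
  · intro j hj1 hj2 hcj
    by_contra! h
    have h4 : c ≤ leftNbr t (candidatesIn C t) (t + (j : ℝ) / (15 * k)) := le_leftNbr hcC hcj
    have h5 : leftNbr t (candidatesIn C t) (t + (j : ℝ) / (15 * k)) ≤ t + (j : ℝ) / (15 * k) :=
      leftNbr_le (by linarith [hct, hcj])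
    obtain ⟨y', q1, q2, q3⟩ := hspec.below _ (mem_positions.2 (Or.inr ⟨j, ⟨hj1, hj2⟩, Or.inl rfl⟩))
      (hct.trans_le h4) (h5.trans_lt h)
    have h6 : y' ≤ leftNbr t (pointAnswers false D) φ₂ :=
      le_leftNbr (hD.mem_pointAnswers.2 q1) (by linarith [h2.2.1])
    linarith [hr1.1, hr2.2]
  · intro j hj1 hj2 hcj
    by_contra! h
    have h4 : rightNbr t (candidatesIn C t) (t + (j : ℝ) / (15 * k)) ≤ c := rightNbr_le hcC hcj
    have h5 : t + (j : ℝ) / (15 * k) ≤ rightNbr t (candidatesIn C t) (t + (j : ℝ) / (15 * k)) :=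
      le_rightNbr (by linarith [hct', hcj])
    obtain ⟨y', q1, q2, q3⟩ := hspec.above _ (mem_positions.2 (Or.inr ⟨j, ⟨hj1, hj2⟩, Or.inr rfl⟩))
      (h4.trans_lt hct') (h.trans_le h5)
    have h6 : rightNbr t (pointAnswers false D) φ₃ ≤ y' :=
      rightNbr_le (hD.mem_pointAnswers.2 q1) (by linarith [h3.2.2])
    linarith [hr1'.2, hr2'.1]

/-- Here the number of rounds matters: the mesh of the last round is `2⁻ᴿ ≤ 1 / |P_t| ≤ 1 / (15 k)`,
and a longer interval approves some query. -/
theorem short_of_not_approvedSome {ι : Type} {v : ι} {u : ℝ × ℝ} {D : Dialogue ι} {s : Finset ℝ}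
    (hk1 : 1 ≤ k) (hsize : 15 * k ≤ size multi (positions M C k tie t))
    (hspec : ResolveSpec C (positions M C k tie t).toFinset v u t
      (Nat.clog 2 (size multi (positions M C k tie t))) (s, D)) (hD : ¬ ApprovedSome D) :
    u.2 - u.1 < 1 / (15 * k) := by
  have h1 := not_le.1 fun h => hD (hspec.approvedSome h)
  refine h1.trans_le ?_
  rw [one_div]
  have hk' : (0 : ℝ) < k := by exact_mod_cast hk1
  refine inv_anti₀ (by positivity) ?_
  have := hsize.trans (Nat.le_pow_clog one_lt_two _)
  exact_mod_cast this

theorem le_size_positions (hsize : multi = true ∨ ∀ t ∈ Finset.Icc 1 M.σ, 0 < M.p t →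
      15 * k ≤ (positions M C k tie t).toFinset.card) (ht : t ∈ Finset.Icc 1 M.σ)
    (hp : 0 < M.p t) : 15 * k ≤ size multi (positions M C k tie t) := by
  unfold size
  split_ifs with h
  · rw [card_positions]; omega
  · exact hsize.resolve_left h t ht hp

/-- The number of members of the guess near a candidate `c` bounds the probability of the box
around `c`. -/
theorem box_le (htie : ∀ s : Finset ℝ, s.Nonempty → tie s ∈ s) {c : ℝ} (hc : c ∈ C)
    (hcW : c ∉ guess M C k tie) (ht : t ∈ Finset.Icc 1 M.σ) (h1 : (t : ℝ) < c) (h2 : c < t + 1)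
    (R : Finset ℝ) :
    2 * ((seats M k t : ℝ) + 1) * ((c - leftNbr t (guess M C k tie \ R) c) *
      (rightNbr t (guess M C k tie \ R) c - c)) + 1 / 3 ≤ R.card + 1 := by
  have hsub : guessIn M C k tie t ⊆ guess M C k tie :=
    Finset.subset_biUnion_of_mem (fun t => guessIn M C k tie t) ht
  have hcS : c ∉ guess M C k tie \ R := fun h => hcW (Finset.mem_sdiff.1 h).1
  have hcC : c ∈ candidatesIn C t \ guessIn M C k tie t :=
    Finset.mem_sdiff.2 ⟨mem_candidatesIn.2 ⟨hc, h1.le, h2.le⟩, fun h => hcW (hsub h)⟩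
  -- The candidate `c` itself is left over, so `exists_greedy_enumeration` applies and compares
  -- every selected candidate with `c`.
  obtain ⟨d, hinj, hmem, hle⟩ := exists_greedy_enumeration htie (candidatesIn C t)
    (fun ξ c => |c - t - markedPoint (seats M k t) ξ|) (seats M k t)
    (by rw [← guessIn_eq_greedy]; exact ⟨c, hcC⟩)
  rw [← guessIn_eq_greedy] at hmem hle
  set S := guess M C k tie \ R with hS
  have hSG : ∀ x ∈ S, x ∈ guess M C k tie := fun x hx => (Finset.mem_sdiff.1 hx).1
  have hyle : leftNbr t S c ≤ c := leftNbr_le h1.le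
  have hzle : c ≤ rightNbr t S c := le_rightNbr h2.le
  have hy0 : (t : ℝ) ≤ leftNbr t S c := start_le_leftNbr
  have hz1 : rightNbr t S c ≤ t + 1 := rightNbr_le_end
  have hyc : leftNbr t S c < c := by
    rcases leftNbr_mem (t := t) (T := S) (x := c) with h | h
    · rw [h]; exact h1
    · exact lt_of_le_of_ne h.2 fun he => hcS (he ▸ h.1)
  have hcz : c < rightNbr t S c := by
    rcases rightNbr_mem (t := t) (T := S) (x := c) with h | h
    · rw [h]; exact h2
    · exact lt_of_le_of_ne h.2 fun he => hcS (he ▸ h.1)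
  have hdmem : ∀ ξ ∈ Set.Icc 2 (seats M k t + 1), d ξ ∈ guessIn M C k tie t := fun ξ hξ =>
    (hmem _).2 ⟨ξ, hξ, rfl⟩
  have hdS : ∀ ξ ∈ Set.Icc 2 (seats M k t + 1), d ξ ∉ R → d ξ ∈ S := fun ξ hξ h =>
    Finset.mem_sdiff.2 ⟨hsub (hdmem ξ hξ), h⟩
  have hdt : ∀ ξ ∈ Set.Icc 2 (seats M k t + 1), (t : ℝ) ≤ d ξ ∧ d ξ ≤ t + 1 := fun ξ hξ =>
    (mem_candidatesIn.1 (guessIn_subset htie (hdmem ξ hξ))).2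
  obtain ⟨U, V, hUV, hU, hV⟩ := exists_marked_range (R := R) hinj
    (fun ξ hξ => hle ξ hξ c hcC)
    (fun ξ hξ he => (Finset.mem_sdiff.1 hcC).2 (he ▸ hdmem ξ hξ)) hyc hcz
    (fun ξ hξ h3 h4 => by
      by_contra hR
      exact absurd (le_leftNbr (t := t) (hdS ξ hξ hR) h4.le) (not_le.2 h3))
    (fun ξ hξ h3 h4 => by
      by_contra hR
      exact absurd (rightNbr_le (t := t) (hdS ξ hξ hR) h3.le) (not_le.2 h4))
    (by
      by_cases hy : leftNbr t S c ∈ guessIn M C k tie t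
      · exact Or.inl ((hmem _).1 hy)
      -- The neighbour can be the end `t` even as a guess member contributed by the preceding
      -- segment only. A selected candidate of this segment outside `R` and left of `c` would have
      -- to coincide with it, which is excluded.
      · have hyt : leftNbr t S c = t := by
          rcases hy0.eq_or_lt with h | h
          · exact h.symm
          · exact absurd (mem_guessIn_of_mem_guess htie (hSG _ (leftNbr_mem_of_lt h)) h
              (hyle.trans_lt h2)) hy
        refine Or.inr ⟨hyt, fun ξ hξ h3 => ?_⟩
        by_contra hR
        have h4 := le_leftNbr (t := t) (hdS ξ hξ hR) h3.le
        have h5 : leftNbr t S c = d ξ := le_antisymm (hyt.le.trans (hdt ξ hξ).1) h4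
        exact hy (h5 ▸ hdmem ξ hξ))
    (by
      by_cases hz : rightNbr t S c ∈ guessIn M C k tie t
      · exact Or.inl ((hmem _).1 hz)
      · have hzt : rightNbr t S c = t + 1 := by
          rcases hz1.eq_or_lt with h | h
          · exact h
          · exact absurd (mem_guessIn_of_mem_guess htie (hSG _ (rightNbr_mem_of_lt h))
              (h1.trans_le hzle) h) hz
        refine Or.inr ⟨hzt, fun ξ hξ h3 => ?_⟩
        by_contra hR
        have h4 := rightNbr_le (t := t) (hdS ξ hξ hR) h3.le
        have h5 : rightNbr t S c = d ξ := le_antisymm h4 ((hdt ξ hξ).2.trans hzt.ge)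
        exact hz (h5 ▸ hdmem ξ hξ))
  have key := box_bound (m := (seats M k t : ℝ) + 1) (y := leftNbr t S c - t) (c := c - t)
    (z := rightNbr t S c - t) (U := U) (V := V) (N := R.card + 1)
    (by linarith [Nat.cast_nonneg (α := ℝ) (seats M k t)]) (by linarith) (by linarith)
    (by linarith) (by linarith) (by linarith [Nat.cast_nonneg (α := ℝ) R.card])
    (by exact_mod_cast hUV)
    (by
      rcases hU with ⟨h3, h4⟩ | h3
      · exact Or.inl ⟨by linarith, by exact_mod_cast h4⟩
      · exact Or.inr (by convert h3 using 3; ring))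
    (by
      rcases hV with ⟨h3, h4⟩ | h3
      · refine Or.inl ⟨by linarith, ?_⟩
        rw [h4]; push_cast; ring
      · exact Or.inr (by convert h3 using 3; ring))
  have e1 : c - t - (leftNbr t S c - t) = c - leftNbr t S c := by ring
  have e2 : rightNbr t S c - t - (c - t) = rightNbr t S c - c := by ring
  rwa [e1, e2] at key

/-- After multiplication by `k`, the slack `1/3` of the box bound covers `2/15` for the mixed terms
of the grid error, `1/450` for its quadratic term and `2/15` for the short intervals; more than
`1/20` is left for Hoeffding's inequality. -/
theorem probability_arith {p κ α β δ₁ δ₂ N ℓ k : ℝ} (hp1 : p ≤ 1) (hk : 1 ≤ k)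
    (hpk : p * k ≤ κ) (hα : 0 ≤ α) (hα1 : α ≤ 1) (hβ : 0 ≤ β) (hβ1 : β ≤ 1) (hδ₁ : 0 ≤ δ₁)
    (hδ₂ : 0 ≤ δ₂) (hδ : δ₁ + δ₂ = 1 / (15 * k)) (hbox : 2 * κ * (α * β) + 1 / 3 ≤ N)
    (hN : N ≤ ℓ) :
    p * (2 * ((α + δ₁) * (β + δ₂))) + 2 * (1 / (15 * k)) ≤ ℓ / k - 1 / (20 * k) := by
  have hk0 : 0 < k := by linarith
  have hδk : (δ₁ + δ₂) * k = 1 / 15 := by rw [hδ]; field_simp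
  have h1 : p * k * (2 * (α * β)) ≤ κ * (2 * (α * β)) := by gcongr
  have h2 : α * δ₂ + β * δ₁ ≤ δ₁ + δ₂ := by nlinarith
  have h3 : p * k * (2 * (α * δ₂ + β * δ₁)) ≤ 2 / 15 := by
    calc p * k * (2 * (α * δ₂ + β * δ₁)) ≤ 1 * k * (2 * (δ₁ + δ₂)) := by gcongr
      _ = 2 / 15 := by linarith
  have h4 : p * k * (2 * (δ₁ * δ₂)) ≤ 1 / 450 := by
    have h5 : 4 * (δ₁ * δ₂) ≤ (δ₁ + δ₂) ^ 2 := by nlinarith [sq_nonneg (δ₁ - δ₂)]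
    have h6 : (δ₁ + δ₂) ≤ 1 / 15 := by
      rw [← hδk]; nlinarith [add_nonneg hδ₁ hδ₂]
    calc p * k * (2 * (δ₁ * δ₂)) ≤ 1 * k * ((δ₁ + δ₂) ^ 2 / 2) := by gcongr; linarith
      _ = ((δ₁ + δ₂) * k) * (δ₁ + δ₂) / 2 := by ring
      _ ≤ 1 / 450 := by rw [hδk]; linarith
  have h5 : ℓ / k - 1 / (20 * k) - (p * (2 * ((α + δ₁) * (β + δ₂))) + 2 * (1 / (15 * k))) =
      (ℓ - 1 / 20 - 2 / 15 - p * k * (2 * (α * β)) - p * k * (2 * (α * δ₂ + β * δ₁)) -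
        p * k * (2 * (δ₁ * δ₂))) / k := by
    field_simp
    ring
  rw [← sub_nonneg, h5]
  apply div_nonneg _ hk0.le
  linarith

/-- The voters counted in one inequality of the validation test lie in an event of small
probability. -/
theorem exists_counting_event (htie : ∀ s : Finset ℝ, s.Nonempty → tie s ∈ s) (hk1 : 1 ≤ k)
    (hsize : multi = true ∨ ∀ t ∈ Finset.Icc 1 M.σ, 0 < M.p t →
      15 * k ≤ (positions M C k tie t).toFinset.card)
    {ℓ : ℕ} (hℓ : 1 ≤ ℓ) {c : ℝ} (hc : c ∈ C) (hcW : c ∉ guess M C k tie) {R : Finset ℝ}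
    (hR : R.card + 1 ≤ ℓ) :
    ∃ E : Set (ℝ × ℝ), MeasurableSet E ∧
      voterLaw M E ≤ ENNReal.ofReal ((ℓ : ℝ) / k - 1 / (20 * k)) ∧
      ∀ (n : ℕ) (ω : Fin n → ℝ × ℝ) (v : Fin n),
        (∃ t ∈ Finset.Icc 1 M.σ, 0 < M.p t ∧ InSegment (ω v) t) →
        (ApprovedSome (dialogues M C k tie multi ω v) →
          Poss (dialogues M C k tie multi ω v) c (guess M C k tie \ R)) → ω v ∈ E := by
  have hk' : (1 : ℝ) ≤ k := by exact_mod_cast hk1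
  have hk0 : (0 : ℝ) < k := by linarith
  set S := guess M C k tie \ R with hS
  have hshort : ∀ (n : ℕ) (ω : Fin n → ℝ × ℝ) (v : Fin n),
      (∃ t ∈ Finset.Icc 1 M.σ, 0 < M.p t ∧ InSegment (ω v) t) →
      ¬ ApprovedSome (dialogues M C k tie multi ω v) →
      ω v ∈ {u : ℝ × ℝ | u.2 - u.1 < 1 / (15 * k)} := by
    rintro n ω v ⟨t, ht, hp, hu⟩ h
    obtain ⟨-, s, hspec⟩ := dialogues_spec (C := C) (multi := multi) htie hk1 ht hu
    exact short_of_not_approvedSome hk1 (le_size_positions hsize ht hp) hspec h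
  -- If this fails, `c` is not interior to a segment of the model, so `Poss` holds for no voter and
  -- only the short intervals count.
  by_cases hcond : segmentOf c ∈ Finset.Icc 1 M.σ ∧ (segmentOf c : ℝ) < c
  swap
  · refine ⟨_, measurableSet_short (1 / (15 * k)), (voterLaw_short_le M _).trans ?_, ?_⟩
    · apply ENNReal.ofReal_le_ofReal
      have hℓ' : (1 : ℝ) ≤ ℓ := by exact_mod_cast hℓ
      have : (ℓ : ℝ) / k - 1 / (20 * k) - 2 * (1 / (15 * k)) = (ℓ - 1 / 20 - 2 / 15) / k := by
        field_simp
      rw [← sub_nonneg, this]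
      exact div_nonneg (by linarith) hk0.le
    · rintro n ω v hv h
      refine hshort n ω v hv fun happ => hcond ?_
      obtain ⟨t, ht, hp, hu⟩ := hv
      obtain ⟨hD, s, hspec⟩ := dialogues_spec (C := C) (multi := multi) htie hk1 ht hu
      obtain ⟨h1, h2, -⟩ := bounds_of_poss htie hu hD hspec hc Finset.sdiff_subset (h happ)
      rw [h1]
      exact ⟨ht, h2.1⟩
  · obtain ⟨ht, htc⟩ := hcond
    set t := segmentOf c with htdef
    have htc' : c < t + 1 := Nat.lt_floor_add_one c
    have hpos : (0 : ℝ) < 15 * k := by linarith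
    have hg : 0 < (c - t) * (15 * k) := mul_pos (by linarith) hpos
    have hi1 := Nat.le_ceil ((c - t) * (15 * k))
    have hi2 := Nat.ceil_lt_add_one hg.le
    have hi3 : 1 ≤ ⌈(c - t) * (15 * k)⌉₊ := Nat.ceil_pos.2 hg
    -- `c` lies between the consecutive grid points of indices `i - 1` and `i`, whose distances from
    -- `c` add up to the mesh `1 / (15 k)`.
    set i := ⌈(c - t) * (15 * k)⌉₊ with hidef
    have hi4 : i ≤ 15 * k := by
      have : (i : ℝ) < 15 * k + 1 := hi2.trans_le (by nlinarith)
      have : i < 15 * k + 1 := by exact_mod_cast this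
      omega
    have hx : c ≤ t + (i : ℝ) / (15 * k) := by
      have := (le_div_iff₀ hpos).2 hi1
      linarith
    have hx' : t + ((i : ℝ) - 1) / (15 * k) ≤ c := by
      have := (div_le_iff₀ hpos).2 (show (i : ℝ) - 1 ≤ (c - t) * (15 * k) by linarith)
      linarith
    have hy : leftNbr t S c ≤ c := leftNbr_le htc.le
    have hz : c ≤ rightNbr t S c := le_rightNbr htc'.le
    have hy0 : (t : ℝ) ≤ leftNbr t S c := start_le_leftNbr
    have hz1 : rightNbr t S c ≤ t + 1 := rightNbr_le_end
    refine ⟨boxEvent t (leftNbr t S c) (t + (i : ℝ) / (15 * k)) (t + ((i : ℝ) - 1) / (15 * k))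
      (rightNbr t S c) ∪ {u : ℝ × ℝ | u.2 - u.1 < 1 / (15 * k)},
      (measurableSet_boxEvent _ _ _ _ _).union (measurableSet_short _), ?_, ?_⟩
    · refine (measure_union_le _ _).trans ((add_le_add (voterLaw_boxEvent_le M ht (hy.trans hx))
        (voterLaw_short_le M _)).trans ?_)
      have hp0 := M.p_nonneg t ht
      rw [← ENNReal.ofReal_add (mul_nonneg hp0 (mul_nonneg (by norm_num)
        (mul_nonneg (by linarith) (by linarith)))) (by positivity)]
      apply ENNReal.ofReal_le_ofReal
      have key := probability_arith (p := M.p t) (κ := (seats M k t : ℝ) + 1)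
        (α := c - leftNbr t S c) (β := rightNbr t S c - c) (δ₁ := t + (i : ℝ) / (15 * k) - c)
        (δ₂ := c - (t + ((i : ℝ) - 1) / (15 * k))) (N := R.card + 1) (ℓ := ℓ) (k := k)
        (UniformRIV.p_le_one ht) hk' (Nat.lt_floor_add_one _).le (by linarith) (by linarith)
        (by linarith) (by linarith) (by linarith) (by linarith) (by ring)
        (box_le htie hc hcW ht htc htc' R) (by exact_mod_cast hR)
      refine le_trans (le_of_eq ?_) key
      ring
    · intro n ω v hv h
      by_cases happ : ApprovedSome (dialogues M C k tie multi ω v)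
      · left
        obtain ⟨t', ht', hp, hu⟩ := hv
        obtain ⟨hD, s, hspec⟩ := dialogues_spec (C := C) (multi := multi) htie hk1 ht' hu
        obtain ⟨h1, -, -, h3, h4, h5⟩ :=
          bounds_of_poss htie hu hD hspec hc Finset.sdiff_subset (h happ)
        have htt : t' = t := h1.symm
        subst htt
        refine ⟨hu, ⟨h3.1, h4 i hi3 hi4 hx⟩, ?_, h3.2⟩
        -- For `i = 1` the lower grid point is `t`, which is not among the query positions' grid
        -- points but bounds `u.2` trivially.
        rcases hi3.eq_or_lt with h6 | h6
        · rw [← h6]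
          simp only [Nat.cast_one, sub_self, zero_div, add_zero]
          linarith [hu.left, hu.le]
        · have := h5 (i - 1) (by omega) (by omega)
          rw [Nat.cast_sub hi3, Nat.cast_one] at this
          exact this hx'
      · exact Or.inr (hshort n ω v hv happ)

end Validation

/-! ### Failure probability of the validation test -/

section Test

variable {M : UniformRIV} {C : Finset ℝ} {k : ℕ} {tie : Finset ℝ → ℝ} {multi : Bool}

open scoped Classical in
/-- The voters of a profile in `E` are counted by the sum of the indicator function. -/
theorem sum_indicator_eq_card {n : ℕ} (E : Set (ℝ × ℝ)) (ω : Fin n → ℝ × ℝ) :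
    ∑ v, E.indicator (fun _ => (1 : ℝ)) (ω v) = (Finset.univ.filter fun v => ω v ∈ E).card := by
  simp only [Set.indicator_apply, Finset.sum_boole]

/-- One inequality of the validation test fails with exponentially small probability. -/
theorem exists_event_of_test_fails (htie : ∀ s : Finset ℝ, s.Nonempty → tie s ∈ s) (hk1 : 1 ≤ k)
    (hsize : multi = true ∨ ∀ t ∈ Finset.Icc 1 M.σ, 0 < M.p t →
      15 * k ≤ (positions M C k tie t).toFinset.card)
    {n : ℕ} (hn : 1 ≤ n) {ℓ : ℕ} (hℓ : 1 ≤ ℓ) {c : ℝ} (hc : c ∈ C) (hcW : c ∉ guess M C k tie)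
    (j : ℕ) :
    ∃ B : Set (Fin n → ℝ × ℝ), MeasurableSet B ∧
      profileLaw M n B ≤ ENNReal.ofReal (Real.exp (-(n / (200 * (k : ℝ) ^ 2)))) ∧
      ∀ ω, GoodProfile M ω →
        ¬ ((possibleCount (guess M C k tie) (dialogues M C k tie multi ω) ℓ c j : ℝ) +
          unapproving (dialogues M C k tie multi ω) < (n : ℝ) * ℓ / k) → ω ∈ B := by
  classical
  have hk' : (1 : ℝ) ≤ k := by exact_mod_cast hk1
  have hk0 : (0 : ℝ) < k := by linarith
  set ρ : ℤ := (((guess M C k tie).filter (· < c)).card : ℤ) with hρ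
  set R := slice (guess M C k tie) (ρ - j) (ρ + ℓ - 1 - j) with hRdef
  have hR : R.card + 1 ≤ ℓ := by
    have h := card_slice_le (guess M C k tie) (ρ - j) (ρ + ℓ - 1 - j)
    rw [← hRdef, show ρ + ℓ - 1 - j - (ρ - j) = (ℓ : ℤ) - 1 by ring] at h
    omega
  obtain ⟨E, hE, hEm, hEω⟩ := exists_counting_event (multi := multi) htie hk1 hsize hℓ hc hcW hR
  have hf : Measurable (E.indicator fun _ => (1 : ℝ)) := measurable_const.indicator hE
  have hm : ∫ u, E.indicator (fun _ => (1 : ℝ)) u ∂(voterLaw M) ≤ (ℓ : ℝ) / k - 1 / (20 * k) := by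
    rw [integral_indicator_const _ hE, smul_eq_mul, mul_one]
    refine ENNReal.toReal_le_of_le_ofReal ?_ hEm
    have hℓ' : (1 : ℝ) ≤ ℓ := by exact_mod_cast hℓ
    have : (ℓ : ℝ) / k - 1 / (20 * k) = (ℓ - 1 / 20) / k := by field_simp
    rw [this]
    exact div_nonneg (by linarith) hk0.le
  -- The threshold exceeds the bound on the mean by `1 / (20 k)`, which makes the Hoeffding exponent
  -- `2 n / (20 k)² = n / (200 k²)`.
  refine ⟨{ω | n * ((ℓ : ℝ) / k - 1 / (20 * k) + 1 / (20 * k)) ≤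
    ∑ v, E.indicator (fun _ => (1 : ℝ)) (ω v)}, ?_, ?_, ?_⟩
  · exact measurableSet_le measurable_const
      (Finset.measurable_sum _ fun v _ => hf.comp (measurable_pi_apply v))
  · refine (profileLaw_sum_ge_le M n hf one_pos (Set.indicator_nonneg fun _ _ => zero_le_one)
      (fun u => Set.indicator_le' (fun _ _ => le_rfl) (fun _ _ => zero_le_one) u) hm
      (by positivity) hn).trans (le_of_eq ?_)
    congr 3
    field_simp
    norm_num
  · intro ω hω hfail
    rw [not_lt] at hfail
    simp only [Set.mem_ofPred_eq]
    rw [sum_indicator_eq_card, sub_add_cancel, ← mul_div_assoc]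
    refine hfail.trans ?_
    rw [possibleCount, unapproving]
    rw [← Nat.cast_add, Nat.cast_le, ← Finset.card_union_of_disjoint]
    · refine Finset.card_le_card fun v hv => ?_
      simp only [Finset.mem_union, Finset.mem_filter, Finset.mem_univ, true_and] at hv ⊢
      refine hEω n ω v (hω v) fun happ => ?_
      exact (hv.resolve_right (not_not_intro happ)).2
    · rw [Finset.disjoint_left]
      intro v hv hv'
      simp only [Finset.mem_filter, Finset.mem_univ, true_and] at hv hv'
      exact hv' hv.1

/-- The guess passes the validation test outside an event of exponentially small probability. -/
theorem exists_event_of_not_validated (htie : ∀ s : Finset ℝ, s.Nonempty → tie s ∈ s)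
    (hk1 : 1 ≤ k) (hk : k ≤ C.card)
    (hsize : multi = true ∨ ∀ t ∈ Finset.Icc 1 M.σ, 0 < M.p t →
      15 * k ≤ (positions M C k tie t).toFinset.card) {n : ℕ} (hn : 1 ≤ n) :
    ∃ B : Set (Fin n → ℝ × ℝ), MeasurableSet B ∧
      profileLaw M n B ≤
        ENNReal.ofReal ((C.card : ℝ) ^ 3 * Real.exp (-(n / (200 * (k : ℝ) ^ 2)))) ∧
      ∀ ω, GoodProfile M ω →
        ¬ Validated C k (guess M C k tie) (dialogues M C k tie multi ω) → ω ∈ B := by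
  set T := Finset.Icc 1 k ×ˢ (C \ guess M C k tie) ×ˢ Finset.range k with hT
  have hex : ∀ x ∈ T, ∃ B : Set (Fin n → ℝ × ℝ), MeasurableSet B ∧
      profileLaw M n B ≤ ENNReal.ofReal (Real.exp (-(n / (200 * (k : ℝ) ^ 2)))) ∧
      ∀ ω, GoodProfile M ω →
        ¬ ((possibleCount (guess M C k tie) (dialogues M C k tie multi ω) x.1 x.2.1 x.2.2 : ℝ) +
          unapproving (dialogues M C k tie multi ω) < (n : ℝ) * x.1 / k) → ω ∈ B := by
    intro x hx
    simp only [hT, Finset.mem_product, Finset.mem_Icc, Finset.mem_sdiff] at hx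
    exact exists_event_of_test_fails htie hk1 hsize hn hx.1.1 hx.2.1.1 hx.2.1.2 x.2.2
  choose! B hBm hB hBω using hex
  refine ⟨⋃ x ∈ T, B x, T.measurableSet_biUnion hBm, ?_, ?_⟩
  · refine (measure_biUnion_finset_le _ _).trans ((Finset.sum_le_sum hB).trans ?_)
    rw [Finset.sum_const, nsmul_eq_mul, ← ENNReal.ofReal_natCast,
      ← ENNReal.ofReal_mul (Nat.cast_nonneg _)]
    apply ENNReal.ofReal_le_ofReal
    gcongr
    have h1 : T.card ≤ C.card ^ 3 := by
      rw [hT, Finset.card_product, Finset.card_product, Nat.card_Icc, Finset.card_range]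
      have := Finset.card_le_card (Finset.sdiff_subset (s := C) (t := guess M C k tie))
      calc (k + 1 - 1) * ((C \ guess M C k tie).card * k) ≤ C.card * (C.card * C.card) := by
            gcongr; omega
        _ = C.card ^ 3 := by ring
    exact_mod_cast h1
  · intro ω hω hV
    simp only [Validated, not_forall] at hV
    obtain ⟨ℓ, hℓ, c, hc, j, hj, hfail⟩ := hV
    rw [Finset.mem_Icc] at hℓ
    rw [Finset.mem_range] at hj
    refine Set.mem_biUnion (x := (ℓ, c, j)) ?_ (hBω (ℓ, c, j) ?_ ω hω hfail)
    all_goals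
      simp only [hT, Finset.coe_product, Set.mem_prod, Finset.mem_coe, Finset.mem_product,
        Finset.mem_Icc, Finset.mem_range]
      exact ⟨hℓ, hc, by omega⟩

end Test

/-! ### Cost of resolving one voter -/

section Cost

/-- The variable part of the number of queries of the second step, for approval interval
`[u.1, u.2]`. -/
def costBound (k : ℕ) (u : ℝ × ℝ) : ℝ :=
  12 * ∑ i ∈ Finset.range (Nat.clog 2 (31 * k)),
      2 ^ i * {u : ℝ × ℝ | u.2 - u.1 < (2 ^ i)⁻¹}.indicator (fun _ => (1 : ℝ)) u +
    403 * k * {u : ℝ × ℝ | u.2 - u.1 < 1 / (15 * k)}.indicator (fun _ => (1 : ℝ)) u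

variable {k : ℕ}

theorem indicator_one_nonneg {α : Type*} (S : Set α) (u : α) :
    0 ≤ S.indicator (fun _ => (1 : ℝ)) u :=
  Set.indicator_nonneg (fun _ _ => zero_le_one) u

theorem indicator_one_le {α : Type*} (S : Set α) (u : α) : S.indicator (fun _ => (1 : ℝ)) u ≤ 1 :=
  Set.indicator_le' (fun _ _ => le_rfl) (fun _ _ => zero_le_one) u

theorem measurable_costBound : Measurable (costBound k) := by
  have h : ∀ s : ℝ, Measurable ({u : ℝ × ℝ | u.2 - u.1 < s}.indicator fun _ => (1 : ℝ)) :=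
    fun s => measurable_const.indicator (measurableSet_short s)
  exact ((Finset.measurable_sum _ fun i _ => (h _).const_mul _).const_mul _).add
    ((h _).const_mul _)

theorem costBound_nonneg (u : ℝ × ℝ) : 0 ≤ costBound k u := by
  have h := fun S : Set (ℝ × ℝ) => indicator_one_nonneg S u
  have h1 : 0 ≤ ∑ i ∈ Finset.range (Nat.clog 2 (31 * k)),
      2 ^ i * {u : ℝ × ℝ | u.2 - u.1 < (2 ^ i)⁻¹}.indicator (fun _ => (1 : ℝ)) u :=
    Finset.sum_nonneg fun i _ => mul_nonneg (by positivity) (h _)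
  have h2 := mul_nonneg (show (0 : ℝ) ≤ 403 * k by positivity)
    (h {u : ℝ × ℝ | u.2 - u.1 < 1 / (15 * k)})
  unfold costBound
  linarith

theorem two_pow_clog_le {n : ℕ} (hn : 1 ≤ n) : 2 ^ Nat.clog 2 n ≤ 2 * n := by
  rcases hn.eq_or_lt with rfl | h
  · simp
  · have h1 := Nat.pow_pred_clog_lt_self (b := 2) one_lt_two h
    have h2 := Nat.clog_pos (b := 2) one_lt_two h
    obtain ⟨r, hr⟩ : ∃ r, Nat.clog 2 n = r + 1 := ⟨_, (Nat.succ_pred_eq_of_pos h2).symm⟩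
    rw [hr] at h1 ⊢
    rw [Nat.pred_succ] at h1
    rw [pow_succ]
    omega

theorem costBound_le (hk : 1 ≤ k) (u : ℝ × ℝ) : costBound k u ≤ 1147 * k := by
  have h := fun S : Set (ℝ × ℝ) => indicator_one_le S u
  have h1 : ∑ i ∈ Finset.range (Nat.clog 2 (31 * k)),
      2 ^ i * {u : ℝ × ℝ | u.2 - u.1 < (2 ^ i)⁻¹}.indicator (fun _ => (1 : ℝ)) u ≤ 62 * k := by
    calc _ ≤ ∑ i ∈ Finset.range (Nat.clog 2 (31 * k)), (2 : ℝ) ^ i :=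
          Finset.sum_le_sum fun i _ => mul_le_of_le_one_right (by positivity) (h _)
      _ ≤ 2 ^ Nat.clog 2 (31 * k) := by
          rw [geom_sum_eq (by norm_num)]
          norm_num
      _ ≤ 62 * k := by
          have := two_pow_clog_le (n := 31 * k) (by omega)
          have h' : (2 : ℕ) ^ Nat.clog 2 (31 * k) ≤ 62 * k := by omega
          exact_mod_cast h'
  have h2 := mul_le_of_le_one_right (show (0 : ℝ) ≤ 403 * k by positivity)
    (h {u : ℝ × ℝ | u.2 - u.1 < 1 / (15 * k)})
  unfold costBound
  linarith

theorem integral_short_le (M : UniformRIV) {s : ℝ} (hs : 0 ≤ s) :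
    ∫ u, {u : ℝ × ℝ | u.2 - u.1 < s}.indicator (fun _ => (1 : ℝ)) u ∂(voterLaw M) ≤ 2 * s := by
  rw [integral_indicator_const _ (measurableSet_short s), smul_eq_mul, mul_one]
  exact ENNReal.toReal_le_of_le_ofReal (by linarith) (voterLaw_short_le M s)

/-- The weight `2 ^ i` of a scale cancels against the probability `2 · 2⁻ⁱ` of an interval this
short. In the same way `403 k` cancels against `2 / (15 k)`. -/
theorem integral_costBound_le (M : UniformRIV) (hk : 1 ≤ k) :
    ∫ u, costBound k u ∂(voterLaw M) ≤ 24 * Nat.clog 2 (31 * k) + 54 := by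
  have hk' : (0 : ℝ) < k := by exact_mod_cast hk
  have hint : ∀ s : ℝ, Integrable ({u : ℝ × ℝ | u.2 - u.1 < s}.indicator fun _ => (1 : ℝ))
      (voterLaw M) := fun s => (integrable_const 1).indicator (measurableSet_short s)
  unfold costBound
  rw [integral_add ((integrable_finsetSum _ fun i _ => (hint _).const_mul _).const_mul _)
      ((hint _).const_mul _), integral_const_mul, integral_const_mul,
    integral_finsetSum _ fun i _ => (hint _).const_mul _]
  have h1 : ∑ i ∈ Finset.range (Nat.clog 2 (31 * k)), ∫ u, (2 : ℝ) ^ i *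
      {u : ℝ × ℝ | u.2 - u.1 < (2 ^ i)⁻¹}.indicator (fun _ => (1 : ℝ)) u ∂(voterLaw M) ≤
      2 * Nat.clog 2 (31 * k) := by
    calc _ ≤ ∑ i ∈ Finset.range (Nat.clog 2 (31 * k)), (2 : ℝ) := by
          refine Finset.sum_le_sum fun i _ => ?_
          rw [integral_const_mul]
          have := integral_short_le M (s := ((2 : ℝ) ^ i)⁻¹) (by positivity)
          calc _ ≤ (2 : ℝ) ^ i * (2 * (2 ^ i)⁻¹) := by gcongr
            _ = 2 := by field_simp
      _ = _ := by simp [mul_comm]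
  have h2 : 403 * (k : ℝ) * ∫ u, {u : ℝ × ℝ | u.2 - u.1 < 1 / (15 * k)}.indicator
      (fun _ => (1 : ℝ)) u ∂(voterLaw M) ≤ 54 := by
    have := integral_short_le M (s := 1 / (15 * (k : ℝ))) (by positivity)
    calc _ ≤ 403 * (k : ℝ) * (2 * (1 / (15 * k))) := by gcongr
      _ = 806 / 15 := by field_simp; norm_num
      _ ≤ 54 := by norm_num
  linarith

variable {ι : Type} {C : Finset ℝ} {v : ι} {u : ℝ × ℝ} {t : ℕ}

/-- Let `i` be the first round whose mesh is at most the length of the interval. The resolution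
costs about `3 · 2 ^ (i + 1) = 12 · 2 ^ (i - 1)` queries, and the interval is shorter than `2 ^ (-(i
- 1))`, so the term `i - 1` of the sum pays. If there is no such round, the second indicator pays.
-/
theorem ResolveSpec.length_le_costBound {P : Finset ℝ} {s : Finset ℝ} {D : Dialogue ι} {N : ℕ}
    (hspec : ResolveSpec C P v u t (Nat.clog 2 N) (s, D)) (hu : InSegment u t) (hk : 1 ≤ k)
    (hN : 15 * k ≤ N) (hN' : N ≤ 31 * k) (hP : P.card ≤ 31 * k) :
    (D.length : ℝ) ≤ costBound k u + 2 * Nat.clog 2 (31 * k + 1) := by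
  have hclog : Nat.clog 2 (P.card + 1) ≤ Nat.clog 2 (31 * k + 1) :=
    Nat.clog_mono_right 2 (by omega)
  have hRle : Nat.clog 2 N ≤ Nat.clog 2 (31 * k) := Nat.clog_mono_right 2 hN'
  have hind := fun S : Set (ℝ × ℝ) => indicator_one_nonneg S u
  have hsum0 : ∀ i ∈ Finset.range (Nat.clog 2 (31 * k)),
      0 ≤ 2 ^ i * {u : ℝ × ℝ | u.2 - u.1 < (2 ^ i)⁻¹}.indicator (fun _ => (1 : ℝ)) u := fun i _ =>
    mul_nonneg (by positivity) (hind _)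
  have h2 := mul_nonneg (show (0 : ℝ) ≤ 403 * k by positivity)
    (hind {u : ℝ × ℝ | u.2 - u.1 < 1 / (15 * k)})
  by_cases hlong : ∃ i, (1 ≤ i ∧ i ≤ Nat.clog 2 N) ∧ ((2 : ℝ) ^ i)⁻¹ ≤ u.2 - u.1
  · classical
    obtain ⟨⟨hi1, hiR⟩, hiL⟩ := Nat.find_spec hlong
    have hmin := fun m (h : m < Nat.find hlong) => Nat.find_min hlong h
    set i := Nat.find hlong with hi
    obtain ⟨i', hi'⟩ : ∃ i', i = i' + 1 := ⟨i - 1, by omega⟩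
    have hlt : u.2 - u.1 < ((2 : ℝ) ^ i')⁻¹ := by
      rcases Nat.eq_zero_or_pos i' with rfl | h0
      · simp only [pow_zero, inv_one]
        linarith [hu.left, hu.right]
      · by_contra! h
        exact hmin i' (by omega) ⟨⟨h0, by omega⟩, h⟩
    have hlen := hspec.length_le_of_long i hi1 hiR hiL
    have hterm := Finset.single_le_sum hsum0 (Finset.mem_range.2 (show i' < _ by omega))
    rw [Set.indicator_of_mem (show u ∈ {u : ℝ × ℝ | u.2 - u.1 < (2 ^ i')⁻¹} from hlt),
      mul_one] at hterm
    have h3 : D.length ≤ 12 * 2 ^ i' + 2 * Nat.clog 2 (31 * k + 1) := by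
      have : 3 * 2 ^ (i + 1) = 12 * 2 ^ i' := by rw [hi']; ring
      simp only at hlen
      omega
    have h4 : (D.length : ℝ) ≤ 12 * 2 ^ i' + 2 * Nat.clog 2 (31 * k + 1) := by exact_mod_cast h3
    unfold costBound
    linarith
  · have hR1 : 1 ≤ Nat.clog 2 N := Nat.clog_pos one_lt_two (by omega)
    have hshort : u.2 - u.1 < ((2 : ℝ) ^ Nat.clog 2 N)⁻¹ := by
      by_contra! h
      exact hlong ⟨_, ⟨hR1, le_rfl⟩, h⟩
    have hk' : (0 : ℝ) < k := by exact_mod_cast hk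
    have hmem : u ∈ {u : ℝ × ℝ | u.2 - u.1 < 1 / (15 * k)} := by
      refine lt_of_lt_of_le hshort ?_
      rw [one_div]
      refine inv_anti₀ (by positivity) ?_
      have := hN.trans (Nat.le_pow_clog one_lt_two N)
      exact_mod_cast this
    have hpow := two_pow_clog_le (n := N) (by omega)
    have hlen := hspec.length_le
    -- `3 · 2 ^ (R + 1) ≤ 12 N ≤ 372 k` for the rounds, and at most `31 k` for asking about all of
    -- `P`.
    have h3 : D.length ≤ 403 * k + 2 * Nat.clog 2 (31 * k + 1) := by
      simp only [pow_succ] at hlen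
      omega
    have h4 : (D.length : ℝ) ≤ 403 * k + 2 * Nat.clog 2 (31 * k + 1) := by exact_mod_cast h3
    unfold costBound
    rw [Set.indicator_of_mem hmem]
    have := Finset.sum_nonneg hsum0
    linarith

end Cost

/-! ### Expected and typical numbers of queries -/

section Bounds

variable {M : UniformRIV} {C : Finset ℝ} {k n : ℕ} {tie : Finset ℝ → ℝ} {multi : Bool}

theorem UniformRIV.one_le_σ (M : UniformRIV) : 1 ≤ M.σ := by
  by_contra! h
  have h1 := M.sum_p
  have : M.σ = 0 := by omega
  rw [this] at h1
  simp at h1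

theorem clog_le_log {m : ℕ} (hm : 1 ≤ m) : (Nat.clog 2 m : ℝ) ≤ 1 + 2 * Real.log m := by
  have h1 := two_pow_clog_le hm
  have hm' : (0 : ℝ) < m := by exact_mod_cast hm
  have h2 : (2 : ℝ) ^ Nat.clog 2 m ≤ 2 * m := by exact_mod_cast h1
  have h3 := Real.log_le_log (by positivity) h2
  rw [Real.log_pow, Real.log_mul (by norm_num) hm'.ne'] at h3
  have h4 := Real.log_two_gt_d9
  have h5 : 0 ≤ Real.log m := Real.log_nonneg (by exact_mod_cast hm)
  have h6 : ((Nat.clog 2 m : ℝ) - 1) * Real.log 2 ≤ Real.log m := by linarith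
  rcases le_total ((Nat.clog 2 m : ℝ) - 1) 0 with h | h
  · linarith
  · nlinarith

theorem log_mul_eq (M : UniformRIV) (hk : 1 ≤ k) :
    Real.log (M.σ * k) = Real.log M.σ + Real.log k ∧ 0 ≤ Real.log M.σ ∧ 0 ≤ Real.log (k : ℝ) := by
  have h1 : (1 : ℝ) ≤ M.σ := by exact_mod_cast M.one_le_σ
  have h2 : (1 : ℝ) ≤ k := by exact_mod_cast hk
  exact ⟨Real.log_mul (by linarith) (by linarith), Real.log_nonneg h1, Real.log_nonneg h2⟩

theorem clog_mul_le (hk : 1 ≤ k) {m : ℕ} (hm : 1 ≤ m) (hmk : m ≤ 32 * k) :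
    (Nat.clog 2 m : ℝ) ≤ 9 + 2 * Real.log k := by
  have hk' : (0 : ℝ) < k := by exact_mod_cast hk
  have h1 := clog_le_log hm
  have h2 : Real.log m ≤ Real.log 32 + Real.log k := by
    rw [← Real.log_mul (by norm_num) hk'.ne']
    refine Real.log_le_log (by exact_mod_cast hm) ?_
    exact_mod_cast hmk
  have h3 : Real.log 32 = 5 * Real.log 2 := by
    rw [show (32 : ℝ) = 2 ^ 5 by norm_num, Real.log_pow]; norm_num
  have h4 := Real.log_two_lt_d9
  linarith

/-- The number of queries of the second step. -/
theorem length_elicitPositions_le (htie : ∀ s : Finset ℝ, s.Nonempty → tie s ∈ s) (hk1 : 1 ≤ k)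
    (hsize : multi = true ∨ ∀ t ∈ Finset.Icc 1 M.σ, 0 < M.p t →
      15 * k ≤ (positions M C k tie t).toFinset.card)
    {ω : Fin n → ℝ × ℝ} (hω : GoodProfile M ω) (v : Fin n) :
    (((elicitPositions M C k tie multi v).run fun v => answer C (ω v)).2.length : ℝ) ≤
      22 * (1 + Real.log (M.σ * k)) + costBound k (ω v) := by
  obtain ⟨t, ht, hp, hu⟩ := hω v
  obtain ⟨-, s, hspec⟩ := dialogues_spec (C := C) (multi := multi) htie hk1 ht hu
  obtain ⟨h1, h2⟩ := run_elicitPositions (M := M) (k := k) (tie := tie)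
    (ans := fun w => answer C (ω w)) (v := v) (fun _ => rfl) hu ht hk1 multi
  rw [← h1] at h2
  have hcard := card_positions_le (C := C) (k := k) (tie := tie) ht
  have h3 := hspec.length_le_costBound hu hk1 (le_size_positions hsize ht hp)
    ((size_le_card _ _).trans hcard) ((Multiset.toFinset_card_le _).trans hcard)
  have h4 : (((elicitPositions M C k tie multi v).run fun v => answer C (ω v)).2.length : ℝ) ≤
      2 * (Nat.clog 2 M.σ + 1) + ((dialogues M C k tie multi ω v).length : ℝ) := by
    exact_mod_cast h2
  have h5 := clog_le_log M.one_le_σ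
  have h6 := clog_mul_le hk1 (m := 31 * k + 1) (by omega) (by omega)
  obtain ⟨h7, h8, h9⟩ := log_mul_eq M hk1
  rw [h7]
  linarith

/-- The number of queries of the fourth step. -/
theorem length_resolve_all_le (hk1 : 1 ≤ k) (hk : k ≤ C.card) {ω : Fin n → ℝ × ℝ}
    (hω : GoodProfile M ω) (v : Fin n) :
    (((resolve M.σ C multi v C.val).run fun v => answer C (ω v)).2.length : ℝ) ≤
      2 * (1 + Real.log (M.σ * k)) + 17 * C.card := by
  obtain ⟨t, ht, hp, hu⟩ := hω v
  have hC : 1 ≤ C.card := hk1.trans hk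
  obtain ⟨-, h1⟩ := run_resolve (ans := fun w => answer C (ω w)) (v := v) (fun _ => rfl) hu ht multi
    C.val
  have h2 := (run_resolveIn (ans := fun w => answer C (ω w)) (v := v) (P := C) (fun _ => rfl) hu
    (fun x hx _ _ => hx) (Nat.clog 2 (size multi C.val))).length_le
  have hsize : size multi C.val = C.card := by
    unfold size
    split_ifs
    · rfl
    · rw [Finset.val_toFinset]
  rw [Finset.val_toFinset] at h1
  rw [hsize] at h1 h2
  have h3 := two_pow_clog_le hC
  have h4 : Nat.clog 2 (C.card + 1) ≤ C.card :=
    Nat.clog_le_of_le_pow (Nat.lt_two_pow_self (n := C.card))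
  have h5 : ((resolve M.σ C multi v C.val).run fun v => answer C (ω v)).2.length ≤
      Nat.clog 2 M.σ + 1 + 15 * C.card := by
    rw [pow_succ] at h2
    omega
  have h6 : (((resolve M.σ C multi v C.val).run fun v => answer C (ω v)).2.length : ℝ) ≤
      Nat.clog 2 M.σ + 1 + 15 * C.card := by exact_mod_cast h5
  have h7 := clog_le_log M.one_le_σ
  obtain ⟨h8, h9, h10⟩ := log_mul_eq M hk1
  have h11 : (1 : ℝ) ≤ C.card := by exact_mod_cast hC
  rw [h8]
  linarith

/-- The number of queries put to a voter, in terms of an event that contains the profiles on which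
the test fails. -/
theorem queries_le (htie : ∀ s : Finset ℝ, s.Nonempty → tie s ∈ s) (hk1 : 1 ≤ k)
    (hk : k ≤ C.card)
    (hsize : multi = true ∨ ∀ t ∈ Finset.Icc 1 M.σ, 0 < M.p t →
      15 * k ≤ (positions M C k tie t).toFinset.card)
    {B : Set (Fin n → ℝ × ℝ)}
    (hB : ∀ ω, GoodProfile M ω →
      ¬ Validated C k (guess M C k tie) (dialogues M C k tie multi ω) → ω ∈ B)
    {ω : Fin n → ℝ × ℝ} (hω : GoodProfile M ω) (v : Fin n) :
    (queries M C k n tie multi v ω : ℝ) ≤ 22 * (1 + Real.log (M.σ * k)) + costBound k (ω v) +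
      B.indicator (fun _ => (1 : ℝ)) ω * (2 * (1 + Real.log (M.σ * k)) + 17 * C.card) := by
  have h1 := length_elicitPositions_le (C := C) htie hk1 hsize hω v
  have h2 := length_resolve_all_le (multi := multi) hk1 hk hω v
  have h0 := Nat.cast_nonneg (α := ℝ)
    ((resolve M.σ C multi v C.val).run fun v => answer C (ω v)).2.length
  have hI := indicator_one_nonneg B ω
  rw [queries_eq]
  split_ifs with hV
  · push_cast
    have := mul_nonneg hI (h0.trans h2)
    linarith
  · rw [Set.indicator_of_mem (hB ω hω hV)]
    push_cast
    linarith

theorem measurable_queries (v : Fin n) :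
    Measurable fun ω => (queries M C k n tie multi v ω : ℝ) := by
  have h : ∀ (w : Fin n) (q : Query), Measurable fun ω : Fin n → ℝ × ℝ => answer C (ω w) q :=
    fun w q => (measurable_answer C q).comp (measurable_pi_apply w)
  exact measurable_run h (findCommittee M C k n tie multi) fun z => (queryCount z.2 v : ℝ)

theorem integrable_queries (v : Fin n) :
    Integrable (fun ω => (queries M C k n tie multi v ω : ℝ)) (profileLaw M n) := by
  obtain ⟨B, hB⟩ := exists_length_le (findCommittee M C k n tie multi)
  refine integrable_of_bounded (measurable_queries v) (fun _ => Nat.cast_nonneg _) (B := B)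
    fun ω => ?_
  have : queries M C k n tie multi v ω ≤ B := List.countP_le_length.trans (hB _)
  exact_mod_cast this

theorem integral_costBound_eval (v : Fin n) :
    ∫ ω, costBound k (ω v) ∂(profileLaw M n) = ∫ u, costBound k u ∂(voterLaw M) := by
  have hmap : (profileLaw M n).map (fun ω => ω v) = voterLaw M :=
    (measurePreserving_eval (fun _ : Fin n => voterLaw M) v).map_eq
  rw [← hmap, integral_map (measurable_pi_apply v).aemeasurable
    measurable_costBound.aestronglyMeasurable]

theorem integral_costBound_le_log (M : UniformRIV) (hk : 1 ≤ k) :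
    ∫ u, costBound k u ∂(voterLaw M) ≤ 270 * (1 + Real.log (M.σ * k)) := by
  have h1 := integral_costBound_le M hk
  have h2 := clog_mul_le hk (m := 31 * k) (by omega) (by omega)
  obtain ⟨h3, h4, h5⟩ := log_mul_eq M hk
  rw [h3]
  linarith

/-- A polynomial in the number `m` of candidates is beaten by the exponential. -/
theorem pow_mul_exp_le {m : ℕ} (hm : 1 ≤ m) {x : ℝ} (r : ℕ) (h : r * Real.log m ≤ x) :
    (m : ℝ) ^ r * Real.exp (-x) ≤ 1 := by
  have hm' : (0 : ℝ) < m := by exact_mod_cast hm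
  have h1 : (m : ℝ) ^ r = Real.exp (r * Real.log m) := by
    rw [← Real.log_pow, Real.exp_log (by positivity)]
  rw [h1, ← Real.exp_add, Real.exp_le_one_iff]
  linarith

/-- Full elicitation costs `O(m)` queries per voter beyond the logarithmic term and happens with
probability at most `m³ exp(-n / (200 k²))`. The lower bound on `n` makes the product of this
probability with `m` at most `1`. -/
theorem integral_queries_le (htie : ∀ s : Finset ℝ, s.Nonempty → tie s ∈ s) (hk1 : 1 ≤ k)
    (hk : k ≤ C.card) (hn : 1 ≤ n) (hnk : 8000000 * (k : ℝ) ^ 2 * Real.log C.card ≤ n)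
    (hsize : multi = true ∨ ∀ t ∈ Finset.Icc 1 M.σ, 0 < M.p t →
      15 * k ≤ (positions M C k tie t).toFinset.card) (v : Fin n) :
    ∫ ω, (queries M C k n tie multi v ω : ℝ) ∂(profileLaw M n) ≤
      400 * (1 + Real.log (M.σ * k)) := by
  obtain ⟨B, hBm, hB, hBω⟩ := exists_event_of_not_validated (n := n) htie hk1 hk hsize hn
  have hC : 1 ≤ C.card := hk1.trans hk
  have hC' : (1 : ℝ) ≤ C.card := by exact_mod_cast hC
  have hk' : (0 : ℝ) < k := by exact_mod_cast hk1
  obtain ⟨h3, h4, h5⟩ := log_mul_eq M hk1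
  set Λ := 1 + Real.log (M.σ * k) with hΛ
  have hΛ1 : 1 ≤ Λ := by rw [hΛ, h3]; linarith
  have hlog : 0 ≤ Real.log C.card := Real.log_nonneg hC'
  have hint1 : Integrable (fun ω : Fin n → ℝ × ℝ => costBound k (ω v)) (profileLaw M n) :=
    integrable_of_bounded (measurable_costBound.comp (measurable_pi_apply v))
      (fun ω => costBound_nonneg _) fun ω => costBound_le hk1 _
  have hint2 : Integrable (fun ω : Fin n → ℝ × ℝ => B.indicator (fun _ => (1 : ℝ)) ω *
      (2 * Λ + 17 * C.card)) (profileLaw M n) :=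
    ((integrable_const 1).indicator hBm).mul_const _
  have hint0 : Integrable (fun ω : Fin n → ℝ × ℝ => 22 * Λ + costBound k (ω v))
      (profileLaw M n) := (integrable_const _).add hint1
  have hPB : (profileLaw M n).real B ≤
      (C.card : ℝ) ^ 3 * Real.exp (-(n / (200 * (k : ℝ) ^ 2))) :=
    ENNReal.toReal_le_of_le_ofReal (by positivity) hB
  have hx : ((4 : ℕ) : ℝ) * Real.log C.card ≤ n / (200 * (k : ℝ) ^ 2) := by
    rw [le_div_iff₀ (by positivity)]
    push_cast
    nlinarith [mul_nonneg hlog (sq_nonneg (k : ℝ))]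
  have hPB4 : C.card * (profileLaw M n).real B ≤ 1 := by
    calc C.card * (profileLaw M n).real B
        ≤ C.card * ((C.card : ℝ) ^ 3 * Real.exp (-(n / (200 * (k : ℝ) ^ 2)))) := by gcongr
      _ = (C.card : ℝ) ^ 4 * Real.exp (-(n / (200 * (k : ℝ) ^ 2))) := by ring
      _ ≤ 1 := pow_mul_exp_le hC 4 hx
  have hPB1 : (profileLaw M n).real B ≤ 1 := measureReal_le_one
  calc ∫ ω, (queries M C k n tie multi v ω : ℝ) ∂(profileLaw M n)
      ≤ ∫ ω, (22 * Λ + costBound k (ω v) + B.indicator (fun _ => (1 : ℝ)) ω *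
          (2 * Λ + 17 * C.card)) ∂(profileLaw M n) := by
        refine integral_mono_ae (integrable_queries v)
          (hint0.add hint2) ?_
        filter_upwards [ae_goodProfile M n] with ω hω
        exact queries_le htie hk1 hk hsize hBω hω v
    _ = 22 * Λ + ∫ u, costBound k u ∂(voterLaw M) +
          (profileLaw M n).real B * (2 * Λ + 17 * C.card) := by
        rw [integral_add hint0 hint2,
          integral_add (integrable_const _) hint1, integral_costBound_eval, integral_const, integral_mul_const,
          integral_indicator_const _ hBm]
        simp
    _ ≤ 400 * Λ := by
        have := integral_costBound_le_log M hk1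
        have h6 : (profileLaw M n).real B * (2 * Λ) ≤ 1 * (2 * Λ) := by gcongr
        nlinarith

/-- Two events are excluded: failure of the test, and an unusually large sum of the cost bounds. The
second is handled by Hoeffding's inequality with range `1147 k`, which is why the exponent is of
order `n / k²`. -/
theorem sum_queries_tail (htie : ∀ s : Finset ℝ, s.Nonempty → tie s ∈ s) (hk1 : 1 ≤ k)
    (hk : k ≤ C.card) (hn : 1 ≤ n) (hnk : 8000000 * (k : ℝ) ^ 2 * Real.log C.card ≤ n)
    (hsize : multi = true ∨ ∀ t ∈ Finset.Icc 1 M.σ, 0 < M.p t →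
      15 * k ≤ (positions M C k tie t).toFinset.card) :
    profileLaw M n {ω | 400 * (1 + Real.log (M.σ * k)) <
        (∑ v : Fin n, (queries M C k n tie multi v ω : ℝ)) / n} ≤
      ENNReal.ofReal (Real.exp (-(1 / 2000000 * n / (k : ℝ) ^ 2))) := by
  obtain ⟨B, hBm, hB, hBω⟩ := exists_event_of_not_validated (n := n) htie hk1 hk hsize hn
  have hC : 1 ≤ C.card := hk1.trans hk
  have hk' : (0 : ℝ) < k := by exact_mod_cast hk1
  have hn' : (0 : ℝ) < n := by exact_mod_cast hn
  obtain ⟨h3, h4, h5⟩ := log_mul_eq M hk1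
  set Λ := 1 + Real.log (M.σ * k) with hΛ
  have hΛ1 : 1 ≤ Λ := by rw [hΛ, h3]; linarith
  set y : ℝ := n / (k : ℝ) ^ 2 with hy
  have hy0 : 0 < y := by positivity
  set A : Set (Fin n → ℝ × ℝ) := {ω | n * (270 * Λ + 1) ≤ ∑ v, costBound k (ω v)} with hA
  have hPA : profileLaw M n A ≤ ENNReal.ofReal (Real.exp (-(1 / 1000000 * y))) := by
    refine (profileLaw_sum_ge_le M n measurable_costBound (B := 1147 * k) (by positivity)
      costBound_nonneg (costBound_le hk1) (integral_costBound_le_log M hk1) zero_le_one hn).trans ?_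
    apply ENNReal.ofReal_le_ofReal
    rw [Real.exp_le_exp, neg_le_neg_iff]
    have : 2 * (n : ℝ) * 1 ^ 2 / (1147 * k) ^ 2 = 2 / 1147 ^ 2 * y := by
      rw [hy]; field_simp
    rw [this]
    exact mul_le_mul_of_nonneg_right (by norm_num) hy0.le
  have hexp : Real.exp (-(1 / 2000000 * n / (k : ℝ) ^ 2)) = Real.exp (-(1 / 2000000 * y)) := by
    rw [hy, mul_div_assoc]
  rw [hexp]
  have hsum : ∀ ω, GoodProfile M ω → ω ∉ A →
      (∑ v : Fin n, (queries M C k n tie multi v ω : ℝ)) / n ≤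
        293 * Λ + B.indicator (fun _ => (1 : ℝ)) ω * (2 * Λ + 17 * C.card) := by
    intro ω hω hωA
    rw [div_le_iff₀ hn']
    have h1 : ∑ v : Fin n, (queries M C k n tie multi v ω : ℝ) ≤ ∑ v : Fin n,
        (22 * Λ + costBound k (ω v) + B.indicator (fun _ => (1 : ℝ)) ω *
          (2 * Λ + 17 * C.card)) :=
      Finset.sum_le_sum fun v _ => queries_le htie hk1 hk hsize hBω hω v
    rw [Finset.sum_add_distrib, Finset.sum_add_distrib] at h1
    simp only [Finset.sum_const, Finset.card_univ, Fintype.card_fin, nsmul_eq_mul] at h1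
    simp only [hA, Set.mem_ofPred_eq, not_le] at hωA
    nlinarith
  -- For `m = 1` the lower bound on `n` is void and cannot absorb the factor `1 + m³`; but then full
  -- elicitation costs only `O(1 + log (σ k))` and failure of the test need not be excluded.
  rcases hC.eq_or_lt with hC1 | hC2
  · -- with a single candidate the fourth step is cheap
    have hsub : ∀ᵐ ω ∂(profileLaw M n), ω ∈ {ω | 400 * Λ <
        (∑ v : Fin n, (queries M C k n tie multi v ω : ℝ)) / n} → ω ∈ A := by
      filter_upwards [ae_goodProfile M n] with ω hω hlt
      by_contra hωA
      have h1 := hsum ω hω hωA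
      have h2 := indicator_one_le B ω
      rw [← hC1] at h1
      change 400 * Λ < (∑ v : Fin n, (queries M C k n tie multi v ω : ℝ)) / n at hlt
      have h6 : B.indicator (fun _ => (1 : ℝ)) ω * (2 * Λ + 17 * (1 : ℕ)) ≤
          1 * (2 * Λ + 17 * (1 : ℕ)) := by gcongr
      push_cast at h1 h6
      linarith
    refine (measure_mono_ae hsub).trans (hPA.trans (ENNReal.ofReal_le_ofReal ?_))
    rw [Real.exp_le_exp]
    linarith
  · have hsub : ∀ᵐ ω ∂(profileLaw M n), ω ∈ {ω | 400 * Λ <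
        (∑ v : Fin n, (queries M C k n tie multi v ω : ℝ)) / n} → ω ∈ A ∪ B := by
      filter_upwards [ae_goodProfile M n] with ω hω hlt
      by_contra hωAB
      rw [Set.mem_union, not_or] at hωAB
      have h1 := hsum ω hω hωAB.1
      rw [Set.indicator_of_notMem hωAB.2] at h1
      change 400 * Λ < (∑ v : Fin n, (queries M C k n tie multi v ω : ℝ)) / n at hlt
      linarith
    refine (measure_mono_ae hsub).trans ((measure_union_le _ _).trans
      ((add_le_add hPA hB).trans ?_))
    rw [← ENNReal.ofReal_add (by positivity) (by positivity)]
    apply ENNReal.ofReal_le_ofReal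
    have hm2 : (2 : ℝ) ≤ C.card := by exact_mod_cast hC2
    set m : ℝ := (C.card : ℝ) with hm
    have h1 : Real.exp (-(n / (200 * (k : ℝ) ^ 2))) ≤ Real.exp (-(1 / 1000000 * y)) := by
      rw [Real.exp_le_exp, neg_le_neg_iff]
      have : (n : ℝ) / (200 * (k : ℝ) ^ 2) = 1 / 200 * y := by rw [hy]; field_simp
      rw [this]
      exact mul_le_mul_of_nonneg_right (by norm_num) hy0.le
    have h2 : Real.exp (-(1 / 1000000 * y)) =
        Real.exp (-(1 / 2000000 * y)) * Real.exp (-(1 / 2000000 * y)) := by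
      rw [← Real.exp_add]; congr 1; ring
    -- Half of the exponent is spent on the polynomial factor; this step determines the constant
    -- `8000000 = 4 · 2000000`.
    have h6 : m ^ 4 * Real.exp (-(1 / 2000000 * y)) ≤ 1 := by
      refine pow_mul_exp_le hC 4 ?_
      have : 8000000 * Real.log C.card ≤ y := by
        rw [hy, le_div_iff₀ (by positivity)]
        linarith
      push_cast
      linarith
    have h7 : 1 + m ^ 3 ≤ m ^ 4 := by
      have : 8 ≤ m ^ 3 := by
        calc (8 : ℝ) = 2 ^ 3 := by norm_num
          _ ≤ m ^ 3 := by gcongr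
      nlinarith
    have h8 := Real.exp_pos (-(1 / 2000000 * y))
    calc Real.exp (-(1 / 1000000 * y)) + m ^ 3 * Real.exp (-(n / (200 * (k : ℝ) ^ 2)))
        ≤ Real.exp (-(1 / 1000000 * y)) + m ^ 3 * Real.exp (-(1 / 1000000 * y)) := by gcongr
      _ = (1 + m ^ 3) * Real.exp (-(1 / 1000000 * y)) := by ring
      _ ≤ m ^ 4 * Real.exp (-(1 / 1000000 * y)) := by gcongr
      _ = (m ^ 4 * Real.exp (-(1 / 2000000 * y))) * Real.exp (-(1 / 2000000 * y)) := by
          rw [h2]; ring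
      _ ≤ 1 * Real.exp (-(1 / 2000000 * y)) := by gcongr
      _ = Real.exp (-(1 / 2000000 * y)) := one_mul _

end Bounds

end RIV

end

theorem theorem2 :
    ∃ C₀ C₁ c₀ : ℝ, 0 < C₀ ∧ 0 < C₁ ∧ 0 < c₀ ∧
      ∀ (M : RIV.UniformRIV) (C : Finset ℝ) (k n : ℕ) (tie : Finset ℝ → ℝ) (multi : Bool),
        (C : Set ℝ) ⊆ Set.Icc (1 : ℝ) (M.σ + 1) →
        1 ≤ k → k ≤ C.card → 1 ≤ n →
        (∀ s : Finset ℝ, s.Nonempty → tie s ∈ s) →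
        (∀ᵐ ω ∂(RIV.profileLaw M n),
          RIV.PJRPlus C k (fun v => RIV.ballot C (ω v)) (RIV.output M C k n tie multi ω)) ∧
        (C₀ * (k : ℝ) ^ 2 * Real.log C.card ≤ n →
          (multi = true ∨ ∀ t ∈ Finset.Icc 1 M.σ, 0 < M.p t →
            15 * k ≤ (RIV.positions M C k tie t).toFinset.card) →
          (∀ v : Fin n,
            MeasureTheory.Integrable (fun ω => (RIV.queries M C k n tie multi v ω : ℝ))
              (RIV.profileLaw M n) ∧
            ∫ ω, (RIV.queries M C k n tie multi v ω : ℝ) ∂(RIV.profileLaw M n)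
              ≤ C₁ * (1 + Real.log (M.σ * k))) ∧
          RIV.profileLaw M n
              {ω | C₁ * (1 + Real.log (M.σ * k))
                < (∑ v : Fin n, (RIV.queries M C k n tie multi v ω : ℝ)) / n}
            ≤ ENNReal.ofReal (Real.exp (-(c₀ * n / (k : ℝ) ^ 2)))) := by
  -- `400` exceeds `22 + 270 + 1 + 2 + 17`: segment searches and binary searches, mean cost of the
  -- rounds, deviation, and full elicitation. `1 / 2000000` is half of `1 / 1000000 < 2 / 1147²`,
  -- the Hoeffding exponent of the cost.
  refine ⟨8000000, 400, 1 / 2000000, by norm_num, by norm_num, by norm_num, ?_⟩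
  intro M C k n tie multi _ hk1 hk hn htie
  refine ⟨?_, fun hnk hsize => ⟨fun v => ⟨RIV.integrable_queries v,
    RIV.integral_queries_le htie hk1 hk hn hnk hsize v⟩,
    RIV.sum_queries_tail htie hk1 hk hn hnk hsize⟩⟩
  filter_upwards [RIV.ae_goodProfile M n] with ω hω
  exact RIV.pjrPlus_output htie hk1 hk hn hω
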